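/- **Setting.** Let $U\subset\mathbb R$ be bounded, open, $0\in U$; $V\subset\mathbb R$ bounded, open, connected; $q>0$; $u:U\times V\to V$ and $v:U\times V\to\mathbb R$ real-analytic, $v$ bounded, such that, writing $u_b=u(b,\cdot)$: $u_0\equiv 0$; $|u_b'(x)|=|b|^q e^{v(b,x)}$ on $U\times V$; $\sup|u_b'|<1$ over $U\times V$; and $\bigcup_{b\in U}u_b(V)$ is precompact in $V$. An *index set* is a set $S\subset U\setminus\{0\}$ whose only accumulation point in $\mathbb R$, if any, is $0$. For an index set $S$ let $\pi:S^{\mathbb N}\to V$ be the coding map $\pi(\omega)=\lim_n u_{\omega_1}\circ\cdots\circ u_{\omega_n}(0)$ and $\Lambda_S$ its image. If $\sum_{b\in S}|b|^{qs}<\infty$, let $P(S,s)\in[-\infty,\infty)$ be the logarithm of the spectral radius of $\tilde L f(\omega)=\sum_{b\in S}|u_b'(\pi(\omega))|^s f(b*\omega)$ acting on the bounded continuous functions on $S^{\mathbb N}$, where $b*\omega$ is the word obtained by prepending $b$ to $\omega$; otherwise $P(S,s)=+\infty$. Let $\delta_S=\inf\{s\in\mathbb R:P(S,s)\le 0\}$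 and $\Theta_S=\inf\{s\in\mathbb R:P(S,s)<\infty\}$; $S$ is *regular* if $P(S,s)=0$ for some $s\ge0$. Fix an index set $S$ and $\delta\in\mathbb R$ with $\delta\ge\delta_S$ and $\delta>\Theta_S$. Fix open sets $U_{\mathbb C}\supset S\cup\{0\}$ and $V_{\mathbb C}\supset\overline{\Lambda_S}\cup\{0\}$ in $\mathbb C$, $V_{\mathbb C}$ connected, such that $u,v$ extend to bounded holomorphic maps $U_{\mathbb C}\times V_{\mathbb C}\to V_{\mathbb C}$, resp. $\to\mathbb C$, with $\sup\{|u_b'(x)|: b\in U\cap U_{\mathbb C},\,x\in V_{\mathbb C}\}<1$. Let $\mathcal B$ be the Banach space of bounded holomorphic functions on $V_{\mathbb C}$ with the sup norm, and for $f\in\mathcal B$, $\sigma\in\mathcal B^*$ let $f\sigma$ be the operator $f'\mapsto(\sigma f')f$. Put $$L_{T,s}f(x)=\sum_{b\in T}|b|^{qs}e^{sv(b,x)}f(u_b(x)),\quad h(x)=e^{\delta v(0,x)},\quad \nu f=f(0),\quad L_1=L_{S,\delta},\quad Q_1=\sum_{m\ge0}L_1^m,$$ $$\tilde c=1\Big/\sum_{m\ge0}\nu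 L_1^m h\ \ (\tilde c=0\text{ if the series diverges}),\qquad L=L_1+\tilde c\,h\nu,$$ $$\alpha_jf(x)=\tfrac1{j!}\sum_{b\in S}|b|^{q\delta}e^{\delta v(b,x)}\big(q\log|b|+v(b,x)\big)^jf(u_b(x)),$$ $$\beta_{i,j}f(x)=\tfrac1{i!\,j!}\,\partial_b^i\partial_\theta^j\big[e^{(\delta+\theta)v(b,x)}f(u_b(x))\big]_{b=\theta=0}.$$ For $g\in\mathcal B$, $\mu\in\mathcal B^*$ with $Lg=g$, $\mu L=\mu$ put $c=1/\mu g$, $R=L-c\,g\mu$, $Q=\sum_{n\ge0}R^n$. In formal variables $\eta_1,\eta_2,\dots,\theta,\xi$ put $\alpha=\sum_{j\ge1}\theta^j\alpha_j$, $$\beta=\xi h\nu+\sum_{j\ge1}(\tilde c+\xi)\theta^j\beta_{0,j}+\sum_{i\ge1}\sum_{j\ge0}\eta_i\theta^j\beta_{i,j},\qquad \Delta=\alpha+\beta,$$ $$\Xi=\sum_{p\ge0}\mu\Delta(Q\Delta)^pg=\sum_{I,j,k}c_{I,j,k}\,\eta_I\theta^j\xi^k,$$ where $I$ runs over finite multisets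 of positive integers (with multiplicity function $I(\cdot)$), $\eta_I=\prod_i\eta_i^{I(i)}$, $\#(I)=\sum_iI(i)$, $\Sigma(I)=\sum_i i\,I(i)$. Call $(g,\mu)$ *normalized* if $\mu h=\nu g=1$. For a regular index set $S'$ put $\theta(S')=\delta_{S'}-\delta$, $\eta_i(S')=\sum_{b\in S'}|b|^{q\delta_{S'}}b^i-\sum_{b\in S}|b|^{q\delta_{S'}}b^i$, $\xi(S')=\eta_0(S')-\tilde c$, $\eta(S')=\sup_{b\in S\triangle S'}|b|$, let $\Xi(S')$ be the value of the series $\Xi$ at these numbers, and let $L'=L_{S',\delta_{S'}}$, $L''=L_{S,\delta_{S'}}+\tilde c\,h\nu$, $\alpha(S')=L''-L$, $\beta(S')=L'-L''$. **Proposition 6.1.** (i) Suppose $S=\emptyset$. Then normalized pairs of fixed points exist, $h$ and $\nu$ are right and left fixed points of $L$, and every normalized pair $(g,\mu)$ satisfies $ag=h$, $b\mu=\nu$ for some nonzero scalars $a,b$. Moreover $\alpha=0$ (formally, and $\alpha(S')=0$ for every $S'$), $L_1=0$ and $Q_1=I$; and, after renormalizing so that $g=h$ and $\mu=\nu$, we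 have $c=\tilde c=1/\nu h$ (with $\nu h\ne0$), $L=c\,g\mu$, $R=0$, $Q=I$ and $$\Xi=\sum_{p\ge1}\nu\beta^ph .$$ The last identity holds as an identity of formal power series; and there is $\epsilon>0$ such that for every regular index set $S'$ with $\eta(S')\le\epsilon$ and $|\theta(S')|\le\epsilon$, the series $\Xi(S')$ converges absolutely and $\Xi(S')=\sum_{p\ge1}\nu\,\beta(S')^p\,h$, the latter series converging too. In (ii)–(iv) the coefficients $c_{I,j,k}$ are those of $\Xi$ for a normalized pair $(g,\mu)$; the claims hold for each such pair. (ii) If $v(0,\cdot)=0$, then $\beta_{i,j}=0$ whenever $j>i$. If furthermore $v(\cdot,0)=0$, then $\nu\beta_{i,j}=0$ whenever $j>0$. If both hold and $S=\emptyset$, then $c_{I,j,k}=0$ whenever $j\ge\Sigma(I)$ and $(I,j)\ne(\emptyset,0)$; in particular $c_{I,j,0}=0$ whenever $j\ge\Sigma(I)$, and $c_{I,j,k}=0$ whenever $j>\Sigma(I)$. (iii) If $v(0,\cdot)=0$ and $v(\cdot,0)=0$, then $\nu\beta_{i,j}h=0$ for all $(i,j)\ne(0,0)$. If furthermore $S=\emptyset$,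 then $c_{I,j,0}=0$ for all $I,j$ with $\#(I)<2$. (iv) If $\delta=0$, then $\beta_{i,0}g=\beta_{i,0}h=0$ for all $i>0$, and $c_{I,0,k}=0$ for all $k$ and all $I\ne\emptyset$. -/

import Mathlib

open Set Filter Topology BoundedContinuousFunction

noncomputable section

/-- A quintuple `(U, V, u, v, q)` generating a family of point-accumulating conformal
iterated function systems on the line: a real-analytic, uniformly contracting family of
self-maps `u b` of `V` with `|(u b)' x| = |b| ^ q * exp (v b x)`, normalized by `u 0 = 0`.
(Conformality in dimension one, i.e. `(u b)' x ≠ 0` for `b ≠ 0`, is contained in `deriv_eq`.) -/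
structure PACSystem where
  U : Set ℝ
  V : Set ℝ
  u : ℝ → ℝ → ℝ
  v : ℝ → ℝ → ℝ
  q : ℝ
  isOpen_U : IsOpen U
  bounded_U : Bornology.IsBounded U
  zero_mem_U : (0 : ℝ) ∈ U
  isOpen_V : IsOpen V
  bounded_V : Bornology.IsBounded V
  connected_V : IsConnected V
  analytic_u : AnalyticOnNhd ℝ (Function.uncurry u) (U ×ˢ V)
  contracting : ∃ lam < (1 : ℝ), ∀ b ∈ U, ∀ x ∈ V, |deriv (u b) x| ≤ lam
  precompact : ∃ K ⊆ V, IsCompact K ∧ ∀ b ∈ U, ∀ x ∈ V, u b x ∈ K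
  analytic_v : AnalyticOnNhd ℝ (Function.uncurry v) (U ×ˢ V)
  bounded_v : ∃ M : ℝ, ∀ b ∈ U, ∀ x ∈ V, |v b x| ≤ M
  q_pos : 0 < q
  deriv_eq : ∀ b ∈ U, ∀ x ∈ V, |deriv (u b) x| = |b| ^ q * Real.exp (v b x)
  u_zero : ∀ x ∈ V, u 0 x = 0

/-- The index set of a PACIFS over `D`: a subset of `U \ {0}` whose only accumulation point,
if any, is `0`. -/
structure PACSystem.IndexSet (D : PACSystem) where
  carrier : Set ℝ
  subset : carrier ⊆ D.U \ {0}
  accPt : ∀ x : ℝ, AccPt x (𝓟 carrier) → x = 0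

namespace PACSystem

variable {D : PACSystem}

theorem mapsTo_V {b x : ℝ} (hb : b ∈ D.U) (hx : x ∈ D.V) : D.u b x ∈ D.V := by
  obtain ⟨K, hK, -, h⟩ := D.precompact
  exact hK (h b hb x hx)

theorem zero_mem_V : (0 : ℝ) ∈ D.V := by
  obtain ⟨x, hx⟩ := D.connected_V.nonempty
  simpa [D.u_zero x hx] using D.mapsTo_V D.zero_mem_U hx

namespace IndexSet

variable (S : D.IndexSet)

theorem mem_U (b : S.carrier) : (b : ℝ) ∈ D.U := (S.subset b.2).1

theorem ne_zero (b : S.carrier) : (b : ℝ) ≠ 0 := (S.subset b.2).2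

/-- The symbolic space `S ^ ℕ`. -/
abbrev Word : Type := ℕ → S.carrier

variable {S} in
/-- The composition `u_{ω 0} ∘ ⋯ ∘ u_{ω (n - 1)}`. -/
def prefixMap (ω : S.Word) : ℕ → ℝ → ℝ
  | 0, x => x
  | n + 1, x => prefixMap ω n (D.u (ω n) x)

variable {S} in
/-- The coding map `ω ↦ lim_n u_{ω 0} ∘ ⋯ ∘ u_{ω (n - 1)} (x₀)`, with `x₀ = 0 ∈ V`. -/
def coding (ω : S.Word) : ℝ := limUnder atTop fun n => prefixMap ω n 0

/-- The limit set. -/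
def limitSet : Set ℝ := range (coding (S := S))

variable {S} in
/-- The word `b * ω`. -/
def consWord (b : S.carrier) (ω : S.Word) : S.Word
  | 0 => b
  | n + 1 => ω n

variable {S}

theorem prefixMap_mem (ω : S.Word) : ∀ (n : ℕ) {x : ℝ}, x ∈ D.V → prefixMap ω n x ∈ D.V
  | 0, _, hx => hx
  | n + 1, _, hx => prefixMap_mem ω n (D.mapsTo_V (S.mem_U _) hx)

theorem continuous_prefixMap (n : ℕ) : ∀ x : S.Word → ℝ, Continuous x → (∀ ω, x ω ∈ D.V) →
    Continuous fun ω => prefixMap ω n (x ω) := by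
  induction n with
  | zero => intro x hx _; exact hx
  | succ n ih =>
    intro x hx hV
    refine ih (fun ω => D.u (ω n) (x ω)) ?_ fun ω => D.mapsTo_V (S.mem_U _) (hV ω)
    have h1 : Continuous fun ω : S.Word => (((ω n : S.carrier) : ℝ), x ω) := by fun_prop
    exact D.analytic_u.continuousOn.comp_continuous h1 fun ω => ⟨S.mem_U _, hV ω⟩

theorem contraction_nonneg : ∃ lam : ℝ, 0 ≤ lam ∧ lam < 1 ∧ ∀ b ∈ D.U, ∀ x ∈ D.V, ∀ y ∈ D.V,
    |D.u b x - D.u b y| ≤ lam * |x - y| := by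
  obtain ⟨lam, h1, h⟩ := D.contracting
  have h0 : 0 ≤ lam := (abs_nonneg _).trans (h 0 D.zero_mem_U 0 D.zero_mem_V)
  refine ⟨lam, h0, h1, fun b hb x hx y hy => ?_⟩
  have hc : Convex ℝ D.V := D.connected_V.isPreconnected.ordConnected.convex
  have hd : ∀ z ∈ D.V, DifferentiableAt ℝ (D.u b) z := fun z hz =>
    ((D.analytic_u (b, z) ⟨hb, hz⟩).differentiableAt).comp z
      ((differentiableAt_const b).prodMk differentiableAt_id)
  simpa [Real.norm_eq_abs] using
    hc.norm_image_sub_le_of_norm_deriv_le hd (fun z hz => h b hb z hz) hy hx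

theorem tendstoUniformly_coding :
    TendstoUniformly (fun n (ω : S.Word) => prefixMap ω n 0) coding atTop := by
  obtain ⟨lam, h0, h1, h⟩ := contraction_nonneg (D := D)
  obtain ⟨C, hC⟩ := D.bounded_V.exists_norm_le
  have hpre : ∀ (ω : S.Word) (n : ℕ), ∀ x ∈ D.V, ∀ y ∈ D.V,
      |prefixMap ω n x - prefixMap ω n y| ≤ lam ^ n * |x - y| := by
    intro ω n
    induction n with
    | zero => intro x _ y _; simp [prefixMap]
    | succ n ih =>
      intro x hx y hy
      refine (ih _ (D.mapsTo_V (S.mem_U _) hx) _ (D.mapsTo_V (S.mem_U _) hy)).trans ?_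
      rw [pow_succ, mul_assoc]
      exact mul_le_mul_of_nonneg_left (h _ (S.mem_U _) x hx y hy) (pow_nonneg h0 n)
  have hdist : ∀ (ω : S.Word) (n : ℕ),
      dist (prefixMap ω n 0) (prefixMap ω (n + 1) 0) ≤ C * lam ^ n := by
    intro ω n
    have hV := D.mapsTo_V (S.mem_U (ω n)) D.zero_mem_V
    refine (hpre ω n 0 D.zero_mem_V _ hV).trans ?_
    rw [mul_comm]
    refine mul_le_mul_of_nonneg_right ?_ (pow_nonneg h0 n)
    simpa [Real.norm_eq_abs] using hC _ hV
  have hlim : ∀ ω : S.Word, Tendsto (fun n => prefixMap ω n 0) atTop (𝓝 (coding ω)) :=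
    fun ω => (cauchySeq_of_le_geometric lam C h1 (hdist ω)).tendsto_limUnder
  rw [Metric.tendstoUniformly_iff]
  intro ε hε
  have hz : Tendsto (fun n : ℕ => C * lam ^ n / (1 - lam)) atTop (𝓝 0) := by
    simpa using ((tendsto_pow_atTop_nhds_zero_of_lt_one h0 h1).const_mul C).div_const (1 - lam)
  filter_upwards [hz.eventually (gt_mem_nhds hε)] with n hn ω
  rw [dist_comm]
  exact (dist_le_of_le_geometric_of_tendsto lam C h1 (hdist ω) (hlim ω) n).trans_lt hn

theorem continuous_coding : Continuous (coding (S := S)) :=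
  tendstoUniformly_coding.continuous <| Eventually.frequently <| Eventually.of_forall fun n =>
    continuous_prefixMap n (fun _ => 0) continuous_const fun _ => D.zero_mem_V

theorem coding_mem (ω : S.Word) : coding ω ∈ D.V := by
  obtain ⟨K, hKV, hK, h⟩ := D.precompact
  have aux : ∀ (n : ℕ) (x : ℝ), x ∈ D.V → prefixMap ω (n + 1) x ∈ K := by
    intro n
    induction n with
    | zero => intro x hx; exact h _ (S.mem_U _) x hx
    | succ n ih => intro x hx; exact ih _ (D.mapsTo_V (S.mem_U _) hx)
  refine hKV (hK.isClosed.mem_of_tendsto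
    ((tendstoUniformly_coding (S := S)).tendsto_at ω) ?_)
  filter_upwards [eventually_ge_atTop 1] with n hn
  obtain ⟨m, rfl⟩ := Nat.exists_eq_add_of_le' hn
  exact aux m 0 D.zero_mem_V

theorem continuous_consWord (b : S.carrier) : Continuous (consWord b) := by
  refine continuous_pi fun n => ?_
  cases n with
  | zero => exact continuous_const
  | succ n => exact continuous_apply n

theorem continuous_weight (s : ℝ) (b : S.carrier) :
    Continuous fun ω : S.Word => |deriv (D.u b) (coding ω)| ^ s := by
  have h1 : Continuous fun ω : S.Word => D.v b (coding ω) :=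
    D.analytic_v.continuousOn.comp_continuous (continuous_const.prodMk continuous_coding)
      fun ω => ⟨S.mem_U b, coding_mem ω⟩
  have h2 : (fun ω : S.Word => |deriv (D.u b) (coding ω)| ^ s) =
      fun ω => (|(b : ℝ)| ^ D.q * Real.exp (D.v b (coding ω))) ^ s := by
    funext ω; rw [D.deriv_eq _ (S.mem_U b) _ (coding_mem ω)]
  rw [h2]
  refine Continuous.rpow_const (by fun_prop) fun ω => Or.inl ?_
  have := Real.rpow_pos_of_pos (abs_pos.2 (S.ne_zero b)) D.q
  positivity

theorem exists_weight_le (S : D.IndexSet) (s : ℝ) : ∃ M : ℝ, 0 ≤ M ∧ ∀ (b : S.carrier) (ω : S.Word),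
    |deriv (D.u b) (coding ω)| ^ s ≤ M * |(b : ℝ)| ^ (D.q * s) := by
  obtain ⟨M, hM⟩ := D.bounded_v
  refine ⟨Real.exp (|s| * M), (Real.exp_pos _).le, fun b ω => ?_⟩
  rw [D.deriv_eq _ (S.mem_U b) _ (coding_mem ω), Real.mul_rpow (by positivity) (by positivity),
    ← Real.rpow_mul (abs_nonneg _), mul_comm, ← Real.exp_mul]
  refine mul_le_mul_of_nonneg_right (Real.exp_le_exp.2 ?_) (by positivity)
  calc D.v b (coding ω) * s ≤ |D.v b (coding ω) * s| := le_abs_self _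
    _ = |s| * |D.v b (coding ω)| := by rw [abs_mul, mul_comm]
    _ ≤ |s| * M := mul_le_mul_of_nonneg_left (hM _ (S.mem_U b) _ (coding_mem ω)) (abs_nonneg s)

variable (S)

/-- The condition `∑_{b ∈ S} |b| ^ (q s) < ∞`. -/
def PowSummable (s : ℝ) : Prop := Summable fun b : S.carrier => |(b : ℝ)| ^ (D.q * s)

variable {S} in
theorem summable_symbolic {s : ℝ} (hs : S.PowSummable s) (f : S.Word →ᵇ ℂ) :
    ∃ B : S.carrier → ℝ, Summable B ∧ ∀ (b : S.carrier) (ω : S.Word),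
      ‖((|deriv (D.u b) (coding ω)| ^ s : ℝ) : ℂ) * f (consWord b ω)‖ ≤ B b * ‖f‖ := by
  obtain ⟨M, hM0, hM⟩ := S.exists_weight_le s
  refine ⟨fun b => M * |(b : ℝ)| ^ (D.q * s), hs.mul_left M, fun b ω => ?_⟩
  rw [norm_mul, Complex.norm_real, Real.norm_eq_abs, abs_of_nonneg (by positivity)]
  exact mul_le_mul (hM b ω) (f.norm_coe_le_norm _) (norm_nonneg _) (by positivity)

/-- The symbolic Perron--Frobenius operator on the space of bounded continuous functions on
`S ^ ℕ`, given by `(L f)(ω) = ∑_{b ∈ S} |(u b)' (π ω)| ^ s * f (b * ω)`. -/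
def symbolicOp (s : ℝ) (hs : S.PowSummable s) : (S.Word →ᵇ ℂ) →L[ℂ] (S.Word →ᵇ ℂ) :=
  have hsum : ∀ (f : S.Word →ᵇ ℂ) (ω : S.Word), Summable fun b : S.carrier =>
      ((|deriv (D.u b) (coding ω)| ^ s : ℝ) : ℂ) * f (consWord b ω) := fun f ω => by
    obtain ⟨B, hB, h⟩ := summable_symbolic hs f
    exact Summable.of_norm_bounded (hB.mul_right _) fun b => h b ω
  have hcont : ∀ f : S.Word →ᵇ ℂ, Continuous fun ω : S.Word => ∑' b : S.carrier,
      ((|deriv (D.u b) (coding ω)| ^ s : ℝ) : ℂ) * f (consWord b ω) := fun f => by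
    obtain ⟨B, hB, h⟩ := summable_symbolic hs f
    refine continuous_tsum (fun b => ?_) (hB.mul_right ‖f‖) fun b ω => h b ω
    exact (Complex.continuous_ofReal.comp (continuous_weight s b)).mul
      (f.continuous.comp (continuous_consWord b))
  have hbd : ∃ C : ℝ, 0 ≤ C ∧ ∀ (f : S.Word →ᵇ ℂ) (ω : S.Word), ‖∑' b : S.carrier,
      ((|deriv (D.u b) (coding ω)| ^ s : ℝ) : ℂ) * f (consWord b ω)‖ ≤ C * ‖f‖ := by
    obtain ⟨M, hM0, hM⟩ := S.exists_weight_le s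
    refine ⟨∑' b : S.carrier, M * |(b : ℝ)| ^ (D.q * s), tsum_nonneg fun b => by positivity,
      fun f ω => ?_⟩
    rw [← tsum_mul_right]
    refine tsum_of_norm_bounded ((hs.mul_left M).mul_right ‖f‖).hasSum fun b => ?_
    rw [norm_mul, Complex.norm_real, Real.norm_eq_abs, abs_of_nonneg (by positivity)]
    exact mul_le_mul (hM b ω) (f.norm_coe_le_norm _) (norm_nonneg _) (by positivity)
  LinearMap.mkContinuousOfExistsBound
    { toFun := fun f => BoundedContinuousFunction.ofNormedAddCommGroup
        (fun ω : S.Word => ∑' b : S.carrier,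
          ((|deriv (D.u b) (coding ω)| ^ s : ℝ) : ℂ) * f (consWord b ω))
        (hcont f) (hbd.choose * ‖f‖) (hbd.choose_spec.2 f)
      map_add' := fun f g => by
        ext ω
        simp only [coe_ofNormedAddCommGroup, coe_add, Pi.add_apply, mul_add]
        exact (hsum f ω).tsum_add (hsum g ω)
      map_smul' := fun c f => by
        ext ω
        simp only [coe_ofNormedAddCommGroup, coe_smul, RingHom.id_apply, smul_eq_mul,
          ← tsum_mul_left]
        exact tsum_congr fun b => by ring }
    ⟨hbd.choose, fun f => BoundedContinuousFunction.norm_ofNormedAddCommGroup_le _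
      (mul_nonneg hbd.choose_spec.1 (norm_nonneg f)) (hbd.choose_spec.2 f)⟩

open Classical in
/-- The pressure `P(S, s)`: the logarithm of the spectral radius of the symbolic operator,
and `+∞` if that operator is not defined. -/
def pressure (s : ℝ) : EReal :=
  if hs : S.PowSummable s then ENNReal.log (spectralRadius ℂ (S.symbolicOp s hs)) else ⊤

/-- `S` is regular: `P(S, s) = 0` for some `s ≥ 0`. -/
def IsRegular : Prop := ∃ s : ℝ, 0 ≤ s ∧ S.pressure s = 0

/-- The Bowen parameter `δ_S = inf {s ∈ ℝ : P(S, s) ≤ 0}`. -/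
def bowen : EReal := sInf ((fun s : ℝ => (s : EReal)) '' {s | S.pressure s ≤ 0})

/-- The finiteness parameter `Θ_S = inf {s ∈ ℝ : P(S, s) < ∞}`. -/
def finiteness : EReal := sInf ((fun s : ℝ => (s : EReal)) '' {s | S.pressure s < ⊤})

end IndexSet

end PACSystem

/-- The bounded holomorphic functions on `W ⊆ ℂ`, as a subspace of the bounded continuous ones. -/
def bddHolSubmodule (W : Set ℂ) : Submodule ℂ (W →ᵇ ℂ) where
  carrier := {f | ∃ F : ℂ → ℂ, DifferentiableOn ℂ F W ∧ ∀ z : W, f z = F z}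
  add_mem' := by
    rintro f g ⟨F, hF, hf⟩ ⟨G, hG, hg⟩
    exact ⟨F + G, hF.add hG, fun z => by simp [hf, hg]⟩
  zero_mem' := ⟨0, differentiableOn_const 0, fun z => by simp⟩
  smul_mem' := by
    rintro c f ⟨F, hF, hf⟩
    exact ⟨c • F, hF.const_smul c, fun z => by simp [hf]⟩

/-- The space of bounded holomorphic functions on `W ⊆ ℂ`, with the sup norm. -/
def BddHol (W : Set ℂ) : Type := bddHolSubmodule W

namespace BddHol

variable {W : Set ℂ}

instance : NormedAddCommGroup (BddHol W) :=
  inferInstanceAs (NormedAddCommGroup (bddHolSubmodule W))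

instance : NormedSpace ℂ (BddHol W) :=
  inferInstanceAs (NormedSpace ℂ (bddHolSubmodule W))

/-- The inclusion into the bounded continuous functions. -/
def toBCF : BddHol W →L[ℂ] (W →ᵇ ℂ) := (bddHolSubmodule W).subtypeL

theorem toBCF_injective : Function.Injective (toBCF (W := W)) := Subtype.val_injective

theorem norm_toBCF (f : BddHol W) : ‖toBCF f‖ = ‖f‖ := rfl

theorem exists_eqOn (f : BddHol W) :
    ∃ F : ℂ → ℂ, DifferentiableOn ℂ F W ∧ ∀ z : W, toBCF f z = F z :=
  Subtype.property (p := fun g => g ∈ bddHolSubmodule W) f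

open Classical in
/-- The value of `f` at a point of `W` (and `0` outside `W`). -/
def ev (f : BddHol W) (z : ℂ) : ℂ := if h : z ∈ W then toBCF f ⟨z, h⟩ else 0

theorem ev_coe (f : BddHol W) (z : W) : f.ev z = toBCF f z := by simp [ev]

theorem differentiableOn_ev (f : BddHol W) : DifferentiableOn ℂ f.ev W := by
  obtain ⟨F, hF, h⟩ := f.exists_eqOn
  exact hF.congr fun z hz => by rw [← h ⟨z, hz⟩, ← ev_coe]

theorem norm_ev_le (f : BddHol W) (z : ℂ) : ‖f.ev z‖ ≤ ‖f‖ := by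
  by_cases h : z ∈ W
  · rw [f.ev_coe ⟨z, h⟩]; exact (toBCF f).norm_coe_le_norm _
  · rw [ev, dif_neg h, norm_zero]; exact norm_nonneg f

theorem ev_add (f g : BddHol W) (z : ℂ) : (f + g).ev z = f.ev z + g.ev z := by
  by_cases h : z ∈ W <;> simp [ev, h]

theorem ev_smul (c : ℂ) (f : BddHol W) (z : ℂ) : (c • f).ev z = c * f.ev z := by
  by_cases h : z ∈ W <;> simp [ev, h]

theorem ext_ev {f g : BddHol W} (h : ∀ z ∈ W, f.ev z = g.ev z) : f = g := by
  refine toBCF_injective (BoundedContinuousFunction.ext fun z => ?_)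
  exact ((ev_coe f z).symm.trans (h z z.2)).trans (ev_coe g z)

/-- The element of `BddHol W` given by a function holomorphic and bounded on `W`. -/
def mk (F : ℂ → ℂ) (hd : DifferentiableOn ℂ F W) (hb : ∃ C : ℝ, ∀ z ∈ W, ‖F z‖ ≤ C) : BddHol W :=
  ⟨BoundedContinuousFunction.ofNormedAddCommGroup (fun z : W => F z)
    (continuousOn_iff_continuous_domRestrict.1 hd.continuousOn) hb.choose
    fun z => hb.choose_spec z z.2, F, hd, fun _ => rfl⟩

theorem ev_mk {F : ℂ → ℂ} (hd : DifferentiableOn ℂ F W) (hb : ∃ C : ℝ, ∀ z ∈ W, ‖F z‖ ≤ C)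
    {z : ℂ} (hz : z ∈ W) : (mk F hd hb).ev z = F z :=
  (ev_coe _ ⟨z, hz⟩).trans rfl

theorem norm_mk_le {F : ℂ → ℂ} (hd : DifferentiableOn ℂ F W)
    (hb : ∃ C : ℝ, ∀ z ∈ W, ‖F z‖ ≤ C) {C : ℝ} (h0 : 0 ≤ C) (hC : ∀ z ∈ W, ‖F z‖ ≤ C) :
    ‖mk F hd hb‖ ≤ C :=
  (BoundedContinuousFunction.norm_le h0).2 fun z => hC z z.2

theorem complete (hW : IsOpen W) : CompleteSpace (BddHol W) := by
  have hc : IsClosed (bddHolSubmodule W : Set (W →ᵇ ℂ)) := by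
    refine isClosed_of_closure_subset fun f hf => ?_
    obtain ⟨F, hF, hlim⟩ := mem_closure_iff_seq_limit.1 hf
    let G : ℕ → ℂ → ℂ := fun n => ev ⟨F n, hF n⟩
    have hG : ∀ n, ∀ z : W, G n z = F n z := fun n z => ev_coe ⟨F n, hF n⟩ z
    classical
    let g : ℂ → ℂ := fun z => if h : z ∈ W then f ⟨z, h⟩ else 0
    have hg : ∀ z : W, g z = f z := fun z => by simp [g]
    refine ⟨g, ?_, fun z => (hg z).symm⟩
    have hu : TendstoUniformlyOn G g atTop W := by
      rw [Metric.tendstoUniformlyOn_iff]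
      intro ε hε
      filter_upwards [(Metric.tendsto_nhds.1 hlim) ε hε] with n hn z hz
      rw [hG n ⟨z, hz⟩, hg ⟨z, hz⟩, dist_comm]
      exact (BoundedContinuousFunction.dist_coe_le_dist _).trans_lt hn
    exact hu.tendstoLocallyUniformlyOn.differentiableOn
      (Eventually.of_forall fun n => differentiableOn_ev _) hW
  exact hc.completeSpace_coe

/-- A bounded operator on `BddHol W` given by a pointwise formula `(T f)(x) = t f x`. -/
def opOfFormula (t : BddHol W → ℂ → ℂ) (hd : ∀ f, DifferentiableOn ℂ (t f) W)
    (hadd : ∀ f g, ∀ x ∈ W, t (f + g) x = t f x + t g x)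
    (hsmul : ∀ (c : ℂ) f, ∀ x ∈ W, t (c • f) x = c * t f x)
    (hb : ∃ C : ℝ, 0 ≤ C ∧ ∀ f, ∀ x ∈ W, ‖t f x‖ ≤ C * ‖f‖) : BddHol W →L[ℂ] BddHol W :=
  have hb' : ∀ f, ∃ C : ℝ, ∀ x ∈ W, ‖t f x‖ ≤ C :=
    fun f => ⟨hb.choose * ‖f‖, hb.choose_spec.2 f⟩
  LinearMap.mkContinuousOfExistsBound
    { toFun := fun f => mk (t f) (hd f) (hb' f)
      map_add' := fun f g => ext_ev fun z hz => by
        rw [ev_add, ev_mk (hd _) (hb' _) hz, ev_mk (hd _) (hb' _) hz, ev_mk (hd _) (hb' _) hz,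
          hadd f g z hz]
      map_smul' := fun c f => ext_ev fun z hz => by
        rw [RingHom.id_apply, ev_smul, ev_mk (hd _) (hb' _) hz, ev_mk (hd _) (hb' _) hz,
          hsmul c f z hz] }
    ⟨hb.choose, fun f => norm_mk_le (hd f) (hb' f) (mul_nonneg hb.choose_spec.1 (norm_nonneg f))
      (hb.choose_spec.2 f)⟩

theorem ev_opOfFormula {t : BddHol W → ℂ → ℂ} (hd : ∀ f, DifferentiableOn ℂ (t f) W)
    (hadd : ∀ f g, ∀ x ∈ W, t (f + g) x = t f x + t g x)
    (hsmul : ∀ (c : ℂ) f, ∀ x ∈ W, t (c • f) x = c * t f x)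
    (hb : ∃ C : ℝ, 0 ≤ C ∧ ∀ f, ∀ x ∈ W, ‖t f x‖ ≤ C * ‖f‖) (f : BddHol W) {x : ℂ} (hx : x ∈ W) :
    (opOfFormula t hd hadd hsmul hb f).ev x = t f x :=
  ev_mk (hd f) ⟨hb.choose * ‖f‖, hb.choose_spec.2 f⟩ hx

end BddHol

/-- Complex neighbourhoods `U_ℂ ⊇ S ∪ {0}` and `V_ℂ ⊇ cl Λ_S` together with bounded holomorphic
extensions `u : U_ℂ × V_ℂ → V_ℂ` and `v : U_ℂ × V_ℂ → ℂ` of the data of the system, for which the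
real-parameter maps are still uniformly contracting.  For nonempty `S` the condition `0 ∈ V_ℂ`
follows from the others, since `u 0` is the constant `0`. -/
structure ComplexExtension (D : PACSystem) (S : D.IndexSet) where
  U : Set ℂ
  V : Set ℂ
  u : ℂ → ℂ → ℂ
  v : ℂ → ℂ → ℂ
  isOpen_U : IsOpen U
  isOpen_V : IsOpen V
  connected_V : IsConnected V
  zero_mem_U : (0 : ℂ) ∈ U
  subset_U : ∀ b ∈ S.carrier, (b : ℂ) ∈ U
  zero_mem_V : (0 : ℂ) ∈ V
  limitSet_subset_V : ∀ x ∈ closure S.limitSet, (x : ℂ) ∈ V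
  holo_u : AnalyticOnNhd ℂ (Function.uncurry u) (U ×ˢ V)
  holo_v : AnalyticOnNhd ℂ (Function.uncurry v) (U ×ˢ V)
  mapsTo_u : ∀ b ∈ U, ∀ x ∈ V, u b x ∈ V
  bounded_u : ∃ M : ℝ, ∀ b ∈ U, ∀ x ∈ V, ‖u b x‖ ≤ M
  bounded_v : ∃ M : ℝ, ∀ b ∈ U, ∀ x ∈ V, ‖v b x‖ ≤ M
  extends_u : ∀ b ∈ D.U, ∀ x ∈ D.V, (b : ℂ) ∈ U → (x : ℂ) ∈ V → u b x = D.u b x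
  extends_v : ∀ b ∈ D.U, ∀ x ∈ D.V, (b : ℂ) ∈ U → (x : ℂ) ∈ V → v b x = D.v b x
  contracting : ∃ lam < (1 : ℝ), ∀ b ∈ D.U, (b : ℂ) ∈ U → ∀ x ∈ V, ‖deriv (u b) x‖ ≤ lam

/-- The formal variables `η_i` (`i ≥ 1`), `θ` and `ξ`. -/
inductive SeriesVar
  | eta (i : ℕ+)
  | theta
  | xi

/-- The exponent of the monomial `η_I θ ^ j ξ ^ k`, for a multiset `I` of positive integers. -/
def monoExp (I : ℕ+ →₀ ℕ) (j k : ℕ) : SeriesVar →₀ ℕ :=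
  I.mapDomain SeriesVar.eta + Finsupp.single SeriesVar.theta j + Finsupp.single SeriesVar.xi k

/-- The formal power series `∑_a T a * X ^ (e a)`, where `e` is injective. -/
def formalSum {R ι : Type*} [Semiring R] (e : ι → SeriesVar →₀ ℕ) (T : ι → R) :
    MvPowerSeries SeriesVar R :=
  open Classical in fun m => ∑ᶠ a, if e a = m then T a else 0

/-- `#(I)`, the number of elements of the multiset `I`. -/
def multCard (I : ℕ+ →₀ ℕ) : ℕ := I.sum fun _ n => n

/-- `Σ(I)`, the sum of the elements of the multiset `I`. -/
def multSum (I : ℕ+ →₀ ℕ) : ℕ := I.sum fun i n => (i : ℕ) * n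

namespace ComplexExtension

variable {D : PACSystem} {S : D.IndexSet} (E : ComplexExtension D S)

/-- The Banach space of bounded holomorphic functions on `V_ℂ`. -/
abbrev B : Type := BddHol E.V

instance : CompleteSpace E.B := BddHol.complete E.isOpen_V

theorem differentiableAt_u {b x : ℂ} (hb : b ∈ E.U) (hx : x ∈ E.V) :
    DifferentiableAt ℂ (E.u b) x :=
  ((E.holo_u (b, x) ⟨hb, hx⟩).differentiableAt).comp x
    ((differentiableAt_const b).prodMk differentiableAt_id)

theorem differentiableAt_v {b x : ℂ} (hb : b ∈ E.U) (hx : x ∈ E.V) :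
    DifferentiableAt ℂ (E.v b) x :=
  ((E.holo_v (b, x) ⟨hb, hx⟩).differentiableAt).comp x
    ((differentiableAt_const b).prodMk differentiableAt_id)

theorem differentiableOn_comp_u (f : E.B) {b : ℂ} (hb : b ∈ E.U) :
    DifferentiableOn ℂ (fun x => f.ev (E.u b x)) E.V :=
  f.differentiableOn_ev.comp
    (fun _ hx => (E.differentiableAt_u hb hx).differentiableWithinAt)
    fun x hx => E.mapsTo_u b hb x hx

/-- The conditions under which `∑_{b ∈ T} m b x * f (u b x)` is a normally convergent series of
holomorphic functions for every `f`. -/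
def SumAdmissible (T : Set ℝ) (m : ℝ → ℂ → ℂ) : Prop :=
  (∀ b ∈ T, (b : ℂ) ∈ E.U) ∧ (∀ b ∈ T, DifferentiableOn ℂ (m b) E.V) ∧
    ∃ M : T → ℝ, Summable M ∧ ∀ (b : T), ∀ x ∈ E.V, ‖m b x‖ ≤ M b

open Classical in
/-- The operator `(A f)(x) = ∑_{b ∈ T} m b x * f (u b x)`. -/
def sumOp (T : Set ℝ) (m : ℝ → ℂ → ℂ) : E.B →L[ℂ] E.B :=
  if h : E.SumAdmissible T m then
    have hbd : ∀ (f : E.B) (M : T → ℝ), (∀ (b : T), ∀ x ∈ E.V, ‖m b x‖ ≤ M b) → ∀ (b : T),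
        ∀ x ∈ E.V, ‖m b x * f.ev (E.u b x)‖ ≤ M b * ‖f‖ := fun f M hM b x hx => by
      rw [norm_mul]
      exact mul_le_mul (hM b x hx) (f.norm_ev_le _) (norm_nonneg _)
        ((norm_nonneg _).trans (hM b x hx))
    have hsum : ∀ (f : E.B), ∀ x ∈ E.V, Summable fun b : T => m b x * f.ev (E.u b x) := by
      obtain ⟨-, -, M, hM, hb⟩ := h
      exact fun f x hx => Summable.of_norm_bounded (hM.mul_right ‖f‖) fun b => hbd f M hb b x hx
    BddHol.opOfFormula (fun f x => ∑' b : T, m b x * f.ev (E.u b x))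
      (fun f => by
        obtain ⟨h1, h2, M, hM, hb⟩ := h
        exact Complex.differentiableOn_tsum_of_summable_norm (hM.mul_right ‖f‖)
          (fun b => (h2 b b.2).mul (E.differentiableOn_comp_u f (h1 b b.2))) E.isOpen_V
          (hbd f M hb))
      (fun f g x hx => by
        rw [← (hsum f x hx).tsum_add (hsum g x hx)]
        exact tsum_congr fun b => by rw [BddHol.ev_add]; ring)
      (fun c f x hx => by
        rw [← tsum_mul_left]
        exact tsum_congr fun b => by rw [BddHol.ev_smul]; ring)
      (by
        obtain ⟨-, -, M, hM, hb⟩ := h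
        have h0 : ∀ b, 0 ≤ M b := fun b => (norm_nonneg _).trans (hb b 0 E.zero_mem_V)
        refine ⟨∑' b, M b, tsum_nonneg h0, fun f x hx => ?_⟩
        rw [← tsum_mul_right]
        exact tsum_of_norm_bounded (hM.mul_right ‖f‖).hasSum fun b => hbd f M hb b x hx)
  else 0

theorem ev_sumOp {T : Set ℝ} {m : ℝ → ℂ → ℂ} (h : E.SumAdmissible T m) (f : E.B) {x : ℂ}
    (hx : x ∈ E.V) : (E.sumOp T m f).ev x = ∑' b : T, m b x * f.ev (E.u b x) := by
  rw [sumOp, dif_pos h]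
  exact BddHol.ev_opOfFormula _ _ _ _ f hx

/-- The geometric Perron--Frobenius operator
`(L_{T,s} f)(x) = ∑_{b ∈ T} |b| ^ (q s) * exp (s * v b x) * f (u b x)`. -/
def transfer (T : Set ℝ) (s : ℝ) : E.B →L[ℂ] E.B :=
  E.sumOp T fun b x => ((|b| ^ (D.q * s) : ℝ) : ℂ) * Complex.exp (s * E.v b x)

/-- The operators `α_j`:
`(α_j f)(x) = (1 / j!) * ∑_{b ∈ S} |b| ^ (q δ) * exp (δ * v b x) * (q log |b| + v b x) ^ j * f (u b x)`.
-/
def alphaCoeff (δ : ℝ) (j : ℕ) : E.B →L[ℂ] E.B :=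
  E.sumOp S.carrier fun b x => ((j.factorial : ℂ))⁻¹ *
    (((|b| ^ (D.q * δ) : ℝ) : ℂ) * Complex.exp (δ * E.v b x) *
      (((D.q * Real.log |b| : ℝ) : ℂ) + E.v b x) ^ j)

theorem ev_transfer {T : Set ℝ} {s : ℝ} (hT : ∀ b ∈ T, (b : ℂ) ∈ E.U)
    (hs : Summable fun b : T => |(b : ℝ)| ^ (D.q * s)) (f : E.B) {x : ℂ} (hx : x ∈ E.V) :
    (E.transfer T s f).ev x = ∑' b : T, ((|(b : ℝ)| ^ (D.q * s) : ℝ) : ℂ) *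
      Complex.exp (s * E.v b x) * f.ev (E.u b x) := by
  refine E.ev_sumOp ⟨hT, fun b hb x hx => ?_, ?_⟩ f hx
  · exact ((((E.differentiableAt_v (hT b hb) hx).const_mul _).cexp).const_mul
      _).differentiableWithinAt
  · obtain ⟨M, hM⟩ := E.bounded_v
    refine ⟨_, hs.mul_right (Real.exp (|s| * M)), fun b x hx => ?_⟩
    rw [norm_mul, Complex.norm_real, Real.norm_eq_abs, abs_of_nonneg (by positivity)]
    refine mul_le_mul_of_nonneg_left ?_ (by positivity)
    refine (Complex.norm_exp_le_exp_norm _).trans (Real.exp_le_exp.2 ?_)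
    rw [norm_mul, Complex.norm_real, Real.norm_eq_abs]
    exact mul_le_mul_of_nonneg_left (hM _ (hT b b.2) x hx) (abs_nonneg s)

theorem exists_powSummable_lt {δ : ℝ} (hΘ : S.finiteness < (δ : EReal)) :
    ∃ s < δ, S.PowSummable s := by
  obtain ⟨_, ⟨s, hs, rfl⟩, hsδ⟩ := sInf_lt_iff.1 hΘ
  refine ⟨s, EReal.coe_lt_coe_iff.1 hsδ, ?_⟩
  by_contra hn
  simp [PACSystem.IndexSet.pressure, hn] at hs

theorem ev_alphaCoeff {δ : ℝ} (hΘ : S.finiteness < (δ : EReal)) (j : ℕ) (f : E.B) {x : ℂ}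
    (hx : x ∈ E.V) :
    (E.alphaCoeff δ j f).ev x = ∑' b : S.carrier, ((j.factorial : ℂ))⁻¹ *
      (((|(b : ℝ)| ^ (D.q * δ) : ℝ) : ℂ) * Complex.exp (δ * E.v b x) *
        (((D.q * Real.log |(b : ℝ)| : ℝ) : ℂ) + E.v b x) ^ j) * f.ev (E.u b x) := by
  obtain ⟨s, hsδ, hs⟩ := exists_powSummable_lt hΘ
  obtain ⟨M, hM⟩ := E.bounded_v
  obtain ⟨r, hr⟩ := D.bounded_U.exists_norm_le
  have hM0 : 0 ≤ M := (norm_nonneg _).trans (hM 0 E.zero_mem_U 0 E.zero_mem_V)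
  have hr0 : 0 ≤ r := (norm_nonneg _).trans (hr 0 D.zero_mem_U)
  have hκ : 0 < δ - s := sub_pos.2 hsδ
  have hq := D.q_pos
  refine E.ev_sumOp ⟨E.subset_U, fun b hb x hx => ?_, ?_⟩ f hx
  · have hv := E.differentiableAt_v (E.subset_U b hb) hx
    exact ((((hv.const_mul _).cexp.const_mul _).mul
      ((hv.const_add _).pow j)).const_mul _).differentiableWithinAt
  refine ⟨_, hs.mul_right ((max 1 (r ^ (2 * D.q * (δ - s)))) *
    (Real.exp (|δ| * M) * ((δ - s) ^ j)⁻¹ * Real.exp ((δ - s) * M))), fun b x hx => ?_⟩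
  have hb0 : 0 < |(b : ℝ)| := abs_pos.2 (S.ne_zero b)
  set t := |(b : ℝ)| with ht
  have h1 : ‖Complex.exp (δ * E.v b x)‖ ≤ Real.exp (|δ| * M) := by
    refine (Complex.norm_exp_le_exp_norm _).trans (Real.exp_le_exp.2 ?_)
    rw [norm_mul, Complex.norm_real, Real.norm_eq_abs]
    exact mul_le_mul_of_nonneg_left (hM _ (E.subset_U b b.2) x hx) (abs_nonneg δ)
  have h2 : ‖((D.q * Real.log t : ℝ) : ℂ) + E.v b x‖ ≤ D.q * |Real.log t| + M := by
    refine (norm_add_le _ _).trans (add_le_add ?_ (hM _ (E.subset_U b b.2) x hx))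
    rw [Complex.norm_real, Real.norm_eq_abs, abs_mul, abs_of_pos hq]
  have h3 : ((j.factorial : ℝ))⁻¹ * (D.q * |Real.log t| + M) ^ j ≤
      ((δ - s) ^ j)⁻¹ * (Real.exp ((δ - s) * (D.q * |Real.log t|)) * Real.exp ((δ - s) * M)) := by
    have h := Real.pow_div_factorial_le_exp ((δ - s) * (D.q * |Real.log t| + M)) (by positivity) j
    rw [← Real.exp_add, ← mul_add, ← div_eq_inv_mul, ← div_eq_inv_mul]
    rw [le_div_iff₀ (by positivity)]
    refine le_trans (le_of_eq ?_) h
    rw [mul_pow]; ring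
  have h4 : t ^ (D.q * δ) * Real.exp ((δ - s) * (D.q * |Real.log t|)) ≤
      t ^ (D.q * s) * max 1 (r ^ (2 * D.q * (δ - s))) := by
    rcases le_total t 1 with h | h
    · rw [abs_of_nonpos (Real.log_nonpos hb0.le h), Real.rpow_def_of_pos hb0, ← Real.exp_add]
      have : Real.log t * (D.q * δ) + (δ - s) * (D.q * -Real.log t) =
        Real.log t * (D.q * s) := by ring
      rw [this, ← Real.rpow_def_of_pos hb0]
      exact le_mul_of_one_le_right (by positivity) (le_max_left _ _)
    · rw [abs_of_nonneg (Real.log_nonneg h), Real.rpow_def_of_pos hb0, ← Real.exp_add]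
      have : Real.log t * (D.q * δ) + (δ - s) * (D.q * Real.log t) =
        Real.log t * (D.q * s) + Real.log t * (2 * D.q * (δ - s)) := by ring
      rw [this, Real.exp_add, ← Real.rpow_def_of_pos hb0, ← Real.rpow_def_of_pos hb0]
      refine mul_le_mul_of_nonneg_left (le_trans ?_ (le_max_right _ _)) (by positivity)
      exact Real.rpow_le_rpow hb0.le (hr _ (S.mem_U b)) (by positivity)
  rw [norm_mul, norm_mul, norm_mul, norm_pow, norm_inv, Complex.norm_natCast, Complex.norm_real,
    Real.norm_eq_abs, abs_of_nonneg (by positivity : 0 ≤ t ^ (D.q * δ))]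
  calc ((j.factorial : ℝ))⁻¹ * (t ^ (D.q * δ) * ‖Complex.exp (δ * E.v b x)‖ *
        ‖((D.q * Real.log t : ℝ) : ℂ) + E.v b x‖ ^ j)
      ≤ ((j.factorial : ℝ))⁻¹ * (t ^ (D.q * δ) * Real.exp (|δ| * M) *
        (D.q * |Real.log t| + M) ^ j) := by gcongr
    _ = t ^ (D.q * δ) * Real.exp (|δ| * M) *
        (((j.factorial : ℝ))⁻¹ * (D.q * |Real.log t| + M) ^ j) := by ring
    _ ≤ t ^ (D.q * δ) * Real.exp (|δ| * M) * (((δ - s) ^ j)⁻¹ *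
        (Real.exp ((δ - s) * (D.q * |Real.log t|)) * Real.exp ((δ - s) * M))) := by gcongr
    _ = (t ^ (D.q * δ) * Real.exp ((δ - s) * (D.q * |Real.log t|))) *
        (Real.exp (|δ| * M) * ((δ - s) ^ j)⁻¹ * Real.exp ((δ - s) * M)) := by ring
    _ ≤ (t ^ (D.q * s) * max 1 (r ^ (2 * D.q * (δ - s)))) *
        (Real.exp (|δ| * M) * ((δ - s) ^ j)⁻¹ * Real.exp ((δ - s) * M)) := by gcongr
    _ = _ := by ring

/-- The mixed partial derivative
`(1 / i!) (1 / j!) (∂/∂b) ^ i (∂/∂θ) ^ j [exp ((δ + θ) * v b x) * f (u b x)]` at `b = θ = 0`. -/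
def betaFormula (δ : ℝ) (i j : ℕ) (f : E.B) (x : ℂ) : ℂ :=
  ((i.factorial : ℂ))⁻¹ * ((j.factorial : ℂ))⁻¹ *
    iteratedDeriv i (fun b : ℂ => iteratedDeriv j (fun θ : ℂ =>
      Complex.exp ((δ + θ) * E.v b x) * f.ev (E.u b x)) 0) 0

theorem inner_deriv (δ : ℝ) (j : ℕ) (w c : ℂ) :
    iteratedDeriv j (fun θ : ℂ => Complex.exp ((δ + θ) * w) * c) 0 =
      w ^ j * Complex.exp (δ * w) * c := by
  have h : (fun θ : ℂ => Complex.exp ((δ + θ) * w) * c) =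
      fun θ : ℂ => (Complex.exp (δ * w) * c) * Complex.exp (w * θ) := by
    funext θ; rw [add_mul, Complex.exp_add]; ring_nf
  rw [h, iteratedDeriv_const_mul_field, iteratedDeriv_cexp_const_mul]
  simp; ring

theorem exists_analytic_iteratedDeriv {U V : Set ℂ} (hU : IsOpen U) (G : ℂ × ℂ → ℂ)
    (hG : AnalyticOnNhd ℂ G (U ×ˢ V)) (i : ℕ) : ∃ H : ℂ × ℂ → ℂ, AnalyticOnNhd ℂ H (U ×ˢ V) ∧
      ∀ b ∈ U, ∀ x ∈ V, iteratedDeriv i (fun b => G (b, x)) b = H (b, x) := by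
  induction i with
  | zero => exact ⟨G, hG, fun b _ x _ => by simp⟩
  | succ i ih =>
    obtain ⟨H, hH, h⟩ := ih
    refine ⟨fun p => fderiv ℂ H p (1, 0), fun p hp => ?_, fun b hb x hx => ?_⟩
    · exact (ContinuousLinearMap.apply ℂ ℂ ((1, 0) : ℂ × ℂ)).analyticAt _ |>.comp (hH.fderiv p hp)
    · rw [iteratedDeriv_succ]
      have he : iteratedDeriv i (fun b => G (b, x)) =ᶠ[𝓝 b] fun b => H (b, x) := by
        filter_upwards [hU.mem_nhds hb] with b' hb' using h b' hb' x hx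
      rw [he.deriv_eq]
      have h1 : HasDerivAt (fun b : ℂ => (b, x)) ((1, 0) : ℂ × ℂ) b :=
        (hasDerivAt_id b).prodMk (hasDerivAt_const b x)
      exact ((hH (b, x) ⟨hb, hx⟩).differentiableAt.hasFDerivAt.comp_hasDerivAt b h1).deriv

theorem analytic_integrand (δ : ℝ) (j : ℕ) (f : E.B) : AnalyticOnNhd ℂ
    (fun p : ℂ × ℂ => E.v p.1 p.2 ^ j * Complex.exp (δ * E.v p.1 p.2) * f.ev (E.u p.1 p.2))
    (E.U ×ˢ E.V) := by
  intro p hp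
  have hv : AnalyticAt ℂ (fun p : ℂ × ℂ => E.v p.1 p.2) p := E.holo_v p hp
  have hu : AnalyticAt ℂ (fun p : ℂ × ℂ => E.u p.1 p.2) p := E.holo_u p hp
  have hf : AnalyticAt ℂ f.ev (E.u p.1 p.2) :=
    (f.differentiableOn_ev.analyticOnNhd E.isOpen_V) _ (E.mapsTo_u _ hp.1 _ hp.2)
  exact ((hv.pow j).mul (analyticAt_const.mul hv).cexp).mul (hf.comp_of_eq hu rfl)

theorem betaFormula_eq (δ : ℝ) (i j : ℕ) (f : E.B) (x : ℂ) : E.betaFormula δ i j f x =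
    ((i.factorial : ℂ))⁻¹ * ((j.factorial : ℂ))⁻¹ * iteratedDeriv i (fun b : ℂ =>
      E.v b x ^ j * Complex.exp (δ * E.v b x) * f.ev (E.u b x)) 0 := by
  simp only [betaFormula, inner_deriv]

theorem contDiffAt_integrand (δ : ℝ) (j i : ℕ) (f : E.B) {x : ℂ} (hx : x ∈ E.V) :
    ContDiffAt ℂ i (fun b : ℂ =>
      E.v b x ^ j * Complex.exp (δ * E.v b x) * f.ev (E.u b x)) 0 := by
  have h := E.analytic_integrand δ j f (0, x) ⟨E.zero_mem_U, hx⟩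
  exact (h.comp_of_eq (f := fun b : ℂ => (b, x)) (by fun_prop) rfl).contDiffAt

/-- The operators `β_{i,j}`, the coefficients of `b ^ i * θ ^ j` in the expansion of
`exp ((δ + θ) * v b x) * f (u b x)`. -/
def betaCoeff (δ : ℝ) (i j : ℕ) : E.B →L[ℂ] E.B :=
  BddHol.opOfFormula (E.betaFormula δ i j)
    (fun f => by
      obtain ⟨H, hH, h⟩ := exists_analytic_iteratedDeriv E.isOpen_U _ (E.analytic_integrand δ j f) i
      have h1 : DifferentiableOn ℂ (fun x => H (0, x)) E.V := fun x hx =>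
        (((hH (0, x) ⟨E.zero_mem_U, hx⟩).differentiableAt).comp x
          ((differentiableAt_const _).prodMk differentiableAt_id)).differentiableWithinAt
      refine (h1.const_mul (((i.factorial : ℂ))⁻¹ * ((j.factorial : ℂ))⁻¹)).congr fun x hx => ?_
      rw [betaFormula_eq, h 0 E.zero_mem_U x hx])
    (fun f g x hx => by
      rw [betaFormula_eq, betaFormula_eq, betaFormula_eq, ← mul_add,
        ← iteratedDeriv_add (E.contDiffAt_integrand δ j i f hx)
          (E.contDiffAt_integrand δ j i g hx)]
      congr 3
      funext b
      simp only [BddHol.ev_add, Pi.add_apply]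
      ring)
    (fun c f x hx => by
      rw [betaFormula_eq, betaFormula_eq, mul_left_comm]
      congr 1
      rw [← iteratedDeriv_const_mul_field]
      congr 1
      funext b
      rw [BddHol.ev_smul]
      ring)
    (by
      obtain ⟨r, hr, hrU⟩ := Metric.nhds_basis_closedBall.mem_iff.1
        (E.isOpen_U.mem_nhds E.zero_mem_U)
      obtain ⟨M, hM⟩ := E.bounded_v
      have hM0 : 0 ≤ M := (norm_nonneg _).trans (hM 0 E.zero_mem_U 0 E.zero_mem_V)
      refine ⟨‖((i.factorial : ℂ))⁻¹ * ((j.factorial : ℂ))⁻¹‖ *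
        (i.factorial * (M ^ j * Real.exp (|δ| * M)) / r ^ i), by positivity, fun f x hx => ?_⟩
      have hd : DifferentiableOn ℂ (fun b : ℂ =>
          E.v b x ^ j * Complex.exp (δ * E.v b x) * f.ev (E.u b x)) E.U := fun b hb =>
        ((((E.analytic_integrand δ j f) (b, x) ⟨hb, hx⟩).comp_of_eq
          (f := fun b : ℂ => (b, x)) (by fun_prop) rfl).differentiableAt).differentiableWithinAt
      have hC : ∀ b ∈ Metric.sphere (0 : ℂ) r,
          ‖E.v b x ^ j * Complex.exp (δ * E.v b x) * f.ev (E.u b x)‖ ≤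
            M ^ j * Real.exp (|δ| * M) * ‖f‖ := fun b hb => by
        have hbU := hrU (Metric.sphere_subset_closedBall hb)
        rw [norm_mul, norm_mul, norm_pow]
        refine mul_le_mul (mul_le_mul (pow_le_pow_left₀ (norm_nonneg _) (hM b hbU x hx) j) ?_
          (norm_nonneg _) (by positivity)) (f.norm_ev_le _) (norm_nonneg _) (by positivity)
        refine (Complex.norm_exp_le_exp_norm _).trans (Real.exp_le_exp.2 ?_)
        rw [norm_mul, Complex.norm_real, Real.norm_eq_abs]
        exact mul_le_mul_of_nonneg_left (hM b hbU x hx) (abs_nonneg δ)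
      have hK := Complex.norm_iteratedDeriv_le_of_forall_mem_sphere_norm_le i hr
        (hd.mono ((Metric.closure_ball_subset_closedBall).trans hrU)).diffContOnCl hC
      rw [betaFormula_eq, norm_mul, mul_assoc]
      refine mul_le_mul_of_nonneg_left (hK.trans (le_of_eq (by ring))) (norm_nonneg _))

theorem ev_betaCoeff (δ : ℝ) (i j : ℕ) (f : E.B) {x : ℂ} (hx : x ∈ E.V) :
    (E.betaCoeff δ i j f).ev x = E.betaFormula δ i j f x :=
  BddHol.ev_opOfFormula _ _ _ _ f hx

/-- `h x = exp (δ * v 0 x)`. -/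
def h (δ : ℝ) : E.B :=
  BddHol.mk (fun x => Complex.exp (δ * E.v 0 x))
    (fun _ hx => ((E.differentiableAt_v E.zero_mem_U hx).const_mul _).cexp.differentiableWithinAt)
    (by
      obtain ⟨M, hM⟩ := E.bounded_v
      refine ⟨Real.exp (|δ| * M), fun x hx => ?_⟩
      refine (Complex.norm_exp_le_exp_norm _).trans (Real.exp_le_exp.2 ?_)
      rw [norm_mul, Complex.norm_real, Real.norm_eq_abs]
      exact mul_le_mul_of_nonneg_left (hM 0 E.zero_mem_U x hx) (abs_nonneg δ))

/-- `ν f = f 0`. -/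
def nu : E.B →L[ℂ] ℂ :=
  (BoundedContinuousFunction.evalCLM ℂ (⟨0, E.zero_mem_V⟩ : E.V)).comp BddHol.toBCF

/-- The rank one operator `f σ`, `(f σ) f' = (σ f') f`. -/
def rankOne (f : E.B) (σ : E.B →L[ℂ] ℂ) : E.B →L[ℂ] E.B := σ.smulRight f

/-- `L₁ = L_{S,δ}`. -/
def L₁ (δ : ℝ) : E.B →L[ℂ] E.B := E.transfer S.carrier δ

open Classical in
/-- `c̃ = 1 / ∑_{m ≥ 0} ν L₁ ^ m h`, interpreted as `0` if the series diverges. -/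
def cTilde (δ : ℝ) : ℂ :=
  if Summable fun m : ℕ => E.nu ((E.L₁ δ ^ m) (E.h δ)) then
    1 / ∑' m : ℕ, E.nu ((E.L₁ δ ^ m) (E.h δ)) else 0

/-- `Q₁ = ∑_{m ≥ 0} L₁ ^ m`. -/
def Q₁ (δ : ℝ) : E.B →L[ℂ] E.B := ∑' m : ℕ, E.L₁ δ ^ m

/-- `L = L₁ + c̃ h ν`. -/
def L (δ : ℝ) : E.B →L[ℂ] E.B := E.L₁ δ + E.cTilde δ • E.rankOne (E.h δ) E.nu

/-- `g` and `μ` are right and left fixed points of `L`. -/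
def IsFixedPair (δ : ℝ) (g : E.B) (μ : E.B →L[ℂ] ℂ) : Prop :=
  E.L δ g = g ∧ μ.comp (E.L δ) = μ

/-- `g` and `μ` are right and left fixed points of `L`, normalized by `μ h = ν g = 1`. -/
def IsNormalizedPair (δ : ℝ) (g : E.B) (μ : E.B →L[ℂ] ℂ) : Prop :=
  E.IsFixedPair δ g μ ∧ μ (E.h δ) = 1 ∧ E.nu g = 1

/-- `c = 1 / μ g`. -/
def cConst (g : E.B) (μ : E.B →L[ℂ] ℂ) : ℂ := 1 / μ g

/-- `R = L - c g μ`. -/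
def R (δ : ℝ) (g : E.B) (μ : E.B →L[ℂ] ℂ) : E.B →L[ℂ] E.B :=
  E.L δ - E.cConst g μ • E.rankOne g μ

/-- `Q = ∑_{n ≥ 0} R ^ n`. -/
def Q (δ : ℝ) (g : E.B) (μ : E.B →L[ℂ] ℂ) : E.B →L[ℂ] E.B := ∑' n : ℕ, E.R δ g μ ^ n

/-- The formal power series `α = ∑_{j ≥ 1} θ ^ j α_j`. -/
def alphaSeries (δ : ℝ) : MvPowerSeries SeriesVar (E.B →L[ℂ] E.B) :=
  formalSum (fun j : ℕ => monoExp 0 (j + 1) 0) fun j => E.alphaCoeff δ (j + 1)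

/-- The formal power series
`β = ξ h ν + ∑_{j ≥ 1} (c̃ + ξ) θ ^ j β_{0,j} + ∑_{i ≥ 1} ∑_{j ≥ 0} η_i θ ^ j β_{i,j}`. -/
def betaSeries (δ : ℝ) : MvPowerSeries SeriesVar (E.B →L[ℂ] E.B) :=
  MvPowerSeries.monomial (monoExp 0 0 1) (E.rankOne (E.h δ) E.nu)
  + formalSum (fun j : ℕ => monoExp 0 (j + 1) 0) (fun j => E.cTilde δ • E.betaCoeff δ 0 (j + 1))
  + formalSum (fun j : ℕ => monoExp 0 (j + 1) 1) (fun j => E.betaCoeff δ 0 (j + 1))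
  + formalSum (fun p : ℕ+ × ℕ => monoExp (Finsupp.single p.1 1) p.2 0)
      (fun p => E.betaCoeff δ p.1 p.2)

/-- The formal power series `Δ = α + β`. -/
def deltaSeries (δ : ℝ) : MvPowerSeries SeriesVar (E.B →L[ℂ] E.B) :=
  E.alphaSeries δ + E.betaSeries δ

/-- The formal power series `Ξ = ∑_{p ≥ 0} μ Δ (Q Δ) ^ p g`.  Only finitely many `p` contribute
to a given coefficient, because `Δ` has no constant term. -/
def xiSeries (δ : ℝ) (g : E.B) (μ : E.B →L[ℂ] ℂ) : MvPowerSeries SeriesVar ℂ := fun m =>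
  ∑ᶠ p : ℕ, μ ((MvPowerSeries.coeff m
    (E.deltaSeries δ * (MvPowerSeries.C (E.Q δ g μ) * E.deltaSeries δ) ^ p) : E.B →L[ℂ] E.B) g)

/-- The coefficient `c_{I,j,k}` of `η_I θ ^ j ξ ^ k` in `Ξ`. -/
def coef (δ : ℝ) (g : E.B) (μ : E.B →L[ℂ] ℂ) (I : ℕ+ →₀ ℕ) (j k : ℕ) : ℂ :=
  MvPowerSeries.coeff (monoExp I j k) (E.xiSeries δ g μ)

/-! The quantities attached to a perturbation `S'` of `S`. -/

/-- `η = sup_{b ∈ S △ S'} |b|`. -/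
def etaSup (_E : ComplexExtension D S) (S' : D.IndexSet) : ℝ :=
  sSup ((fun b : ℝ => |b|) '' symmDiff S.carrier S'.carrier)

/-- `θ = δ_{S'} - δ`. -/
def theta (_E : ComplexExtension D S) (δ : ℝ) (S' : D.IndexSet) : ℝ := S'.bowen.toReal - δ

/-- `η_i = ∑_{b ∈ S'} |b| ^ (q (δ + θ)) b ^ i - ∑_{b ∈ S} |b| ^ (q (δ + θ)) b ^ i`. -/
def etaVal (δ : ℝ) (S' : D.IndexSet) (i : ℕ) : ℝ :=
  (∑' b : S'.carrier, |(b : ℝ)| ^ (D.q * (δ + E.theta δ S')) * (b : ℝ) ^ i)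
    - ∑' b : S.carrier, |(b : ℝ)| ^ (D.q * (δ + E.theta δ S')) * (b : ℝ) ^ i

/-- `ξ = η_0 - c̃`. -/
def xiVal (δ : ℝ) (S' : D.IndexSet) : ℂ := (E.etaVal δ S' 0 : ℂ) - E.cTilde δ

/-- The operator `L' = L_{S', δ + θ}`. -/
def Lprime (δ : ℝ) (S' : D.IndexSet) : E.B →L[ℂ] E.B :=
  E.transfer S'.carrier (δ + E.theta δ S')

/-- The operator `L'' = L_{S, δ + θ} + c̃ h ν`. -/
def Ldoubleprime (δ : ℝ) (S' : D.IndexSet) : E.B →L[ℂ] E.B :=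
  E.transfer S.carrier (δ + E.theta δ S') + E.cTilde δ • E.rankOne (E.h δ) E.nu

/-- The operator `α = L'' - L`. -/
def alphaOp (δ : ℝ) (S' : D.IndexSet) : E.B →L[ℂ] E.B := E.Ldoubleprime δ S' - E.L δ

/-- The operator `β = L' - L''`. -/
def betaOp (δ : ℝ) (S' : D.IndexSet) : E.B →L[ℂ] E.B := E.Lprime δ S' - E.Ldoubleprime δ S'

/-- The term `c_{I,j,k} η_I θ ^ j ξ ^ k` of the series `Ξ(S')`. -/
def xiTerm (δ : ℝ) (g : E.B) (μ : E.B →L[ℂ] ℂ) (S' : D.IndexSet)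
    (m : (ℕ+ →₀ ℕ) × ℕ × ℕ) : ℂ :=
  E.coef δ g μ m.1 m.2.1 m.2.2 *
    ((m.1.prod fun i n => (E.etaVal δ S' i : ℂ) ^ n) * (E.theta δ S' : ℂ) ^ m.2.1 *
      E.xiVal δ S' ^ m.2.2)

/-- `Ξ(S') = ∑_{I,j,k} c_{I,j,k} η_I θ ^ j ξ ^ k`. -/
def Xi (δ : ℝ) (g : E.B) (μ : E.B →L[ℂ] ℂ) (S' : D.IndexSet) : ℂ := ∑' m, E.xiTerm δ g μ S' m

end ComplexExtension

end

/-! For empty `S` the operator `L₁` is zero, so `L` has rank one, `L = (1 / ν h) h ν`. Its fixed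
points are the multiples of `h` and `ν`; with `(g, μ) = (h, ν)` one gets `R = 0`, `Q = 1`, and `Ξ`
collapses to `∑_{p ≥ 1} ν β ^ p h`.

The vanishing statements combine facts about single operators with bookkeeping of monomials. Since
`u_0 = 0`, `β_{0,0} = h ν`. Up to a constant, `β_{i,j} f (x)` is the `i`-th derivative at `b = 0` of
`v(b,x) ^ j e^{δ v(b,x)} f(u_b x)`. If `v(0,·) = 0` this function vanishes to order `j`, so `β_{i,j}
= 0` for `j > i`: every surviving monomial of `β` has `θ`-degree at most its `Σ(I)`, and contains
exactly one `η` or `ξ`. If also `v(·,0) = 0`, then `ν β_{i,j} = 0` for `j > 0`, and peeling off the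
leftmost factor of `β ^ p` makes the degree inequality strict. Homogeneity of `β ^ p` in `(η, ξ)`
leaves only `p = 1` when `k = 0` and `#(I) < 2`, where `ν β_{i,j} h = 0` applies.

For `δ = 0`, `δ_S ≤ 0` forces `S` to have at most one element. Then `g = h = 1` (for a singleton, `g
∘ u_b = g` is iterated towards the fixed point of `u_b`), and every `β_{i,0}` with `i > 0` kills
constants.

For convergence, Cauchy estimates give `L_{S',δ+θ} = ∑ η_i θ ^ j β_{i,j}` with geometric bounds
(`hasSum_transfer`), so the formal series `β` converges absolutely to the operator `β(S')`
(`hasAbsEval_betaSeries`). Regularity means spectral radius one at `δ_{S'}`. When `S'` is close to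
`0`, all weights are close to `|b| ^ {q δ_{S'}} e^{δ v(0,0)}`, so `η_0` is close to `e^{-δ v(0,0)} =
c̃` and `ξ` is small (`exists_abs_moment_sub_le`). The sum of the norms of the terms of `β` is then
below one, and Fubini exchanges the sum over `p` with the sum over monomials (`geometric`). -/

theorem hasSum_tsum_of_hasSum_fiberwise {α β : Type*} {G : α × β → ℂ} (hG : Summable G)
    {f : α → ℂ} {g : β → ℂ} (hf : ∀ a, HasSum (fun b => G (a, b)) (f a))
    (hg : ∀ b, HasSum (fun a => G (a, b)) (g b)) :
    HasSum f (∑' x, G x) ∧ HasSum g (∑' x, G x) := by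
  refine ⟨hG.hasSum.prod_fiberwise hf, ?_⟩
  have h : HasSum (fun x : β × α => G (x.2, x.1)) (∑' x, G x) :=
    (Equiv.prodComm β α).hasSum_iff.2 hG.hasSum
  exact h.prod_fiberwise hg

/-! ### Absolutely convergent evaluation of power series with coefficients in a normed algebra. -/

namespace MvPowerSeries

section Eval

variable {σ : Type*} {R : Type*} [NormedRing R] [NormedAlgebra ℂ R]

/-- The value `z ^ m` of a monomial. -/
noncomputable def monoVal (z : σ → ℂ) (m : σ →₀ ℕ) : ℂ := m.prod fun s n => z s ^ n

theorem monoVal_add (z : σ → ℂ) (a b : σ →₀ ℕ) :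
    monoVal z (a + b) = monoVal z a * monoVal z b := by
  classical
  exact Finsupp.prod_add_index' (fun _ => pow_zero _) fun _ _ _ => pow_add _ _ _

/-- The term of index `m` of the power series `F` evaluated at `z`. -/
noncomputable def termAt (z : σ → ℂ) (F : MvPowerSeries σ R) (m : σ →₀ ℕ) : R :=
  monoVal z m • coeff m F

/-- The series `F` converges absolutely at `z` to `a`, and the sum of the norms of its terms is
at most `N`. -/
structure HasAbsEval (z : σ → ℂ) (F : MvPowerSeries σ R) (a : R) (N : ℝ) : Prop where
  summable : Summable fun m => ‖termAt z F m‖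
  tsum_le : ∑' m, ‖termAt z F m‖ ≤ N
  hasSum : HasSum (termAt z F) a

theorem termAt_mul (z : σ → ℂ) (F G : MvPowerSeries σ R) (m : σ →₀ ℕ) [DecidableEq σ] :
    termAt z (F * G) m =
      ∑ p ∈ Finset.HasAntidiagonal.antidiagonal m, termAt z F p.1 * termAt z G p.2 := by
  rw [termAt, coeff_mul, Finset.smul_sum]
  refine Finset.sum_congr rfl fun p hp => ?_
  rw [termAt, termAt, ← Finset.HasAntidiagonal.mem_antidiagonal.1 hp, monoVal_add, smul_mul_smul_comm]

/-- The `ℓ¹` norm is submultiplicative under convolution. This is why the constant `N` of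
`HasAbsEval` multiplies along products and powers of series are dominated by a geometric series. -/
theorem cauchy_product {R : Type*} [NormedRing R] {A : Type*} [AddCommMonoid A] [Finset.HasAntidiagonal A] [CompleteSpace R]
    {f g : A → R} (hf : Summable fun m => ‖f m‖) (hg : Summable fun m => ‖g m‖) :
    (Summable fun m => ‖∑ p ∈ Finset.HasAntidiagonal.antidiagonal m, f p.1 * g p.2‖) ∧
    ∑' m, ‖∑ p ∈ Finset.HasAntidiagonal.antidiagonal m, f p.1 * g p.2‖ ≤
      (∑' m, ‖f m‖) * ∑' m, ‖g m‖ ∧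
    HasSum (fun m => ∑ p ∈ Finset.HasAntidiagonal.antidiagonal m, f p.1 * g p.2)
      ((∑' m, f m) * ∑' m, g m) := by
  have hp : Summable fun x : A × A => ‖f x.1‖ * ‖g x.2‖ :=
    Summable.mul_of_nonneg (f := fun m => ‖f m‖) (g := fun m => ‖g m‖) hf hg
      (fun m => norm_nonneg (f m)) fun m => norm_nonneg (g m)
  have hp' := summable_mul_of_summable_norm hf hg
  have hs : Summable fun m => ∑ p ∈ Finset.HasAntidiagonal.antidiagonal m, ‖f p.1‖ * ‖g p.2‖ :=
    summable_sum_mul_antidiagonal_of_summable_mul (f := fun m => ‖f m‖) (g := fun m => ‖g m‖) hp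
  have hle : ∀ m, ‖∑ p ∈ Finset.HasAntidiagonal.antidiagonal m, f p.1 * g p.2‖ ≤
      ∑ p ∈ Finset.HasAntidiagonal.antidiagonal m, ‖f p.1‖ * ‖g p.2‖ := fun m =>
    (norm_sum_le _ _).trans (Finset.sum_le_sum fun p _ => norm_mul_le _ _)
  have hs' := Summable.of_nonneg_of_le (fun _ => norm_nonneg _) hle hs
  refine ⟨hs', (hs'.tsum_le_tsum hle hs).trans_eq ?_, ?_⟩
  · exact (hf.tsum_mul_tsum_eq_tsum_sum_antidiagonal hg hp).symm
  · rw [Summable.tsum_mul_tsum_eq_tsum_sum_antidiagonal hf.of_norm hg.of_norm hp']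
    exact (summable_sum_mul_antidiagonal_of_summable_mul hp').hasSum

namespace HasAbsEval

variable {z : σ → ℂ} {F G : MvPowerSeries σ R} {a b : R} {M N : ℝ}

theorem bound_nonneg (h : HasAbsEval z F a N) : 0 ≤ N :=
  (tsum_nonneg fun _ => norm_nonneg _).trans h.tsum_le

theorem add (hF : HasAbsEval z F a M) (hG : HasAbsEval z G b N) :
    HasAbsEval z (F + G) (a + b) (M + N) := by
  have he : ∀ m, termAt z (F + G) m = termAt z F m + termAt z G m := fun m => by
    simp [termAt, smul_add]
  have hs := hF.summable.add hG.summable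
  have hle : ∀ m, ‖termAt z (F + G) m‖ ≤ ‖termAt z F m‖ + ‖termAt z G m‖ := fun m => by
    rw [he]; exact norm_add_le _ _
  have hs' := Summable.of_nonneg_of_le (fun _ => norm_nonneg _) hle hs
  refine ⟨hs', (hs'.tsum_le_tsum hle hs).trans ?_, ?_⟩
  · rw [hF.summable.tsum_add hG.summable]
    exact add_le_add hF.tsum_le hG.tsum_le
  · rw [funext he]
    exact hF.hasSum.add hG.hasSum

theorem mul [CompleteSpace R] (hF : HasAbsEval z F a M) (hG : HasAbsEval z G b N) :
    HasAbsEval z (F * G) (a * b) (M * N) := by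
  classical
  obtain ⟨h1, h2, h3⟩ := cauchy_product hF.summable hG.summable
  have he : termAt z (F * G) = fun m =>
      ∑ p ∈ Finset.HasAntidiagonal.antidiagonal m, termAt z F p.1 * termAt z G p.2 :=
    funext fun m => termAt_mul z F G m
  rw [← he] at h3
  simp only [← termAt_mul] at h1 h2
  rw [hF.hasSum.tsum_eq, hG.hasSum.tsum_eq] at h3
  exact ⟨h1, h2.trans (mul_le_mul hF.tsum_le hG.tsum_le (tsum_nonneg fun _ => norm_nonneg _)
    hF.bound_nonneg), h3⟩

/-- Positive exponents only: `‖1‖ ≤ 1` is not assumed in `R`, and the series for `Ξ` starts with the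
first power of `β`. -/
theorem pow_succ [CompleteSpace R] (hF : HasAbsEval z F a M) (n : ℕ) :
    HasAbsEval z (F ^ (n + 1)) (a ^ (n + 1)) (M ^ (n + 1)) := by
  induction n with
  | zero => simpa using hF
  | succ n ih =>
    rw [_root_.pow_succ F, _root_.pow_succ a, _root_.pow_succ M]
    exact ih.mul hF

/-- Evaluation of a geometric series of power series, coefficient by coefficient. -/
theorem geometric [CompleteSpace R] (hF : HasAbsEval z F a N) (hN : N < 1)
    (h0 : coeff 0 F = 0) (φ : R →L[ℂ] ℂ) :
    (Summable fun m => monoVal z m * ∑ᶠ p : ℕ, φ (coeff m (F ^ (p + 1)))) ∧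
    HasSum (fun p : ℕ => φ (a ^ (p + 1)))
      (∑' m, monoVal z m * ∑ᶠ p : ℕ, φ (coeff m (F ^ (p + 1)))) := by
  have hb : ∀ p m, ‖φ (termAt z (F ^ (p + 1)) m)‖ ≤ ‖φ‖ * ‖termAt z (F ^ (p + 1)) m‖ :=
    fun p m => φ.le_opNorm _
  have hsum : Summable fun x : ℕ × (σ →₀ ℕ) => φ (termAt z (F ^ (x.1 + 1)) x.2) := by
    refine Summable.of_norm_bounded (g := fun x : ℕ × (σ →₀ ℕ) =>
      ‖φ‖ * ‖termAt z (F ^ (x.1 + 1)) x.2‖) ?_ fun x => hb _ _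
    -- Summing over the monomials first leaves at most `‖φ‖ * N ^ (p + 1)`, a convergent geometric
    -- series.
    refine (summable_prod_of_nonneg fun x => by positivity).2
      ⟨fun p => ((hF.pow_succ p).summable.mul_left _), ?_⟩
    have hg : Summable fun p : ℕ => ‖φ‖ * N ^ (p + 1) :=
      (((summable_geometric_of_lt_one hF.bound_nonneg hN).mul_right N).congr
        fun p => (_root_.pow_succ N p).symm).mul_left _
    refine Summable.of_nonneg_of_le (fun p => tsum_nonneg fun m => by positivity) (fun p => ?_) hg
    rw [tsum_mul_left]
    exact mul_le_mul_of_nonneg_left (hF.pow_succ p).tsum_le (norm_nonneg _)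
  have hm : ∀ m, HasSum (fun p : ℕ => φ (termAt z (F ^ (p + 1)) m))
      (monoVal z m * ∑ᶠ p : ℕ, φ (coeff m (F ^ (p + 1)))) := fun m => by
    -- Without constant term `F ^ (p + 1)` has order at least `p + 1`, so only `p < m.degree`
    -- contributes; hence the `finsum` is a genuine sum and not its default value `0`.
    have hfin : (Function.support fun p : ℕ => φ (coeff m (F ^ (p + 1)))).Finite := by
      refine (Set.finite_lt_nat m.degree).subset fun p hp => ?_
      by_contra hlt
      refine hp ?_
      have h1 : 1 ≤ F.order := one_le_order_iff_constCoeff_eq_zero.2 h0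
      have h2 : ((p + 1 : ℕ) : ℕ∞) ≤ (F ^ (p + 1)).order :=
        le_order_pow_of_constantCoeff_eq_zero _ h0
      have h3 : ((m.degree : ℕ) : ℕ∞) < (F ^ (p + 1)).order :=
        lt_of_lt_of_le (Nat.cast_lt.2 (by simp at hlt; omega)) h2
      simp only [coeff_of_lt_order h3, map_zero]
    have hs : HasSum (fun p : ℕ => φ (coeff m (F ^ (p + 1))))
        (∑ᶠ p : ℕ, φ (coeff m (F ^ (p + 1)))) := by
      rw [← tsum_eq_finsum (L := SummationFilter.unconditional ℕ) hfin]
      exact (summable_of_hasFiniteSupport hfin).hasSum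
    refine (hs.mul_left (monoVal z m)).congr_fun fun p => ?_
    simp [termAt]
  have hp : ∀ p : ℕ, HasSum (fun m => φ (termAt z (F ^ (p + 1)) m)) (φ (a ^ (p + 1))) :=
    fun p => φ.hasSum (hF.pow_succ p).hasSum
  obtain ⟨h1, h2⟩ := hasSum_tsum_of_hasSum_fiberwise hsum hp hm
  refine ⟨h2.summable, ?_⟩
  rw [h2.tsum_eq]
  exact h1

end HasAbsEval

end Eval

end MvPowerSeries

/-! ### Coefficients and evaluation of formal sums of monomials. -/

theorem coeff_formalSum_apply {R ι : Type*} [Semiring R] {e : ι → SeriesVar →₀ ℕ}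
    (he : Function.Injective e) (T : ι → R) (a : ι) :
    MvPowerSeries.coeff (e a) (formalSum e T) = T a := by
  classical
  change (∑ᶠ a', if e a' = e a then T a' else 0) = T a
  rw [finsum_eq_single _ a fun a' h => if_neg fun h' => h (he h'), if_pos rfl]

theorem coeff_formalSum_of_forall_ne {R ι : Type*} [Semiring R] {e : ι → SeriesVar →₀ ℕ}
    (T : ι → R) {m : SeriesVar →₀ ℕ} (h : ∀ a, e a ≠ m) :
    MvPowerSeries.coeff m (formalSum e T) = 0 := by
  classical
  change (∑ᶠ a', if e a' = m then T a' else 0) = 0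
  rw [finsum_eq_zero_of_forall_eq_zero fun a => if_neg (h a)]

theorem hasAbsEval_formalSum {R ι : Type*} [NormedRing R] [NormedAlgebra ℂ R]
    {z : SeriesVar → ℂ} {e : ι → SeriesVar →₀ ℕ}
    (he : Function.Injective e) {T : ι → R} {a : R} {B : ι → ℝ} {N : ℝ} (hB : HasSum B N)
    (hTB : ∀ i, ‖MvPowerSeries.monoVal z (e i) • T i‖ ≤ B i)
    (ha : HasSum (fun i => MvPowerSeries.monoVal z (e i) • T i) a) :
    MvPowerSeries.HasAbsEval z (formalSum e T) a N := by
  have h1 : ∀ i, MvPowerSeries.termAt z (formalSum e T) (e i) =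
      MvPowerSeries.monoVal z (e i) • T i := fun i => by
    rw [MvPowerSeries.termAt, coeff_formalSum_apply he]
  have h0 : ∀ m ∉ range e, MvPowerSeries.termAt z (formalSum e T) m = 0 := fun m hm => by
    rw [MvPowerSeries.termAt, coeff_formalSum_of_forall_ne T fun i hi => hm ⟨i, hi⟩, smul_zero]
  have hs : Summable fun i => ‖MvPowerSeries.monoVal z (e i) • T i‖ :=
    Summable.of_nonneg_of_le (fun _ => norm_nonneg _) hTB hB.summable
  have hn : HasSum (fun m => ‖MvPowerSeries.termAt z (formalSum e T) m‖)
      (∑' i, ‖MvPowerSeries.monoVal z (e i) • T i‖) := by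
    refine (he.hasSum_iff fun m hm => by rw [h0 m hm, norm_zero]).1 ?_
    refine hs.hasSum.congr_fun fun i => ?_
    simp only [Function.comp_apply, h1]
  refine ⟨hn.summable, ?_, ?_⟩
  · rw [hn.tsum_eq, ← hB.tsum_eq]
    exact hs.tsum_le_tsum hTB hB.summable
  · refine (he.hasSum_iff h0).1 (ha.congr_fun fun i => ?_)
    simp only [Function.comp_apply, h1]

theorem hasAbsEval_monomial {R : Type*} [NormedRing R] [NormedAlgebra ℂ R]
    {z : SeriesVar → ℂ} (e : SeriesVar →₀ ℕ) (T : R) {N : ℝ}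
    (hN : ‖MvPowerSeries.monoVal z e • T‖ ≤ N) :
    MvPowerSeries.HasAbsEval z (MvPowerSeries.monomial e T) (MvPowerSeries.monoVal z e • T) N := by
  classical
  have h0 : ∀ m, m ≠ e → MvPowerSeries.termAt z (MvPowerSeries.monomial e T) m = 0 :=
    fun m hm => by rw [MvPowerSeries.termAt, MvPowerSeries.coeff_monomial_ne hm, smul_zero]
  have h1 : MvPowerSeries.termAt z (MvPowerSeries.monomial e T) e =
      MvPowerSeries.monoVal z e • T := by
    rw [MvPowerSeries.termAt, MvPowerSeries.coeff_monomial_same]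
  have hs := hasSum_single e h0
  have hn := hasSum_single (f := fun m =>
    ‖MvPowerSeries.termAt z (MvPowerSeries.monomial e T) m‖) e
    fun m hm => by rw [h0 m hm, norm_zero]
  rw [h1] at hs hn
  exact ⟨hn.summable, hn.tsum_eq.trans_le hN, hs⟩

/-! ### Exponents -/

@[simp] theorem monoExp_eta (I : ℕ+ →₀ ℕ) (j k : ℕ) (i : ℕ+) :
    monoExp I j k (SeriesVar.eta i) = I i := by
  have h : Function.Injective SeriesVar.eta := fun a b h => by cases h; rfl
  simp [monoExp, Finsupp.mapDomain_apply h]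

@[simp] theorem monoExp_theta (I : ℕ+ →₀ ℕ) (j k : ℕ) :
    monoExp I j k SeriesVar.theta = j := by
  have h : SeriesVar.theta ∉ range SeriesVar.eta := by rintro ⟨i, hi⟩; cases hi
  simp [monoExp, Finsupp.mapDomain_of_notMem_range _ _ h]

@[simp] theorem monoExp_xi (I : ℕ+ →₀ ℕ) (j k : ℕ) :
    monoExp I j k SeriesVar.xi = k := by
  have h : SeriesVar.xi ∉ range SeriesVar.eta := by rintro ⟨i, hi⟩; cases hi
  simp [monoExp, Finsupp.mapDomain_of_notMem_range _ _ h]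

theorem SeriesVar.eta_injective : Function.Injective SeriesVar.eta :=
  fun a b h => by cases h; rfl

/-- The multiset of the `η`-variables in a monomial. -/
noncomputable def etaPart (m : SeriesVar →₀ ℕ) : ℕ+ →₀ ℕ :=
  m.comapDomain SeriesVar.eta SeriesVar.eta_injective.injOn

@[simp] theorem etaPart_apply (m : SeriesVar →₀ ℕ) (i : ℕ+) :
    etaPart m i = m (SeriesVar.eta i) := rfl

theorem etaPart_add (a b : SeriesVar →₀ ℕ) : etaPart (a + b) = etaPart a + etaPart b := by
  ext i; simp

@[simp] theorem etaPart_monoExp (I : ℕ+ →₀ ℕ) (j k : ℕ) : etaPart (monoExp I j k) = I := by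
  ext i; simp

theorem monoExp_etaPart (m : SeriesVar →₀ ℕ) :
    monoExp (etaPart m) (m SeriesVar.theta) (m SeriesVar.xi) = m := by
  ext s
  cases s <;> simp

/-- The monomials `η_I θ ^ j ξ ^ k` enumerate all monomials. -/
noncomputable def monoExpEquiv : (ℕ+ →₀ ℕ) × ℕ × ℕ ≃ (SeriesVar →₀ ℕ) where
  toFun p := monoExp p.1 p.2.1 p.2.2
  invFun m := (etaPart m, m SeriesVar.theta, m SeriesVar.xi)
  left_inv p := by simp
  right_inv m := monoExp_etaPart m

theorem monoExp_inj {I I' : ℕ+ →₀ ℕ} {j j' k k' : ℕ} :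
    monoExp I j k = monoExp I' j' k' ↔ I = I' ∧ j = j' ∧ k = k' := by
  have := monoExpEquiv.injective.eq_iff (a := (I, j, k)) (b := (I', j', k'))
  simpa [monoExpEquiv] using this

theorem monoVal_monoExp (z : SeriesVar → ℂ) (I : ℕ+ →₀ ℕ) (j k : ℕ) :
    MvPowerSeries.monoVal z (monoExp I j k) =
      (I.prod fun i n => z (SeriesVar.eta i) ^ n) * z SeriesVar.theta ^ j *
        z SeriesVar.xi ^ k := by
  classical
  rw [monoExp, MvPowerSeries.monoVal_add, MvPowerSeries.monoVal_add]
  congr 2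
  · exact Finsupp.prod_mapDomain_index_inj SeriesVar.eta_injective
  · simp [MvPowerSeries.monoVal]
  · simp [MvPowerSeries.monoVal]

theorem multSum_add (I J : ℕ+ →₀ ℕ) : multSum (I + J) = multSum I + multSum J := by
  classical
  exact Finsupp.sum_add_index' (fun _ => mul_zero _) fun _ _ _ => mul_add _ _ _

theorem multCard_add (I J : ℕ+ →₀ ℕ) : multCard (I + J) = multCard I + multCard J := by
  classical
  exact Finsupp.sum_add_index' (fun _ => rfl) fun _ _ _ => rfl

@[simp] theorem multSum_zero : multSum 0 = 0 := by simp [multSum]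

@[simp] theorem multCard_zero : multCard 0 = 0 := by simp [multCard]

@[simp] theorem multSum_single (i : ℕ+) : multSum (Finsupp.single i 1) = i := by simp [multSum]

@[simp] theorem multCard_single (i : ℕ+) : multCard (Finsupp.single i 1) = 1 := by
  simp [multCard]

/-! ### Spectral radius estimates from Gelfand's formula. -/

section Gelfand

open scoped NNReal ENNReal

variable {A : Type*} [NormedRing A] [NormedAlgebra ℂ A] [CompleteSpace A]

/-- Take `n`-th roots in Gelfand's formula: the factor `C ^ n` contributes exactly `C`. -/
theorem spectralRadius_le_mul_of_norm_pow_le {a b : A} (C : ℝ≥0)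
    (h : ∀ n : ℕ, ‖a ^ n‖ ≤ (C : ℝ) ^ n * ‖b ^ n‖) :
    spectralRadius ℂ a ≤ C * spectralRadius ℂ b := by
  have h1 := spectrum.pow_nnnorm_pow_one_div_tendsto_nhds_spectralRadius a
  have h2 := ENNReal.Tendsto.const_mul (a := (C : ℝ≥0∞))
    (spectrum.pow_nnnorm_pow_one_div_tendsto_nhds_spectralRadius b) (Or.inr ENNReal.coe_ne_top)
  refine le_of_tendsto_of_tendsto h1 h2 ?_
  filter_upwards [eventually_gt_atTop 0] with n hn
  have hn' : (n : ℝ) ≠ 0 := by positivity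
  calc (‖a ^ n‖₊ : ℝ≥0∞) ^ (1 / n : ℝ)
      ≤ ((C : ℝ≥0∞) ^ n * ‖b ^ n‖₊) ^ (1 / n : ℝ) :=
        ENNReal.rpow_le_rpow (by exact_mod_cast h n) (by positivity)
    _ = C * (‖b ^ n‖₊ : ℝ≥0∞) ^ (1 / n : ℝ) := by
        rw [ENNReal.mul_rpow_of_nonneg _ _ (by positivity), ← ENNReal.rpow_natCast,
          ← ENNReal.rpow_mul, mul_one_div_cancel hn', ENNReal.rpow_one]

theorem le_spectralRadius_of_pow_le_norm {a : A} (C : ℝ≥0)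
    (h : ∀ n : ℕ, (C : ℝ) ^ n ≤ ‖a ^ n‖) : (C : ℝ≥0∞) ≤ spectralRadius ℂ a := by
  refine ge_of_tendsto (spectrum.pow_nnnorm_pow_one_div_tendsto_nhds_spectralRadius a) ?_
  filter_upwards [eventually_gt_atTop 0] with n hn
  have hn' : (n : ℝ) ≠ 0 := by positivity
  calc (C : ℝ≥0∞) = ((C : ℝ≥0∞) ^ n) ^ (1 / n : ℝ) := by
        rw [← ENNReal.rpow_natCast, ← ENNReal.rpow_mul, mul_one_div_cancel hn', ENNReal.rpow_one]
    _ ≤ _ := ENNReal.rpow_le_rpow (by exact_mod_cast h n) (by positivity)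

theorem spectralRadius_le_of_norm_le {a : A} (C : ℝ≥0) (h : ‖a‖ ≤ C) : spectralRadius ℂ a ≤ C := by
  refine le_of_tendsto (spectrum.pow_nnnorm_pow_one_div_tendsto_nhds_spectralRadius a) ?_
  filter_upwards [eventually_gt_atTop 0] with n hn
  have hn' : (n : ℝ) ≠ 0 := by positivity
  have h1 : ‖a ^ n‖₊ ≤ C ^ n := (nnnorm_pow_le' a hn).trans (pow_le_pow_left' (show ‖a‖₊ ≤ C from h) n)
  calc _ ≤ ((C : ℝ≥0∞) ^ n) ^ (1 / n : ℝ) :=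
        ENNReal.rpow_le_rpow (by exact_mod_cast h1) (by positivity)
    _ = C := by
        rw [← ENNReal.rpow_natCast, ← ENNReal.rpow_mul, mul_one_div_cancel hn', ENNReal.rpow_one]

end Gelfand

namespace BoundedContinuousFunction

variable {X : Type*} [TopologicalSpace X]

theorem opNorm_le_of_forall_norm_apply_le (T : (X →ᵇ ℂ) →L[ℂ] (X →ᵇ ℂ)) {C : ℝ} (h0 : 0 ≤ C)
    (h : ∀ f x, ‖T f x‖ ≤ C * ‖f‖) : ‖T‖ ≤ C :=
  T.opNorm_le_bound h0 fun f =>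
    (BoundedContinuousFunction.norm_le (mul_nonneg h0 (norm_nonneg f))).2 (h f)

theorem norm_apply_one_le_opNorm (T : (X →ᵇ ℂ) →L[ℂ] (X →ᵇ ℂ)) (x : X) : ‖T 1 x‖ ≤ ‖T‖ := by
  have : Nonempty X := ⟨x⟩
  refine ((T 1).norm_coe_le_norm x).trans ((T.le_opNorm 1).trans_eq ?_)
  rw [norm_one, mul_one]

end BoundedContinuousFunction

/-! ### Zeros of the pressure, the Bowen parameter, and bounds on the symbolic operator. -/

namespace PACSystem.IndexSet

variable {D : PACSystem} {S : D.IndexSet}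

theorem abs_deriv_pos (b : S.carrier) (ω : S.Word) : 0 < |deriv (D.u b) (coding ω)| := by
  rw [D.deriv_eq _ (S.mem_U b) _ (coding_mem ω)]
  exact mul_pos (Real.rpow_pos_of_pos (abs_pos.2 (S.ne_zero b)) _) (Real.exp_pos _)

theorem abs_deriv_lt_one (D : PACSystem) :
    ∃ lam < (1 : ℝ), ∀ (S : D.IndexSet) (b : S.carrier) (ω : S.Word),
      |deriv (D.u b) (coding ω)| ≤ lam := by
  obtain ⟨lam, h1, h⟩ := D.contracting
  exact ⟨lam, h1, fun S b ω => h _ (S.mem_U b) _ (coding_mem ω)⟩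

theorem summable_weight {s : ℝ} (hs : S.PowSummable s) (ω : S.Word) :
    Summable fun b : S.carrier => |deriv (D.u b) (coding ω)| ^ s := by
  obtain ⟨M, hM0, hM⟩ := S.exists_weight_le s
  exact Summable.of_nonneg_of_le (fun b => by positivity) (fun b => hM b ω) (hs.mul_left M)

theorem symbolicOp_apply {s : ℝ} (hs : S.PowSummable s) (f : S.Word →ᵇ ℂ) (ω : S.Word) :
    S.symbolicOp s hs f ω = ∑' b : S.carrier,
      ((|deriv (D.u b) (coding ω)| ^ s : ℝ) : ℂ) * f (consWord b ω) := rfl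

theorem symbolicOp_pow_succ_apply {s : ℝ} (hs : S.PowSummable s) (n : ℕ) (f : S.Word →ᵇ ℂ)
    (ω : S.Word) : (S.symbolicOp s hs ^ (n + 1)) f ω = ∑' b : S.carrier,
      ((|deriv (D.u b) (coding ω)| ^ s : ℝ) : ℂ) * (S.symbolicOp s hs ^ n) f (consWord b ω) := by
  rw [pow_succ', mul_apply_eq_comp, symbolicOp_apply]

theorem summable_weight_mul_norm {s : ℝ} (hs : S.PowSummable s) (f : S.Word →ᵇ ℂ) (ω : S.Word) :
    Summable fun b : S.carrier => |deriv (D.u b) (coding ω)| ^ s * ‖f (consWord b ω)‖ :=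
  Summable.of_nonneg_of_le (fun b => by positivity)
    (fun b => mul_le_mul_of_nonneg_left (f.norm_coe_le_norm _) (by positivity))
    ((summable_weight hs ω).mul_right ‖f‖)

/-- The weights are nonnegative, hence so are the iterates of `1`. Writing this as equality with the
norm lets positivity arguments run inside the complex function space. -/
theorem symbolicOp_pow_one_apply {s : ℝ} (hs : S.PowSummable s) (n : ℕ) (ω : S.Word) :
    (S.symbolicOp s hs ^ n) 1 ω = (‖(S.symbolicOp s hs ^ n) 1 ω‖ : ℂ) := by
  induction n generalizing ω with
  | zero => simp
  | succ n ih =>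
    rw [symbolicOp_pow_succ_apply]
    have h : ∀ b : S.carrier, ((|deriv (D.u b) (coding ω)| ^ s : ℝ) : ℂ) *
        (S.symbolicOp s hs ^ n) 1 (consWord b ω) = ((|deriv (D.u b) (coding ω)| ^ s *
          ‖(S.symbolicOp s hs ^ n) 1 (consWord b ω)‖ : ℝ) : ℂ) := fun b => by
      rw [Complex.ofReal_mul, ← ih]
    simp only [h]
    rw [← Complex.ofReal_tsum, Complex.norm_real, Real.norm_of_nonneg]
    exact tsum_nonneg fun b => by positivity

theorem norm_symbolicOp_pow_succ_one {s : ℝ} (hs : S.PowSummable s) (n : ℕ) (ω : S.Word) :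
    ‖(S.symbolicOp s hs ^ (n + 1)) 1 ω‖ = ∑' b : S.carrier,
      |deriv (D.u b) (coding ω)| ^ s * ‖(S.symbolicOp s hs ^ n) 1 (consWord b ω)‖ := by
  rw [← Complex.ofReal_inj, ← symbolicOp_pow_one_apply, symbolicOp_pow_succ_apply,
    Complex.ofReal_tsum]
  refine tsum_congr fun b => ?_
  rw [Complex.ofReal_mul, ← symbolicOp_pow_one_apply]

/-- A positive operator is controlled by its action on `1`, so a comparison of weights with constant
`C` becomes a comparison of `n`-th iterates with constant `C ^ n`. -/
theorem norm_symbolicOp_pow_apply_le {s t : ℝ} (hs : S.PowSummable s) (ht : S.PowSummable t)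
    {C : ℝ} (hC : 0 ≤ C) (h : ∀ (b : S.carrier) (ω : S.Word),
      |deriv (D.u b) (coding ω)| ^ t ≤ C * |deriv (D.u b) (coding ω)| ^ s)
    (f : S.Word →ᵇ ℂ) (n : ℕ) (ω : S.Word) :
    ‖(S.symbolicOp t ht ^ n) f ω‖ ≤ C ^ n * ‖f‖ * ‖(S.symbolicOp s hs ^ n) 1 ω‖ := by
  induction n generalizing ω with
  | zero => simpa using f.norm_coe_le_norm ω
  | succ n ih =>
    rw [symbolicOp_pow_succ_apply, norm_symbolicOp_pow_succ_one, ← tsum_mul_left]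
    refine tsum_of_norm_bounded
      ((summable_weight_mul_norm hs _ ω).mul_left (C ^ (n + 1) * ‖f‖)).hasSum fun b => ?_
    rw [norm_mul, Complex.norm_real, Real.norm_of_nonneg (by positivity)]
    calc _ ≤ (C * |deriv (D.u b) (coding ω)| ^ s) *
          (C ^ n * ‖f‖ * ‖(S.symbolicOp s hs ^ n) 1 (consWord b ω)‖) :=
          mul_le_mul (h b ω) (ih _) (norm_nonneg _) (by positivity)
      _ = _ := by ring

theorem spectralRadius_symbolicOp_le_mul {s t : ℝ} (hs : S.PowSummable s) (ht : S.PowSummable t)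
    (C : NNReal) (h : ∀ (b : S.carrier) (ω : S.Word),
      |deriv (D.u b) (coding ω)| ^ t ≤ C * |deriv (D.u b) (coding ω)| ^ s) :
    spectralRadius ℂ (S.symbolicOp t ht) ≤ C * spectralRadius ℂ (S.symbolicOp s hs) := by
  refine @spectralRadius_le_mul_of_norm_pow_le ((S.Word →ᵇ ℂ) →L[ℂ] (S.Word →ᵇ ℂ)) _ _ _
    (S.symbolicOp t ht) (S.symbolicOp s hs) C fun n => ?_
  refine opNorm_le_of_forall_norm_apply_le _ (by positivity) fun f ω => ?_
  refine (norm_symbolicOp_pow_apply_le hs ht C.2 h f n ω).trans ?_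
  have h1 := norm_apply_one_le_opNorm (S.symbolicOp s hs ^ n) ω
  calc _ ≤ (C : ℝ) ^ n * ‖f‖ * ‖S.symbolicOp s hs ^ n‖ :=
        mul_le_mul_of_nonneg_left h1 (by positivity)
    _ = (C : ℝ) ^ n * ‖S.symbolicOp s hs ^ n‖ * ‖f‖ := by ring

theorem le_spectralRadius_symbolicOp [Nonempty S.Word] {s : ℝ} (hs : S.PowSummable s) (C : NNReal)
    (h : ∀ ω : S.Word, C ≤ ∑' b : S.carrier, |deriv (D.u b) (coding ω)| ^ s) :
    (C : ENNReal) ≤ spectralRadius ℂ (S.symbolicOp s hs) := by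
  have h1 : ∀ (n : ℕ) (ω : S.Word), (C : ℝ) ^ n ≤ ‖(S.symbolicOp s hs ^ n) 1 ω‖ := by
    intro n
    induction n with
    | zero => intro ω; simp
    | succ n ih =>
      intro ω
      rw [norm_symbolicOp_pow_succ_one, pow_succ']
      calc (C : ℝ) * C ^ n ≤ (∑' b : S.carrier, |deriv (D.u b) (coding ω)| ^ s) * C ^ n :=
            mul_le_mul_of_nonneg_right (h ω) (by positivity)
        _ = ∑' b : S.carrier, |deriv (D.u b) (coding ω)| ^ s * C ^ n := by rw [tsum_mul_right]
        _ ≤ _ := Summable.tsum_le_tsum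
            (fun b => mul_le_mul_of_nonneg_left (ih _) (by positivity))
            ((summable_weight hs ω).mul_right _) (summable_weight_mul_norm hs _ ω)
  refine @le_spectralRadius_of_pow_le_norm ((S.Word →ᵇ ℂ) →L[ℂ] (S.Word →ᵇ ℂ)) _ _ _
    (S.symbolicOp s hs) C fun n => ?_
  obtain ⟨ω⟩ := ‹Nonempty S.Word›
  exact (h1 n ω).trans (norm_apply_one_le_opNorm (S.symbolicOp s hs ^ n) ω)

theorem spectralRadius_symbolicOp_le {s : ℝ} (hs : S.PowSummable s) (C : NNReal)
    (h : ∀ ω : S.Word, ∑' b : S.carrier, |deriv (D.u b) (coding ω)| ^ s ≤ C) :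
    spectralRadius ℂ (S.symbolicOp s hs) ≤ C := by
  refine @spectralRadius_le_of_norm_le ((S.Word →ᵇ ℂ) →L[ℂ] (S.Word →ᵇ ℂ)) _ _ _
    (S.symbolicOp s hs) C ?_
  refine opNorm_le_of_forall_norm_apply_le _ C.2 fun f ω => ?_
  refine le_trans ?_ (mul_le_mul_of_nonneg_right (h ω) (norm_nonneg f))
  rw [symbolicOp_apply, ← tsum_mul_right]
  refine tsum_of_norm_bounded ((summable_weight hs ω).mul_right _).hasSum fun b => ?_
  rw [norm_mul, Complex.norm_real, Real.norm_of_nonneg (by positivity)]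
  exact mul_le_mul_of_nonneg_left (f.norm_coe_le_norm _) (by positivity)

theorem exists_powSummable_of_pressure_ne_top {s : ℝ} (h : S.pressure s ≠ ⊤) :
    ∃ hs : S.PowSummable s, S.pressure s = ENNReal.log (spectralRadius ℂ (S.symbolicOp s hs)) := by
  by_cases hs : S.PowSummable s
  · exact ⟨hs, by rw [pressure, dif_pos hs]⟩
  · exact absurd (by rw [pressure, dif_neg hs]) h

theorem spectralRadius_of_pressure_eq_zero {s : ℝ} (h : S.pressure s = 0) :
    ∃ hs : S.PowSummable s, spectralRadius ℂ (S.symbolicOp s hs) = 1 := by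
  obtain ⟨hs, h1⟩ := exists_powSummable_of_pressure_ne_top (S := S) (s := s) (by rw [h]; simp)
  exact ⟨hs, ENNReal.log_injective (by rw [← h1, h, ENNReal.log_one])⟩

/-- Without words the operator algebra is trivial, its spectral radii are `0`, and the pressure is
never `0`. -/
theorem nonempty_word_of_pressure_eq_zero {s : ℝ} (h : S.pressure s = 0) : Nonempty S.Word := by
  by_contra hne
  rw [not_nonempty_iff] at hne
  obtain ⟨hs, h1⟩ := spectralRadius_of_pressure_eq_zero h
  have : Subsingleton (S.Word →ᵇ ℂ) := ⟨fun f g => by ext ω; exact isEmptyElim ω⟩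
  have : Subsingleton ((S.Word →ᵇ ℂ) →L[ℂ] (S.Word →ᵇ ℂ)) := ⟨fun f g => by
    ext1 x; exact Subsingleton.elim _ _⟩
  rw [spectrum.SpectralRadius.of_subsingleton] at h1
  exact zero_ne_one h1

/-- The pressure function has at most one zero, and this zero is the Bowen parameter. -/
theorem bowen_eq_of_pressure_eq_zero {t : ℝ} (h : S.pressure t = 0) :
    S.bowen = (t : EReal) := by
  refine le_antisymm (sInf_le ⟨t, h.le, rfl⟩) (le_sInf ?_)
  rintro _ ⟨s, hsP, rfl⟩
  rw [EReal.coe_le_coe_iff]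
  by_contra! hlt
  obtain ⟨ht, ht1⟩ := spectralRadius_of_pressure_eq_zero h
  obtain ⟨hs, hs1⟩ := exists_powSummable_of_pressure_ne_top (S := S) (s := s)
    (ne_top_of_le_ne_top (by simp) hsP)
  rw [mem_ofPred_eq, hs1, ← ENNReal.log_one, ENNReal.log_le_log_iff] at hsP
  obtain ⟨ω⟩ := nonempty_word_of_pressure_eq_zero h
  obtain ⟨lam, hlam, hle⟩ := abs_deriv_lt_one D
  have h0 : 0 < lam := (abs_deriv_pos (ω 0) ω).trans_le (hle S _ _)
  obtain ⟨κ, hκ⟩ : ∃ κ : NNReal, (κ : ℝ) = lam ^ (t - s) :=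
    ⟨⟨lam ^ (t - s), by positivity⟩, rfl⟩
  -- Uniform contraction makes the pressure strictly decreasing: passing from `s` to `t > s`
  -- multiplies each weight by at most `lam ^ (t - s) < 1`, so spectral radius at most one at `s`
  -- excludes spectral radius one at `t`.
  have h1 := spectralRadius_symbolicOp_le_mul hs ht κ
    fun b ω => by
      have hp := abs_deriv_pos b ω
      have : t = (t - s) + s := by ring
      rw [hκ]
      conv_lhs => rw [this, Real.rpow_add hp]
      exact mul_le_mul_of_nonneg_right (Real.rpow_le_rpow hp.le (hle S b ω) (by linarith))
        (by positivity)
  rw [ht1] at h1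
  have h2 : (κ : ENNReal) < 1 := by
    rw [ENNReal.coe_lt_one_iff, ← NNReal.coe_lt_coe, hκ]
    exact Real.rpow_lt_one h0.le hlam (by linarith)
  exact absurd (h1.trans (mul_le_mul_right hsP _)) (by rw [mul_one]; exact not_le.2 h2)

/-- The spectral radius, here `1`, lies between the infimum and the supremum of the operator applied
to `1`. This lemma and the next are the two halves; together they pin down `η_0` of a regular set.
-/
theorem one_le_of_pressure_eq_zero {t C : ℝ} (h : S.pressure t = 0)
    (hC : ∀ ω : S.Word, ∑' b : S.carrier, |deriv (D.u b) (coding ω)| ^ t ≤ C) : 1 ≤ C := by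
  obtain ⟨ht, ht1⟩ := spectralRadius_of_pressure_eq_zero h
  have := nonempty_word_of_pressure_eq_zero h
  have h0 : 0 ≤ C := (tsum_nonneg fun b => by positivity).trans (hC (Classical.arbitrary _))
  have h1 := spectralRadius_symbolicOp_le ht ⟨C, h0⟩ hC
  rw [ht1] at h1
  exact NNReal.coe_le_coe.2 (ENNReal.coe_le_coe.1 h1)

theorem le_one_of_pressure_eq_zero {t C : ℝ} (h : S.pressure t = 0) (h0 : 0 ≤ C)
    (hC : ∀ ω : S.Word, C ≤ ∑' b : S.carrier, |deriv (D.u b) (coding ω)| ^ t) : C ≤ 1 := by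
  obtain ⟨ht, ht1⟩ := spectralRadius_of_pressure_eq_zero h
  have := nonempty_word_of_pressure_eq_zero h
  have h1 := le_spectralRadius_symbolicOp ht ⟨C, h0⟩ hC
  rw [ht1] at h1
  exact NNReal.coe_le_coe.2 (ENNReal.coe_le_coe.1 h1)

/-- Two letters would give two weights, each at least `1` for `s ≤ 0` and each near `1` for small `s
> 0`. Their sum stays above `3 / 2`, so the pressure is positive for all `s` below some `ε > 0`, and
`δ_S ≥ ε`. -/
theorem subsingleton_of_bowen_le_zero (h : S.bowen ≤ 0) : S.carrier.Subsingleton := by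
  intro b₁ hb₁ b₂ hb₂
  by_contra hne
  obtain ⟨lam, hlam, hle⟩ := abs_deriv_lt_one D
  obtain ⟨M, hM⟩ := D.bounded_v
  -- A lower bound for the derivative that does not depend on the word, so that a single `ε` works
  -- for all words.
  set c : ℝ → ℝ := fun b => |b| ^ D.q * Real.exp (-M) with hc
  have hcle : ∀ (b : S.carrier) (ω : S.Word), c b ≤ |deriv (D.u b) (coding ω)| := fun b ω => by
    rw [D.deriv_eq _ (S.mem_U b) _ (coding_mem ω)]
    refine mul_le_mul_of_nonneg_left (Real.exp_le_exp.2 ?_) (by positivity)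
    exact (abs_le.1 (hM _ (S.mem_U b) _ (coding_mem ω))).1
  have hcpos : ∀ b : S.carrier, 0 < c b := fun b =>
    mul_pos (Real.rpow_pos_of_pos (abs_pos.2 (S.ne_zero b)) _) (Real.exp_pos _)
  have hcont : ContinuousAt (fun s : ℝ => c b₁ ^ s + c b₂ ^ s) 0 :=
    (Real.continuousAt_const_rpow (hcpos ⟨b₁, hb₁⟩).ne').add
      (Real.continuousAt_const_rpow (hcpos ⟨b₂, hb₂⟩).ne')
  -- The sum equals `2` at `s = 0`; any constant strictly between `1` and `2` would serve.
  have hev : ∀ᶠ s in 𝓝 (0 : ℝ), (3 / 2 : ℝ) < c b₁ ^ s + c b₂ ^ s :=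
    hcont.eventually (lt_mem_nhds (by norm_num))
  obtain ⟨ε, hε, hball⟩ := Metric.eventually_nhds_iff.1 hev
  obtain ⟨_, ⟨s, hsP, rfl⟩, hsε⟩ := sInf_lt_iff.1 (h.trans_lt (EReal.coe_pos.2 hε))
  rw [EReal.coe_lt_coe_iff] at hsε
  obtain ⟨hs, hs1⟩ := exists_powSummable_of_pressure_ne_top (S := S) (s := s)
    (ne_top_of_le_ne_top (by simp) hsP)
  rw [mem_ofPred_eq, hs1, ← ENNReal.log_one, ENNReal.log_le_log_iff] at hsP
  have : Nonempty S.Word := ⟨fun _ => ⟨b₁, hb₁⟩⟩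
  have key : ∀ ω : S.Word, (3 / 2 : ℝ) ≤ |deriv (D.u b₁) (coding ω)| ^ s +
      |deriv (D.u b₂) (coding ω)| ^ s := fun ω => by
    rcases le_total s 0 with hs0 | hs0
    · have h1 := Real.one_le_rpow_of_pos_of_le_one_of_nonpos (abs_deriv_pos ⟨b₁, hb₁⟩ ω)
        ((hle S _ _).trans hlam.le) hs0
      have h2 := Real.one_le_rpow_of_pos_of_le_one_of_nonpos (abs_deriv_pos ⟨b₂, hb₂⟩ ω)
        ((hle S _ _).trans hlam.le) hs0
      simp only at h1 h2
      linarith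
    · have h1 := Real.rpow_le_rpow (hcpos ⟨b₁, hb₁⟩).le (hcle ⟨b₁, hb₁⟩ ω) hs0
      have h2 := Real.rpow_le_rpow (hcpos ⟨b₂, hb₂⟩).le (hcle ⟨b₂, hb₂⟩ ω) hs0
      have h3 := hball (y := s) (by rw [Real.dist_eq, sub_zero, abs_of_nonneg hs0]; exact hsε)
      simp only at h1 h2
      linarith
  have h1 := le_spectralRadius_symbolicOp hs (3 / 2) fun ω => by
    refine le_trans ?_ ((summable_weight hs ω).sum_le_tsum
      ({⟨b₁, hb₁⟩, ⟨b₂, hb₂⟩} : Finset S.carrier) fun b _ => by positivity)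
    rw [Finset.sum_pair (by simpa using hne)]
    exact_mod_cast key ω
  have h2 : ((3 / 2 : NNReal) : ENNReal) ≤ ((1 : NNReal) : ENNReal) := by simpa using h1.trans hsP
  rw [ENNReal.coe_le_coe, ← NNReal.coe_le_coe] at h2
  norm_num at h2

end PACSystem.IndexSet

/-! ### Complex-analytic preliminaries and evaluation functionals. -/

theorem frequently_nhdsNE_of_eventually_real {p : ℂ → Prop} {x : ℝ}
    (h : ∀ᶠ y : ℝ in 𝓝 x, p y) : ∃ᶠ z in 𝓝[≠] (x : ℂ), p z := by
  have ht : Tendsto (fun y : ℝ => (y : ℂ)) (𝓝[≠] x) (𝓝[≠] (x : ℂ)) :=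
    tendsto_nhdsWithin_of_tendsto_nhds_of_eventually_within _
      (Complex.continuous_ofReal.continuousAt.mono_left nhdsWithin_le_nhds)
      (eventually_nhdsWithin_of_forall fun y hy h => hy (Complex.ofReal_inj.1 h))
  exact ht.frequently (h.filter_mono nhdsWithin_le_nhds).frequently

/-- A zero of `f` makes `f ^ j * g` vanish to order at least `j`. -/
theorem iteratedDeriv_pow_mul_eq_zero {f g : ℂ → ℂ} {z : ℂ} (hf : AnalyticAt ℂ f z)
    (hg : AnalyticAt ℂ g z) (h0 : f z = 0) {i j : ℕ} (hij : i < j) :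
    iteratedDeriv i (fun w => f w ^ j * g w) z = 0 := by
  have ha : AnalyticAt ℂ (fun w => f w ^ j * g w) z := (hf.pow j).mul hg
  refine (natCast_le_analyticOrderAt_iff_iteratedDeriv_eq_zero ha).1 ?_ i hij
  have h1 : (1 : ℕ∞) ≤ analyticOrderAt f z :=
    Order.one_le_iff_ne_zero.2 (hf.analyticOrderAt_ne_zero.2 h0)
  have h2 : analyticOrderAt (f ^ j * g) z = j • analyticOrderAt f z + analyticOrderAt g z := by
    rw [analyticOrderAt_mul (hf.pow j) hg, analyticOrderAt_pow hf]
  change (j : ℕ∞) ≤ analyticOrderAt (f ^ j * g) z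
  rw [h2]
  refine le_trans ?_ le_self_add
  rw [nsmul_eq_mul]
  simpa using mul_le_mul_right h1 (j : ℕ∞)

/-- The Neumann series of zero: only `0 ^ 0 = 1` survives. It evaluates `Q₁`, `Q` and the series
defining `c̃` for empty `S`. -/
theorem hasSum_apply_zero_pow {R M : Type*} [MonoidWithZero R] [AddCommMonoid M]
    [TopologicalSpace M] (φ : R → M) (h0 : φ 0 = 0) : HasSum (fun n : ℕ => φ (0 ^ n)) (φ 1) := by
  simpa using hasSum_single (f := fun n : ℕ => φ (0 ^ n)) 0 fun n hn => by
    rw [zero_pow hn, h0]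

namespace BddHol

variable {W : Set ℂ}

/-- Evaluation at a point of `W`. -/
noncomputable def evalCLM (x : W) : BddHol W →L[ℂ] ℂ :=
  (BoundedContinuousFunction.evalCLM ℂ x).comp toBCF

theorem evalCLM_apply (x : W) (f : BddHol W) : evalCLM x f = f.ev x := (ev_coe f x).symm

theorem norm_le_of_forall_ev {f : BddHol W} {C : ℝ} (h0 : 0 ≤ C)
    (h : ∀ x ∈ W, ‖f.ev x‖ ≤ C) : ‖f‖ ≤ C := by
  rw [← norm_toBCF]
  exact (BoundedContinuousFunction.norm_le h0).2 fun x => by rw [← ev_coe]; exact h x x.2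

theorem ev_zero (x : ℂ) : (0 : BddHol W).ev x = 0 := by
  by_cases h : x ∈ W <;> simp [ev, h]

end BddHol

/-! ### Identities and vanishing of the operators `β_{i,j}`. -/

namespace ComplexExtension

variable {D : PACSystem} {S : D.IndexSet} (E : ComplexExtension D S)

theorem nu_apply (f : E.B) : E.nu f = f.ev 0 := BddHol.evalCLM_apply ⟨0, E.zero_mem_V⟩ f

theorem ev_h (δ : ℝ) {x : ℂ} (hx : x ∈ E.V) : (E.h δ).ev x = Complex.exp (δ * E.v 0 x) :=
  BddHol.ev_mk _ _ hx

theorem rankOne_apply (f : E.B) (σ : E.B →L[ℂ] ℂ) (g : E.B) : E.rankOne f σ g = σ g • f := rfl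

theorem nu_h_ne_zero (δ : ℝ) : E.nu (E.h δ) ≠ 0 := by
  rw [nu_apply, E.ev_h δ E.zero_mem_V]
  exact Complex.exp_ne_zero _

theorem eventually_mem_real :
    ∀ᶠ x : ℝ in 𝓝 0, x ∈ D.U ∧ x ∈ D.V ∧ (x : ℂ) ∈ E.U ∧ (x : ℂ) ∈ E.V := by
  have hc : Tendsto (fun x : ℝ => (x : ℂ)) (𝓝 0) (𝓝 0) := by
    simpa using Complex.continuous_ofReal.tendsto 0
  filter_upwards [D.isOpen_U.mem_nhds D.zero_mem_U, D.isOpen_V.mem_nhds D.zero_mem_V,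
    hc (E.isOpen_U.mem_nhds E.zero_mem_U), hc (E.isOpen_V.mem_nhds E.zero_mem_V)]
    with x h1 h2 h3 h4 using ⟨h1, h2, h3, h4⟩

/-- The real and complex data are certain to overlap only near `0`, which lies in both open sets;
connectedness of `V_ℂ` and the identity theorem do the rest. -/
theorem eqOn_zero_of_real {f : ℂ → ℂ} (hf : DifferentiableOn ℂ f E.V)
    (h : ∀ᶠ x : ℝ in 𝓝 0, f x = 0) {x : ℂ} (hx : x ∈ E.V) : f x = 0 :=
  (hf.analyticOnNhd E.isOpen_V).eqOn_zero_of_preconnected_of_frequently_eq_zero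
    E.connected_V.isPreconnected E.zero_mem_V
    (Complex.ofReal_zero ▸ frequently_nhdsNE_of_eventually_real h) hx

theorem u_zero {x : ℂ} (hx : x ∈ E.V) : E.u 0 x = 0 := by
  refine E.eqOn_zero_of_real
    (fun y hy => (E.differentiableAt_u E.zero_mem_U hy).differentiableWithinAt) ?_ hx
  filter_upwards [E.eventually_mem_real] with y hy
  have h := E.extends_u 0 D.zero_mem_U y hy.2.1 (by simpa using E.zero_mem_U) hy.2.2.2
  rw [D.u_zero y hy.2.1] at h
  simpa using h

theorem v_zero (h0 : ∀ x ∈ D.V, D.v 0 x = 0) {x : ℂ} (hx : x ∈ E.V) : E.v 0 x = 0 := by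
  refine E.eqOn_zero_of_real
    (fun y hy => (E.differentiableAt_v E.zero_mem_U hy).differentiableWithinAt) ?_ hx
  filter_upwards [E.eventually_mem_real] with y hy
  have h := E.extends_v 0 D.zero_mem_U y hy.2.1 (by simpa using E.zero_mem_U) hy.2.2.2
  rw [h0 y hy.2.1] at h
  simpa using h

theorem analyticAt_v_left {b x : ℂ} (hb : b ∈ E.U) (hx : x ∈ E.V) :
    AnalyticAt ℂ (fun b => E.v b x) b :=
  (E.holo_v (b, x) ⟨hb, hx⟩).comp_of_eq (f := fun b : ℂ => (b, x)) (by fun_prop) rfl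

theorem analyticAt_integrand_left (δ : ℝ) (j : ℕ) (f : E.B) {b x : ℂ} (hb : b ∈ E.U)
    (hx : x ∈ E.V) : AnalyticAt ℂ
      (fun b : ℂ => E.v b x ^ j * Complex.exp (δ * E.v b x) * f.ev (E.u b x)) b :=
  (E.analytic_integrand δ j f (b, x) ⟨hb, hx⟩).comp_of_eq (f := fun b : ℂ => (b, x))
    (by fun_prop) rfl

/-- Only a germ at `b = 0` is obtained, because `U_ℂ` need not be connected; derivatives at `b = 0`
see nothing more. -/
theorem eventually_v_apply_zero (h0 : ∀ b ∈ D.U, D.v b 0 = 0) : ∀ᶠ b in 𝓝 (0 : ℂ),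
    E.v b 0 = 0 := by
  refine (E.analyticAt_v_left E.zero_mem_U E.zero_mem_V).frequently_zero_iff_eventually_zero.1 ?_
  rw [← Complex.ofReal_zero]
  refine frequently_nhdsNE_of_eventually_real ?_
  filter_upwards [E.eventually_mem_real] with b hb
  have h := E.extends_v b hb.1 0 D.zero_mem_V hb.2.2.1 (by simpa using E.zero_mem_V)
  rw [h0 b hb.1] at h
  simpa using h

/-- Because `u_0` is constantly `0`, `f ∘ u_0` is the constant `ν f`. Thus the `(0, 0)` term of the
Taylor expansion of `L'` is `η_0 h ν`, and subtracting `c̃ h ν` leaves `ξ h ν`. -/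
theorem betaCoeff_zero_zero (δ : ℝ) : E.betaCoeff δ 0 0 = E.rankOne (E.h δ) E.nu := by
  ext1 f
  refine BddHol.ext_ev fun x hx => ?_
  rw [ev_betaCoeff _ _ _ _ _ hx, betaFormula_eq, rankOne_apply, BddHol.ev_smul, E.ev_h δ hx,
    nu_apply]
  simp [E.u_zero hx, mul_comm]

theorem betaCoeff_eq_zero_of_lt (δ : ℝ) (h0 : ∀ x ∈ D.V, D.v 0 x = 0) {i j : ℕ} (hij : i < j) :
    E.betaCoeff δ i j = 0 := by
  ext1 f
  refine BddHol.ext_ev fun x hx => ?_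
  rw [ev_betaCoeff _ _ _ _ _ hx, betaFormula_eq, zero_apply, BddHol.ev_zero]
  have hg : AnalyticAt ℂ (fun b => Complex.exp (δ * E.v b x) * f.ev (E.u b x)) 0 := by
    simpa using E.analyticAt_integrand_left δ 0 f E.zero_mem_U hx
  have h := iteratedDeriv_pow_mul_eq_zero (E.analyticAt_v_left E.zero_mem_U hx) hg
    (E.v_zero h0 hx) hij
  simp only [mul_assoc] at h ⊢
  rw [h]
  simp

theorem nu_comp_betaCoeff (δ : ℝ) (h0 : ∀ b ∈ D.U, D.v b 0 = 0) (i : ℕ) {j : ℕ} (hj : 0 < j) :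
    E.nu.comp (E.betaCoeff δ i j) = 0 := by
  ext1 f
  rw [ContinuousLinearMap.comp_apply, nu_apply, ev_betaCoeff _ _ _ _ _ E.zero_mem_V,
    betaFormula_eq]
  have h : (fun b : ℂ => E.v b 0 ^ j * Complex.exp (δ * E.v b 0) * f.ev (E.u b 0)) =ᶠ[𝓝 0]
      fun _ => 0 := by
    filter_upwards [E.eventually_v_apply_zero h0] with b hb
    simp [hb, hj.ne']
  rw [h.iteratedDeriv_eq]
  simp

/-- For `j > 0` the functional `ν` already kills `β_{i,j}`. For `j = 0` one has `h = 1` and `e^{δ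
v(b,0)} = 1` near `b = 0`, so a constant is being differentiated `i > 0` times. -/
theorem nu_betaCoeff_h (δ : ℝ) (h0 : ∀ x ∈ D.V, D.v 0 x = 0) (h0' : ∀ b ∈ D.U, D.v b 0 = 0)
    {i j : ℕ} (hij : (i, j) ≠ (0, 0)) : E.nu (E.betaCoeff δ i j (E.h δ)) = 0 := by
  rcases Nat.eq_zero_or_pos j with rfl | hj
  · have hi : i ≠ 0 := fun h => hij (by rw [h])
    rw [nu_apply, ev_betaCoeff _ _ _ _ _ E.zero_mem_V, betaFormula_eq]
    have h : (fun b : ℂ => E.v b 0 ^ 0 * Complex.exp (δ * E.v b 0) * (E.h δ).ev (E.u b 0))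
        =ᶠ[𝓝 0] fun _ => 1 := by
      filter_upwards [E.eventually_v_apply_zero h0', E.isOpen_U.mem_nhds E.zero_mem_U] with b hb hU
      have hu := E.mapsTo_u b hU 0 E.zero_mem_V
      simp [hb, E.ev_h δ hu, E.v_zero h0 hu]
    rw [h.iteratedDeriv_eq]
    simp [iteratedDeriv_const, hi]
  · exact DFunLike.congr_fun (E.nu_comp_betaCoeff δ h0' i hj) (E.h δ)

theorem betaCoeff_zero_apply_const {f : E.B} {c : ℂ} (hf : ∀ x ∈ E.V, f.ev x = c) {i : ℕ}
    (hi : 0 < i) : E.betaCoeff 0 i 0 f = 0 := by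
  refine BddHol.ext_ev fun x hx => ?_
  rw [ev_betaCoeff _ _ _ _ _ hx, betaFormula_eq, BddHol.ev_zero]
  have h : (fun b : ℂ => E.v b x ^ 0 * Complex.exp ((0 : ℝ) * E.v b x) * f.ev (E.u b x))
      =ᶠ[𝓝 0] fun _ => c := by
    filter_upwards [E.isOpen_U.mem_nhds E.zero_mem_U] with b hU
    simp [hf _ (E.mapsTo_u b hU x hx)]
  rw [h.iteratedDeriv_eq]
  simp [iteratedDeriv_const, hi.ne']

/-! ### Coefficients of the series `α` and `β` -/

theorem monoExp_zero_succ_injective (k : ℕ) :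
    Function.Injective fun j : ℕ => monoExp 0 (j + 1) k := fun a b h => by
  simpa using (monoExp_inj.1 h).2.1

theorem monoExp_single_injective :
    Function.Injective fun p : ℕ+ × ℕ => monoExp (Finsupp.single p.1 1) p.2 0 := fun a b h => by
  have h1 := monoExp_inj.1 h
  exact Prod.ext (Finsupp.single_left_injective one_ne_zero h1.1) h1.2.1

theorem coeff_alphaSeries_of_theta_eq_zero (δ : ℝ) {m : SeriesVar →₀ ℕ}
    (hm : m SeriesVar.theta = 0) : MvPowerSeries.coeff m (E.alphaSeries δ) = 0 :=
  coeff_formalSum_of_forall_ne _ fun j hj => by simp [← hj] at hm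

/-- The four families of monomials in `β` have disjoint exponents, so each coefficient comes from at
most one of them. The later arguments about coefficients of `β` are case distinctions on this list.
-/
theorem coeff_betaSeries_cases (δ : ℝ) (m : SeriesVar →₀ ℕ) :
    (m = monoExp 0 0 1 ∧
      MvPowerSeries.coeff m (E.betaSeries δ) = E.rankOne (E.h δ) E.nu) ∨
    (∃ j, m = monoExp 0 (j + 1) 0 ∧
      MvPowerSeries.coeff m (E.betaSeries δ) = E.cTilde δ • E.betaCoeff δ 0 (j + 1)) ∨
    (∃ j, m = monoExp 0 (j + 1) 1 ∧
      MvPowerSeries.coeff m (E.betaSeries δ) = E.betaCoeff δ 0 (j + 1)) ∨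
    (∃ (i : ℕ+) (j : ℕ), m = monoExp (Finsupp.single i 1) j 0 ∧
      MvPowerSeries.coeff m (E.betaSeries δ) = E.betaCoeff δ i j) ∨
    MvPowerSeries.coeff m (E.betaSeries δ) = 0 := by
  classical
  rw [betaSeries, map_add, map_add, map_add]
  by_cases h1 : m = monoExp 0 0 1
  · subst h1
    left
    rw [MvPowerSeries.coeff_monomial_same, coeff_formalSum_of_forall_ne,
      coeff_formalSum_of_forall_ne, coeff_formalSum_of_forall_ne]
    · simp
    all_goals simp [monoExp_inj]
  right
  rw [MvPowerSeries.coeff_monomial_ne h1, zero_add]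
  by_cases h2 : ∃ j, monoExp 0 (j + 1) 0 = m
  · obtain ⟨j, rfl⟩ := h2
    left
    refine ⟨j, rfl, ?_⟩
    rw [coeff_formalSum_apply (monoExp_zero_succ_injective 0), coeff_formalSum_of_forall_ne,
      coeff_formalSum_of_forall_ne]
    · simp
    all_goals simp [monoExp_inj]
  right
  rw [coeff_formalSum_of_forall_ne _ (not_exists.1 h2), zero_add]
  by_cases h3 : ∃ j, monoExp 0 (j + 1) 1 = m
  · obtain ⟨j, rfl⟩ := h3
    left
    refine ⟨j, rfl, ?_⟩
    rw [coeff_formalSum_apply (monoExp_zero_succ_injective 1), coeff_formalSum_of_forall_ne]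
    · simp
    all_goals simp [monoExp_inj]
  right
  rw [coeff_formalSum_of_forall_ne _ (not_exists.1 h3), zero_add]
  by_cases h4 : ∃ p : ℕ+ × ℕ, monoExp (Finsupp.single p.1 1) p.2 0 = m
  · obtain ⟨p, rfl⟩ := h4
    exact Or.inl ⟨p.1, p.2, rfl, coeff_formalSum_apply monoExp_single_injective _ p⟩
  · exact Or.inr (coeff_formalSum_of_forall_ne _ (not_exists.1 h4))

theorem coeff_zero_betaSeries (δ : ℝ) : MvPowerSeries.coeff 0 (E.betaSeries δ) = 0 := by
  have h : ∀ I j k, monoExp I j k = 0 → I = 0 ∧ j = 0 ∧ k = 0 := fun I j k h =>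
    ⟨by simpa using congrArg etaPart h |>.trans (by ext; simp : etaPart 0 = 0),
      by simpa using DFunLike.congr_fun h SeriesVar.theta,
      by simpa using DFunLike.congr_fun h SeriesVar.xi⟩
  rcases E.coeff_betaSeries_cases δ 0 with ⟨h0, -⟩ | ⟨j, h0, -⟩ | ⟨j, h0, -⟩ | ⟨i, j, h0, -⟩ | h0
  · simpa using h _ _ _ h0.symm
  · simpa using h _ _ _ h0.symm
  · simpa using h _ _ _ h0.symm
  · simpa using h _ _ _ h0.symm
  · exact h0

/-! ### Empty index set -/

theorem transfer_of_isEmpty {T : Set ℝ} (hT : T = ∅) (s : ℝ) : E.transfer T s = 0 := by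
  subst hT
  ext1 f
  refine BddHol.ext_ev fun x hx => ?_
  rw [E.ev_transfer (by simp) summable_empty f hx, zero_apply, BddHol.ev_zero, tsum_empty]

theorem alphaCoeff_of_isEmpty {δ : ℝ} (hΘ : S.finiteness < (δ : EReal)) (hS : S.carrier = ∅)
    (j : ℕ) : E.alphaCoeff δ j = 0 := by
  have : IsEmpty S.carrier := isEmpty_coe_sort.2 hS
  ext1 f
  refine BddHol.ext_ev fun x hx => ?_
  rw [E.ev_alphaCoeff hΘ j f hx, zero_apply, BddHol.ev_zero, tsum_empty]

theorem alphaSeries_of_isEmpty {δ : ℝ} (hΘ : S.finiteness < (δ : EReal)) (hS : S.carrier = ∅) :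
    E.alphaSeries δ = 0 := by
  ext m : 1
  by_cases h : ∃ j, monoExp 0 (j + 1) 0 = m
  · obtain ⟨j, rfl⟩ := h
    rw [alphaSeries, coeff_formalSum_apply (monoExp_zero_succ_injective 0),
      E.alphaCoeff_of_isEmpty hΘ hS, map_zero]
  · rw [alphaSeries, coeff_formalSum_of_forall_ne _ (not_exists.1 h), map_zero]

variable {δ : ℝ}

theorem L₁_of_isEmpty (hS : S.carrier = ∅) : E.L₁ δ = 0 := E.transfer_of_isEmpty hS δ

theorem Q₁_of_isEmpty (hS : S.carrier = ∅) : E.Q₁ δ = 1 := by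
  rw [Q₁, E.L₁_of_isEmpty hS]
  exact (hasSum_apply_zero_pow (fun T => T) rfl).tsum_eq

theorem cTilde_of_isEmpty (hS : S.carrier = ∅) : E.cTilde δ = 1 / E.nu (E.h δ) := by
  have h := hasSum_apply_zero_pow (fun T : E.B →L[ℂ] E.B => E.nu (T (E.h δ))) (by simp)
  rw [cTilde, E.L₁_of_isEmpty hS, if_pos h.summable, h.tsum_eq]
  rfl

theorem L_of_isEmpty (hS : S.carrier = ∅) : E.L δ = (1 / E.nu (E.h δ)) • E.rankOne (E.h δ) E.nu := by
  rw [L, E.L₁_of_isEmpty hS, zero_add, E.cTilde_of_isEmpty hS]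

theorem isFixedPair_h_nu_of_isEmpty (hS : S.carrier = ∅) : E.IsFixedPair δ (E.h δ) E.nu := by
  have h0 := E.nu_h_ne_zero δ
  rw [IsFixedPair, E.L_of_isEmpty hS]
  constructor
  · rw [_root_.smul_apply, rankOne_apply, smul_smul, one_div_mul_cancel h0, one_smul]
  · ext f
    simp [rankOne_apply]
    field_simp

theorem exists_isNormalizedPair_of_isEmpty (hS : S.carrier = ∅) : ∃ g μ, E.IsNormalizedPair δ g μ := by
  have h0 := E.nu_h_ne_zero δ
  obtain ⟨h1, h2⟩ := E.isFixedPair_h_nu_of_isEmpty (δ := δ) hS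
  refine ⟨(E.nu (E.h δ))⁻¹ • E.h δ, (E.nu (E.h δ))⁻¹ • E.nu, ⟨?_, ?_⟩, ?_, ?_⟩
  · rw [map_smul, h1]
  · rw [ContinuousLinearMap.smul_comp, h2]
  · simp [h0]
  · simp [h0]

/-- With `L = (1 / ν h) h ν` the fixed point equations read `g = (ν g / ν h) h` and `μ = (μ h / ν h)
ν`; insert `ν g = μ h = 1`. -/
theorem smul_eq_of_isNormalizedPair_of_isEmpty (hS : S.carrier = ∅) {g : E.B} {μ : E.B →L[ℂ] ℂ}
    (h : E.IsNormalizedPair δ g μ) :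
    E.nu (E.h δ) • g = E.h δ ∧ E.nu (E.h δ) • μ = E.nu := by
  have h0 := E.nu_h_ne_zero δ
  obtain ⟨⟨h1, h2⟩, h3, h4⟩ := h
  rw [E.L_of_isEmpty hS] at h1 h2
  constructor
  · conv_lhs => rw [← h1]
    rw [_root_.smul_apply, rankOne_apply, h4, one_smul, smul_smul,
      mul_one_div_cancel h0, one_smul]
  · conv_lhs => rw [← h2]
    ext f
    simp [rankOne_apply, h3]
    field_simp

theorem R_of_isEmpty (hS : S.carrier = ∅) : E.R δ (E.h δ) E.nu = 0 := by
  rw [R, E.L_of_isEmpty hS, cConst, sub_self]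

theorem Q_of_isEmpty (hS : S.carrier = ∅) : E.Q δ (E.h δ) E.nu = 1 := by
  rw [Q, E.R_of_isEmpty hS]
  exact (hasSum_apply_zero_pow (fun T => T) rfl).tsum_eq

theorem coeff_xiSeries_of_isEmpty (hS : S.carrier = ∅) (hΘ : S.finiteness < (δ : EReal)) (m : SeriesVar →₀ ℕ) :
    MvPowerSeries.coeff m (E.xiSeries δ (E.h δ) E.nu) =
      ∑ᶠ p : ℕ, E.nu (MvPowerSeries.coeff m (E.betaSeries δ ^ (p + 1)) (E.h δ)) := by
  change (∑ᶠ p : ℕ, E.nu ((MvPowerSeries.coeff m (E.deltaSeries δ *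
    (MvPowerSeries.C (E.Q δ (E.h δ) E.nu) * E.deltaSeries δ) ^ p) : E.B →L[ℂ] E.B) (E.h δ))) = _
  rw [E.Q_of_isEmpty hS, deltaSeries, E.alphaSeries_of_isEmpty hΘ hS, zero_add, map_one, one_mul]
  simp only [pow_succ']

end ComplexExtension

namespace ComplexExtension

variable {D : PACSystem} {S : D.IndexSet} (E : ComplexExtension D S) {δ : ℝ}

/-! ### Vanishing of coefficients for the empty index set -/

theorem coeff_betaSeries_eq_zero_of_lt (h0 : ∀ x ∈ D.V, D.v 0 x = 0) {m : SeriesVar →₀ ℕ}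
    (hm : multSum (etaPart m) < m SeriesVar.theta) :
    MvPowerSeries.coeff m (E.betaSeries δ) = 0 := by
  rcases E.coeff_betaSeries_cases δ m with ⟨rfl, -⟩ | ⟨j, rfl, h⟩ | ⟨j, rfl, h⟩ | ⟨i, j, rfl, h⟩ | h
  · simp at hm
  · rw [h, E.betaCoeff_eq_zero_of_lt δ h0 (Nat.succ_pos j), smul_zero]
  · rw [h, E.betaCoeff_eq_zero_of_lt δ h0 (Nat.succ_pos j)]
  · rw [h, E.betaCoeff_eq_zero_of_lt δ h0 (by simpa using hm)]
  · exact h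

theorem coeff_betaSeries_pow_eq_zero_of_lt (h0 : ∀ x ∈ D.V, D.v 0 x = 0) (p : ℕ)
    {m : SeriesVar →₀ ℕ} (hm : multSum (etaPart m) < m SeriesVar.theta) :
    MvPowerSeries.coeff m (E.betaSeries δ ^ p) = 0 := by
  classical
  induction p generalizing m with
  | zero =>
    rw [pow_zero, MvPowerSeries.coeff_one, if_neg]
    rintro rfl
    simp at hm
  | succ p ih =>
    rw [pow_succ, MvPowerSeries.coeff_mul]
    refine Finset.sum_eq_zero fun x hx => ?_
    have hx' := Finset.HasAntidiagonal.mem_antidiagonal.1 hx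
    by_cases h1 : multSum (etaPart x.1) < x.1 SeriesVar.theta
    · rw [ih h1, zero_mul]
    · rw [E.coeff_betaSeries_eq_zero_of_lt h0, mul_zero]
      rw [← hx', etaPart_add, multSum_add, Finsupp.add_apply] at hm
      omega

/-- Peel off the leftmost factor of `β ^ (p + 1)`. If it is `ξ h ν`, the remaining power again
stands behind `ν` and has the same `η` and `θ` exponents, so induction applies. A factor `β_{i,j}`
with `j > 0` is killed by `ν`. A factor `η_i β_{i,0}` uses up `Σ` without any `θ`, and the rest then
has too many `θ`s to survive. -/
theorem nu_coeff_betaSeries_pow_eq_zero (h0 : ∀ x ∈ D.V, D.v 0 x = 0)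
    (h0' : ∀ b ∈ D.U, D.v b 0 = 0) (p : ℕ) {m : SeriesVar →₀ ℕ}
    (hm : multSum (etaPart m) ≤ m SeriesVar.theta)
    (hm' : etaPart m ≠ 0 ∨ m SeriesVar.theta ≠ 0) (f : E.B) :
    E.nu (MvPowerSeries.coeff m (E.betaSeries δ ^ p) f) = 0 := by
  classical
  induction p generalizing m with
  | zero =>
    rw [pow_zero, MvPowerSeries.coeff_one, if_neg]
    · simp
    rintro rfl
    rcases hm' with h | h
    · exact h (by ext; simp)
    · simp at h
  | succ p ih =>
    rw [pow_succ', MvPowerSeries.coeff_mul, _root_.sum_apply, map_sum]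
    refine Finset.sum_eq_zero fun x hx => ?_
    have hx' := Finset.HasAntidiagonal.mem_antidiagonal.1 hx
    rw [← hx', etaPart_add, multSum_add, Finsupp.add_apply] at hm
    rw [mul_apply_eq_comp]
    by_cases h2 : multSum (etaPart x.2) < x.2 SeriesVar.theta
    · rw [E.coeff_betaSeries_pow_eq_zero_of_lt h0 p h2]
      simp
    -- The right factor has no excess of `θ`, so the left factor must satisfy the inequality; for
    -- `η_i θ ^ j` this means `j ≥ i > 0`.
    have h1 : multSum (etaPart x.1) ≤ x.1 SeriesVar.theta := by omega
    set F := MvPowerSeries.coeff x.2 (E.betaSeries δ ^ p) f with hF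
    have hnu : ∀ i j, 0 < j → E.nu (E.betaCoeff δ i j F) = 0 := fun i j hj =>
      DFunLike.congr_fun (E.nu_comp_betaCoeff δ h0' i hj) F
    rcases E.coeff_betaSeries_cases δ x.1 with
      ⟨h, h'⟩ | ⟨j, h, h'⟩ | ⟨j, h, h'⟩ | ⟨i, j, h, h'⟩ | h'
    · rw [h', rankOne_apply, map_smul, hF, ih, zero_smul]
      · rw [h] at hm
        simpa using hm
      · rw [← hx', etaPart_add, h] at hm'
        simpa using hm'
    · rw [h', _root_.smul_apply, map_smul, hnu _ _ (Nat.succ_pos j), smul_zero]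
    · rw [h', hnu _ _ (Nat.succ_pos j)]
    · have hij : (i : ℕ) ≤ j := by simpa [h] using h1
      rw [h', hnu _ _ (i.pos.trans_le hij)]
    · rw [h']
      simp

/-- Once `β_{0,j} = 0` for `j > 0`, only `ξ h ν` and the terms `η_i θ ^ j β_{i,j}` remain: `β` is
homogeneous of degree one in `(η, ξ)`, and so `β ^ p` is of degree `p`. -/
theorem coeff_betaSeries_eq_zero_of_card_ne (h0 : ∀ x ∈ D.V, D.v 0 x = 0) {m : SeriesVar →₀ ℕ}
    (hm : multCard (etaPart m) + m SeriesVar.xi ≠ 1) :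
    MvPowerSeries.coeff m (E.betaSeries δ) = 0 := by
  rcases E.coeff_betaSeries_cases δ m with ⟨rfl, -⟩ | ⟨j, rfl, h⟩ | ⟨j, rfl, h⟩ | ⟨i, j, rfl, h⟩ | h
  · simp at hm
  · rw [h, E.betaCoeff_eq_zero_of_lt δ h0 (Nat.succ_pos j), smul_zero]
  · rw [h, E.betaCoeff_eq_zero_of_lt δ h0 (Nat.succ_pos j)]
  · simp at hm
  · exact h

theorem coeff_betaSeries_pow_eq_zero_of_card_ne (h0 : ∀ x ∈ D.V, D.v 0 x = 0) (p : ℕ)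
    {m : SeriesVar →₀ ℕ} (hm : multCard (etaPart m) + m SeriesVar.xi ≠ p) :
    MvPowerSeries.coeff m (E.betaSeries δ ^ p) = 0 := by
  classical
  induction p generalizing m with
  | zero =>
    rw [pow_zero, MvPowerSeries.coeff_one, if_neg]
    rintro rfl
    have : etaPart 0 = 0 := by ext; simp
    simp [this] at hm
  | succ p ih =>
    rw [pow_succ, MvPowerSeries.coeff_mul]
    refine Finset.sum_eq_zero fun x hx => ?_
    have hx' := Finset.HasAntidiagonal.mem_antidiagonal.1 hx
    by_cases h1 : multCard (etaPart x.1) + x.1 SeriesVar.xi = p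
    · rw [E.coeff_betaSeries_eq_zero_of_card_ne h0, mul_zero]
      rw [← hx', etaPart_add, multCard_add, Finsupp.add_apply] at hm
      omega
    · rw [ih h1, zero_mul]

theorem nu_coeff_betaSeries_h_eq_zero (h0 : ∀ x ∈ D.V, D.v 0 x = 0)
    (h0' : ∀ b ∈ D.U, D.v b 0 = 0) {m : SeriesVar →₀ ℕ} (hm : m SeriesVar.xi = 0) :
    E.nu (MvPowerSeries.coeff m (E.betaSeries δ) (E.h δ)) = 0 := by
  rcases E.coeff_betaSeries_cases δ m with ⟨rfl, -⟩ | ⟨j, rfl, h⟩ | ⟨j, rfl, h⟩ | ⟨i, j, rfl, h⟩ | h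
  · simp at hm
  · rw [h, _root_.smul_apply, map_smul, E.nu_betaCoeff_h δ h0 h0' (by simp), smul_zero]
  · rw [h, E.nu_betaCoeff_h δ h0 h0' (by simp)]
  · rw [h, E.nu_betaCoeff_h δ h0 h0' (by simp)]
  · rw [h]
    simp

theorem nu_h_of_v_zero (h0 : ∀ x ∈ D.V, D.v 0 x = 0) : E.nu (E.h δ) = 1 := by
  rw [nu_apply, E.ev_h δ E.zero_mem_V, E.v_zero h0 E.zero_mem_V]
  simp

/-- Here `ν h = 1`, so the normalized pair is `(h, ν)` itself and no rescaling of the coefficients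
occurs. -/
theorem coef_of_isEmpty (hΘ : S.finiteness < (δ : EReal)) (hS : S.carrier = ∅)
    (h0 : ∀ x ∈ D.V, D.v 0 x = 0) {g : E.B} {μ : E.B →L[ℂ] ℂ} (h : E.IsNormalizedPair δ g μ)
    (I : ℕ+ →₀ ℕ) (j k : ℕ) : E.coef δ g μ I j k =
      ∑ᶠ p : ℕ, E.nu (MvPowerSeries.coeff (monoExp I j k) (E.betaSeries δ ^ (p + 1)) (E.h δ)) := by
  obtain ⟨h1, h2⟩ := E.smul_eq_of_isNormalizedPair_of_isEmpty hS h
  rw [E.nu_h_of_v_zero h0, one_smul] at h1 h2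
  rw [coef, h1, h2, E.coeff_xiSeries_of_isEmpty hS hΘ]

theorem coef_eq_zero_of_multSum_le (hΘ : S.finiteness < (δ : EReal)) (hS : S.carrier = ∅)
    (h0 : ∀ x ∈ D.V, D.v 0 x = 0) (h0' : ∀ b ∈ D.U, D.v b 0 = 0)
    {g : E.B} {μ : E.B →L[ℂ] ℂ} (h : E.IsNormalizedPair δ g μ)
    {I : ℕ+ →₀ ℕ} {j : ℕ} (k : ℕ) (hj : multSum I ≤ j) (hIj : (I, j) ≠ (0, 0)) :
    E.coef δ g μ I j k = 0 := by
  rw [E.coef_of_isEmpty hΘ hS h0 h]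
  refine finsum_eq_zero_of_forall_eq_zero fun p =>
    E.nu_coeff_betaSeries_pow_eq_zero h0 h0' _ (by simpa using hj) ?_ _
  rw [etaPart_monoExp, monoExp_theta, ← not_and_or]
  exact fun hc => hIj (Prod.ext hc.1 hc.2)

theorem coef_eq_zero_of_multCard_lt_two (hΘ : S.finiteness < (δ : EReal)) (hS : S.carrier = ∅)
    (h0 : ∀ x ∈ D.V, D.v 0 x = 0) (h0' : ∀ b ∈ D.U, D.v b 0 = 0)
    {g : E.B} {μ : E.B →L[ℂ] ℂ} (h : E.IsNormalizedPair δ g μ)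
    {I : ℕ+ →₀ ℕ} (j : ℕ) (hI : multCard I < 2) : E.coef δ g μ I j 0 = 0 := by
  rw [E.coef_of_isEmpty hΘ hS h0 h]
  refine finsum_eq_zero_of_forall_eq_zero fun p => ?_
  rcases Nat.eq_zero_or_pos p with rfl | hp
  · rw [zero_add, pow_one, E.nu_coeff_betaSeries_h_eq_zero h0 h0' (by simp)]
  · rw [E.coeff_betaSeries_pow_eq_zero_of_card_ne h0]
    · simp
    · rw [etaPart_monoExp, monoExp_xi]
      omega

theorem coef_zero_zero_zero (g : E.B) (μ : E.B →L[ℂ] ℂ) : E.coef δ g μ 0 0 0 = 0 := by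
  classical
  have h0 : monoExp 0 0 0 = 0 := by simp [monoExp]
  have hD : MvPowerSeries.coeff 0 (E.deltaSeries δ) = 0 := by
    rw [deltaSeries, map_add, E.coeff_alphaSeries_of_theta_eq_zero δ (by simp),
      E.coeff_zero_betaSeries, add_zero]
  rw [coef, h0]
  change (∑ᶠ p : ℕ, μ ((MvPowerSeries.coeff 0 (E.deltaSeries δ *
    (MvPowerSeries.C (E.Q δ g μ) * E.deltaSeries δ) ^ p) : E.B →L[ℂ] E.B) g)) = _
  refine finsum_eq_zero_of_forall_eq_zero fun p => ?_
  rw [MvPowerSeries.coeff_mul, Finset.HasAntidiagonal.antidiagonal_zero, Finset.sum_singleton, hD]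
  simp

/-! ### The case `δ = 0` -/

theorem ev_h_zero {x : ℂ} (hx : x ∈ E.V) : (E.h 0).ev x = 1 := by
  rw [E.ev_h 0 hx]
  simp

theorem ev_L₁_zero_of_eq_singleton {b : ℝ} (hb : S.carrier = {b}) (f : E.B) {x : ℂ}
    (hx : x ∈ E.V) : (E.L₁ 0 f).ev x = f.ev (E.u b x) := by
  have hs : Summable fun b' : S.carrier => |(b' : ℝ)| ^ (D.q * 0) := by
    have : Finite S.carrier := by rw [hb]; infer_instance
    exact Summable.of_finite
  rw [L₁, E.ev_transfer E.subset_U hs f hx]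
  have hu : ∀ b' : S.carrier, (b' : ℝ) = b := fun b' => by simpa [hb] using b'.2
  rw [tsum_eq_single ⟨b, by rw [hb]; rfl⟩ fun b' h => absurd (Subtype.ext (hu b')) h]
  simp

theorem L₁_zero_h_of_eq_singleton {b : ℝ} (hb : S.carrier = {b}) : E.L₁ 0 (E.h 0) = E.h 0 := by
  have hbS : b ∈ S.carrier := by rw [hb]; rfl
  refine BddHol.ext_ev fun x hx => ?_
  rw [E.ev_L₁_zero_of_eq_singleton hb _ hx, E.ev_h_zero hx,
    E.ev_h_zero (E.mapsTo_u _ (E.subset_U b hbS) x hx)]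

/-- For `δ = 0` and one letter, `L₁ f = f ∘ u_b` fixes `h = 1`. Every term of the defining series is
`1`, so it diverges and `c̃` takes its default value. -/
theorem cTilde_zero_of_eq_singleton {b : ℝ} (hb : S.carrier = {b}) : E.cTilde 0 = 0 := by
  have hp : ∀ m : ℕ, (E.L₁ 0 ^ m) (E.h 0) = E.h 0 := fun m => by
    induction m with
    | zero => rfl
    | succ m ih => rw [pow_succ, mul_apply_eq_comp, E.L₁_zero_h_of_eq_singleton hb, ih]
  have h1 : ∀ m : ℕ, E.nu ((E.L₁ 0 ^ m) (E.h 0)) = 1 := fun m => by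
    rw [hp, nu_apply, E.ev_h_zero E.zero_mem_V]
  rw [cTilde, if_neg]
  simp only [h1]
  intro h
  simpa using h.tendsto_atTop_zero

/-- The fixed point is coded by the constant word; as a point of the limit set it also lies in
`V_ℂ`. -/
theorem exists_fixedPoint_of_eq_singleton {b : ℝ} (hb : S.carrier = {b}) :
    ∃ p : ℝ, p ∈ D.V ∧ (p : ℂ) ∈ E.V ∧ E.u b p = p := by
  have hbS : b ∈ S.carrier := by rw [hb]; rfl
  have hbU : b ∈ D.U := (S.subset hbS).1
  set ω : S.Word := fun _ => ⟨b, hbS⟩ with hω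
  set p := PACSystem.IndexSet.coding ω with hp
  have hpV : p ∈ D.V := PACSystem.IndexSet.coding_mem ω
  have hpE : (p : ℂ) ∈ E.V := E.limitSet_subset_V p (subset_closure ⟨ω, rfl⟩)
  have hlim := (PACSystem.IndexSet.tendstoUniformly_coding (S := S)).tendsto_at ω
  have hpre : ∀ (n : ℕ) (x : ℝ), PACSystem.IndexSet.prefixMap ω (n + 1) x =
      D.u b (PACSystem.IndexSet.prefixMap ω n x) := by
    intro n
    induction n with
    | zero => intro x; rfl
    | succ n ih => intro x; exact ih _
  have hcont : ContinuousAt (D.u b) p :=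
    ((D.analytic_u (b, p) ⟨hbU, hpV⟩).continuousAt.comp_of_eq
      (f := fun x : ℝ => (b, x)) (by fun_prop) rfl)
  have h1 := (tendsto_add_atTop_iff_nat 1).2 hlim
  simp only [hpre] at h1
  have h2 := tendsto_nhds_unique h1 (hcont.tendsto.comp hlim)
  refine ⟨p, hpV, hpE, ?_⟩
  rw [E.extends_u b hbU p hpV (E.subset_U b hbS) hpE, ← h2]

/-- On a ball around the fixed point the iterates of `u_b` converge to it, so `f` is constant there,
and the identity theorem extends this to `V_ℂ`. The ball is needed because a derivative bound gives
a Lipschitz bound only on convex sets. -/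
theorem ev_const_of_comp_eq {b : ℝ} (hb : S.carrier = {b}) {f : E.B}
    (hf : ∀ x ∈ E.V, f.ev (E.u b x) = f.ev x) : ∃ c, ∀ x ∈ E.V, f.ev x = c := by
  have hbS : b ∈ S.carrier := by rw [hb]; rfl
  have hbU : b ∈ D.U := (S.subset hbS).1
  obtain ⟨p, -, hpV, hpu⟩ := E.exists_fixedPoint_of_eq_singleton hb
  obtain ⟨lam, hlam, hle⟩ := E.contracting
  obtain ⟨r, hr, hrV⟩ := Metric.isOpen_iff.1 E.isOpen_V p hpV
  have hstep : ∀ z ∈ Metric.ball (p : ℂ) r, ‖E.u b z - p‖ ≤ lam * ‖z - p‖ := fun z hz => by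
    have h := (convex_ball (p : ℂ) r).norm_image_sub_le_of_norm_deriv_le
      (fun w hw => E.differentiableAt_u (E.subset_U b hbS) (hrV hw))
      (fun w hw => hle b hbU (E.subset_U b hbS) w (hrV hw)) (Metric.mem_ball_self hr) hz
    rwa [hpu] at h
  have h0 : 0 ≤ lam := (norm_nonneg _).trans (hle b hbU (E.subset_U b hbS) p hpV)
  have hiter : ∀ z ∈ Metric.ball (p : ℂ) r, ∀ n : ℕ,
      ‖(E.u b)^[n] z - p‖ ≤ lam ^ n * ‖z - p‖ ∧ (E.u b)^[n] z ∈ Metric.ball (p : ℂ) r ∧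
        f.ev ((E.u b)^[n] z) = f.ev z := fun z hz n => by
    induction n with
    | zero => simpa using hz
    | succ n ih =>
      obtain ⟨h1, h2, h3⟩ := ih
      have h4 := hstep _ h2
      rw [Function.iterate_succ_apply']
      refine ⟨h4.trans ?_, ?_, (hf _ (hrV h2)).trans h3⟩
      · rw [pow_succ', mul_assoc]
        exact mul_le_mul_of_nonneg_left h1 h0
      · rw [mem_ball_iff_norm] at h2 ⊢
        exact (h4.trans (mul_le_of_le_one_left (norm_nonneg _) hlam.le)).trans_lt h2
  refine ⟨f.ev p, fun x hx => ?_⟩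
  have hconst : ∀ᶠ z in 𝓝 (p : ℂ), f.ev z = f.ev p := by
    filter_upwards [Metric.ball_mem_nhds (p : ℂ) hr] with z hz
    have hlim : Tendsto (fun n : ℕ => (E.u b)^[n] z) atTop (𝓝 (p : ℂ)) := by
      rw [tendsto_iff_norm_sub_tendsto_zero]
      refine squeeze_zero (fun _ => norm_nonneg _) (fun n => (hiter z hz n).1) ?_
      simpa using (tendsto_pow_atTop_nhds_zero_of_lt_one h0 hlam).mul_const ‖z - p‖
    have hc : ContinuousAt f.ev p :=
      (f.differentiableOn_ev.differentiableAt (E.isOpen_V.mem_nhds hpV)).continuousAt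
    have h1 := hc.tendsto.comp hlim
    refine tendsto_nhds_unique (tendsto_const_nhds.congr fun n => ?_) h1
    exact ((hiter z hz n).2.2).symm
  exact (f.differentiableOn_ev.analyticOnNhd E.isOpen_V).eqOn_of_preconnected_of_eventuallyEq
    analyticOnNhd_const E.connected_V.isPreconnected hpV hconst hx

theorem eq_h_of_isNormalizedPair_zero (hδ : S.bowen ≤ 0) {g : E.B} {μ : E.B →L[ℂ] ℂ}
    (h : E.IsNormalizedPair 0 g μ) : g = E.h 0 := by
  obtain ⟨⟨h1, -⟩, -, h4⟩ := h
  have hconst : ∃ c, ∀ x ∈ E.V, g.ev x = c := by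
    rcases (PACSystem.IndexSet.subsingleton_of_bowen_le_zero hδ).eq_empty_or_singleton
      with hS | ⟨b, hb⟩
    · refine ⟨E.cTilde 0, fun x hx => ?_⟩
      rw [L, E.L₁_of_isEmpty hS, zero_add, _root_.smul_apply, rankOne_apply, h4, one_smul] at h1
      rw [← h1, BddHol.ev_smul, E.ev_h_zero hx, mul_one]
    · rw [L, E.cTilde_zero_of_eq_singleton hb, zero_smul, add_zero] at h1
      refine E.ev_const_of_comp_eq hb fun x hx => ?_
      rw [← E.ev_L₁_zero_of_eq_singleton hb g hx, h1]
  obtain ⟨c, hc⟩ := hconst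
  rw [nu_apply, hc 0 E.zero_mem_V] at h4
  exact BddHol.ext_ev fun x hx => by rw [hc x hx, h4, E.ev_h_zero hx]

theorem betaCoeff_zero_apply_h {i : ℕ} (hi : 0 < i) : E.betaCoeff 0 i 0 (E.h 0) = 0 :=
  E.betaCoeff_zero_apply_const (fun _ hx => E.ev_h_zero hx) hi

/-- Since `R g = 0`, a convergent Neumann series gives `Q g = g`; if it is not summable, `Q` is `0`
by default. Proportionality to `g` holds either way and is all that is used. -/
theorem exists_Q_apply_eq_smul (hδ : S.bowen ≤ 0) {g : E.B} {μ : E.B →L[ℂ] ℂ}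
    (h : E.IsNormalizedPair 0 g μ) : ∃ c : ℂ, E.Q 0 g μ g = c • g := by
  have hg := E.eq_h_of_isNormalizedPair_zero hδ h
  obtain ⟨⟨h1, -⟩, h3, -⟩ := h
  rw [← hg] at h3
  have hR : E.R 0 g μ g = 0 := by
    rw [R, _root_.sub_apply, h1, _root_.smul_apply, rankOne_apply, cConst, h3]
    simp
  by_cases hs : Summable fun n : ℕ => E.R 0 g μ ^ n
  · refine ⟨1, ?_⟩
    have h2 := (ContinuousLinearMap.apply ℂ E.B g).hasSum hs.hasSum
    have h4 : HasSum (fun n : ℕ => (E.R 0 g μ ^ n) g) g := by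
      simpa using hasSum_single (f := fun n : ℕ => (E.R 0 g μ ^ n) g) 0 fun n hn => by
        obtain ⟨k, rfl⟩ := Nat.exists_eq_succ_of_ne_zero hn
        rw [pow_succ, mul_apply_eq_comp, hR, map_zero]
    rw [one_smul]
    exact h2.unique h4
  · exact ⟨0, by rw [Q, tsum_eq_zero_of_not_summable hs]; simp⟩

theorem coeff_deltaSeries_zero_apply_h {m : SeriesVar →₀ ℕ} (hm : m SeriesVar.theta = 0) :
    (∃ c : ℂ, MvPowerSeries.coeff m (E.deltaSeries 0) (E.h 0) = c • E.h 0) ∧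
      (etaPart m ≠ 0 → MvPowerSeries.coeff m (E.deltaSeries 0) (E.h 0) = 0) := by
  rw [deltaSeries, map_add, E.coeff_alphaSeries_of_theta_eq_zero 0 hm, zero_add]
  rcases E.coeff_betaSeries_cases 0 m with ⟨rfl, h⟩ | ⟨j, rfl, -⟩ | ⟨j, rfl, -⟩ | ⟨i, j, rfl, h⟩ | h
  · exact ⟨⟨_, by rw [h, rankOne_apply]⟩, by simp⟩
  · simp at hm
  · simp at hm
  · obtain rfl : j = 0 := by simpa using hm
    have h2 := E.betaCoeff_zero_apply_h i.pos
    exact ⟨⟨0, by rw [h, h2, zero_smul]⟩, fun _ => by rw [h, h2]⟩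
  · exact ⟨⟨0, by rw [h, zero_smul]; rfl⟩, fun _ => by rw [h]; rfl⟩

/-- Among the `θ`-free terms `α` is absent, `ξ h ν` preserves the line spanned by `h`, and `η_i
β_{i,0}` kills it. As `T` preserves the line too, a single `η` anywhere in a product annihilates
`h`. -/
theorem coeff_deltaSeries_mul_pow_apply_h {T : E.B →L[ℂ] E.B}
    (hT : ∃ c : ℂ, T (E.h 0) = c • E.h 0) (p : ℕ) {m : SeriesVar →₀ ℕ}
    (hm : m SeriesVar.theta = 0) :
    (∃ c : ℂ, (MvPowerSeries.coeff m (E.deltaSeries 0 *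
      (MvPowerSeries.C T * E.deltaSeries 0) ^ p) : E.B →L[ℂ] E.B) (E.h 0) = c • E.h 0) ∧
    (etaPart m ≠ 0 → (MvPowerSeries.coeff m (E.deltaSeries 0 *
      (MvPowerSeries.C T * E.deltaSeries 0) ^ p) : E.B →L[ℂ] E.B) (E.h 0) = 0) := by
  classical
  induction p generalizing m with
  | zero => simpa using E.coeff_deltaSeries_zero_apply_h hm
  | succ p ih =>
    obtain ⟨t, ht⟩ := hT
    set F := E.deltaSeries 0 * (MvPowerSeries.C T * E.deltaSeries 0) ^ p with hF
    have h1 : E.deltaSeries 0 * (MvPowerSeries.C T * E.deltaSeries 0) ^ (p + 1) =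
        E.deltaSeries 0 * (MvPowerSeries.C T * F) := by
      rw [pow_succ', mul_assoc (MvPowerSeries.C T)]
    have hterm : ∀ x ∈ Finset.HasAntidiagonal.antidiagonal m,
        (∃ c : ℂ, (MvPowerSeries.coeff x.1 (E.deltaSeries 0) *
          MvPowerSeries.coeff x.2 (MvPowerSeries.C T * F)) (E.h 0) = c • E.h 0) ∧
        (etaPart m ≠ 0 → (MvPowerSeries.coeff x.1 (E.deltaSeries 0) *
          MvPowerSeries.coeff x.2 (MvPowerSeries.C T * F)) (E.h 0) = 0) := by
      intro x hx
      have hx' := Finset.HasAntidiagonal.mem_antidiagonal.1 hx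
      rw [← hx', Finsupp.add_apply] at hm
      obtain ⟨hm1, hm2⟩ : x.1 SeriesVar.theta = 0 ∧ x.2 SeriesVar.theta = 0 := by omega
      obtain ⟨⟨c₂, hc₂⟩, h0₂⟩ := ih hm2
      obtain ⟨⟨c₁, hc₁⟩, h0₁⟩ := E.coeff_deltaSeries_zero_apply_h hm1
      rw [mul_apply_eq_comp, MvPowerSeries.coeff_C_mul, mul_apply_eq_comp, hc₂]
      refine ⟨⟨c₂ * t * c₁, ?_⟩, fun hI => ?_⟩
      · rw [map_smul, ht, map_smul, map_smul, hc₁, smul_smul, smul_smul]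
      · by_cases hI2 : etaPart x.2 = 0
        · rw [map_smul, ht, map_smul, map_smul, h0₁, smul_zero, smul_zero]
          rwa [← hx', etaPart_add, hI2, add_zero] at hI
        · rw [← hc₂, h0₂ hI2, map_zero, map_zero]
    rw [h1, MvPowerSeries.coeff_mul, _root_.sum_apply]
    refine ⟨?_, fun hI => Finset.sum_eq_zero fun x hx => (hterm x hx).2 hI⟩
    choose! c hc using fun x hx => (hterm x hx).1
    exact ⟨∑ x ∈ Finset.HasAntidiagonal.antidiagonal m, c x, by
      rw [Finset.sum_smul]; exact Finset.sum_congr rfl hc⟩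

theorem coef_zero_eq_zero (hδ : S.bowen ≤ 0) {g : E.B} {μ : E.B →L[ℂ] ℂ}
    (h : E.IsNormalizedPair 0 g μ) {I : ℕ+ →₀ ℕ} (k : ℕ) (hI : I ≠ 0) :
    E.coef 0 g μ I 0 k = 0 := by
  have hg := E.eq_h_of_isNormalizedPair_zero hδ h
  have hQ := E.exists_Q_apply_eq_smul hδ h
  change (∑ᶠ p : ℕ, μ ((MvPowerSeries.coeff (monoExp I 0 k) (E.deltaSeries 0 *
    (MvPowerSeries.C (E.Q 0 g μ) * E.deltaSeries 0) ^ p) : E.B →L[ℂ] E.B) g)) = _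
  refine finsum_eq_zero_of_forall_eq_zero fun p => ?_
  have h1 := (E.coeff_deltaSeries_mul_pow_apply_h (T := E.Q 0 g μ)
    (by rwa [hg] at hQ ⊢) p (m := monoExp I 0 k) (by simp)).2 (by simpa using hI)
  rw [← hg] at h1
  rw [h1, map_zero]

end ComplexExtension

namespace ComplexExtension

variable {D : PACSystem} {S : D.IndexSet} (E : ComplexExtension D S)

/-! ### Taylor expansion of the transfer operator -/

/-- Constants in the Cauchy estimates for the operators `β_{i,j}`. -/
structure CauchyBound (δ A K : ℝ) : Prop where
  A_pos : 0 < A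
  K_pos : 0 < K
  ball_subset : Metric.ball (0 : ℂ) K⁻¹ ⊆ E.U
  formula_le : ∀ (i j : ℕ) (f : E.B), ∀ x ∈ E.V,
    ‖E.betaFormula δ i j f x‖ ≤ A * K ^ (i + j) * ‖f‖

/-- Cauchy's estimate on the circle `|b| = r` costs `r⁻¹ ^ i`, and `v ^ j` costs `M ^ j`; `K = max M
r⁻¹` covers both. The gain from `1 / j!` is discarded. -/
theorem exists_cauchyBound (δ : ℝ) : ∃ A K, E.CauchyBound δ A K := by
  obtain ⟨r, hr, hrU⟩ := Metric.nhds_basis_closedBall.mem_iff.1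
    (E.isOpen_U.mem_nhds E.zero_mem_U)
  obtain ⟨M, hM⟩ := E.bounded_v
  have hM0 : 0 ≤ M := (norm_nonneg _).trans (hM 0 E.zero_mem_U 0 E.zero_mem_V)
  have hrK : r⁻¹ ≤ max M r⁻¹ := le_max_right _ _
  have hK : 0 < max M r⁻¹ := (inv_pos.2 hr).trans_le hrK
  refine ⟨Real.exp (|δ| * M), max M r⁻¹, Real.exp_pos _, hK, ?_, fun i j f x hx => ?_⟩
  · refine subset_trans (subset_trans (Metric.ball_subset_ball ?_) Metric.ball_subset_closedBall)
      hrU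
    exact inv_le_of_inv_le₀ hr hrK
  have hd : DifferentiableOn ℂ (fun b : ℂ =>
      E.v b x ^ j * Complex.exp (δ * E.v b x) * f.ev (E.u b x)) E.U := fun b hb =>
    (E.analyticAt_integrand_left δ j f hb hx).differentiableAt.differentiableWithinAt
  have hC : ∀ b ∈ Metric.sphere (0 : ℂ) r,
      ‖E.v b x ^ j * Complex.exp (δ * E.v b x) * f.ev (E.u b x)‖ ≤
        M ^ j * Real.exp (|δ| * M) * ‖f‖ := fun b hb => by
    have hbU := hrU (Metric.sphere_subset_closedBall hb)
    rw [norm_mul, norm_mul, norm_pow]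
    refine mul_le_mul (mul_le_mul (pow_le_pow_left₀ (norm_nonneg _) (hM b hbU x hx) j) ?_
      (norm_nonneg _) (by positivity)) (f.norm_ev_le _) (norm_nonneg _) (by positivity)
    refine (Complex.norm_exp_le_exp_norm _).trans (Real.exp_le_exp.2 ?_)
    rw [norm_mul, Complex.norm_real, Real.norm_eq_abs]
    exact mul_le_mul_of_nonneg_left (hM b hbU x hx) (abs_nonneg δ)
  have hcauchy := Complex.norm_iteratedDeriv_le_of_forall_mem_sphere_norm_le i hr
    (hd.mono ((Metric.closure_ball_subset_closedBall).trans hrU)).diffContOnCl hC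
  rw [betaFormula_eq, norm_mul, norm_mul, norm_inv, norm_inv, Complex.norm_natCast,
    Complex.norm_natCast]
  have hi : (0 : ℝ) < i.factorial := by positivity
  have hj : ((j.factorial : ℝ))⁻¹ ≤ 1 := inv_le_one_of_one_le₀ (by exact_mod_cast j.factorial_pos)
  calc _ ≤ ((i.factorial : ℝ))⁻¹ * 1 *
        (i.factorial * (M ^ j * Real.exp (|δ| * M) * ‖f‖) / r ^ i) := by gcongr
    _ = Real.exp (|δ| * M) * (r⁻¹ ^ i * M ^ j) * ‖f‖ := by
        rw [inv_pow]
        field_simp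
    _ ≤ Real.exp (|δ| * M) * (max M r⁻¹ ^ i * max M r⁻¹ ^ j) * ‖f‖ := by
        gcongr
        exact le_max_left _ _
    _ = _ := by rw [pow_add]

variable {E} {δ A K : ℝ}

theorem CauchyBound.norm_betaCoeff_le (hAK : E.CauchyBound δ A K) (i j : ℕ) :
    ‖E.betaCoeff δ i j‖ ≤ A * K ^ (i + j) := by
  have h1 := hAK.A_pos
  have h2 := hAK.K_pos
  refine ContinuousLinearMap.opNorm_le_bound _ (by positivity) fun f => ?_
  refine BddHol.norm_le_of_forall_ev (by positivity) fun x hx => ?_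
  rw [E.ev_betaCoeff δ i j f hx]
  exact hAK.formula_le i j f x hx

theorem summable_pow_add {y : ℝ} (h0 : 0 ≤ y) (h1 : y < 1) :
    Summable fun p : ℕ × ℕ => y ^ (p.1 + p.2) := by
  have h := summable_geometric_of_lt_one h0 h1
  refine (h.mul_of_nonneg h (fun n => by positivity) fun n => by positivity).congr fun p => ?_
  rw [pow_add]

theorem CauchyBound.norm_term_le (hAK : E.CauchyBound δ A K) {y : ℝ} {b θ : ℂ}
    (hb : ‖b‖ * K ≤ y) (hθ : ‖θ‖ * K ≤ y) (i j : ℕ) (f : E.B) {x : ℂ} (hx : x ∈ E.V) :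
    ‖b ^ i * θ ^ j * E.betaFormula δ i j f x‖ ≤ A * ‖f‖ * y ^ (i + j) := by
  have h1 := hAK.A_pos
  have h2 := hAK.K_pos
  rw [norm_mul, norm_mul, norm_pow, norm_pow]
  calc _ ≤ ‖b‖ ^ i * ‖θ‖ ^ j * (A * K ^ (i + j) * ‖f‖) :=
        mul_le_mul_of_nonneg_left (hAK.formula_le i j f x hx) (by positivity)
    _ = A * ‖f‖ * ((‖b‖ * K) ^ i * (‖θ‖ * K) ^ j) := by
        rw [pow_add, mul_pow, mul_pow]; ring
    _ ≤ A * ‖f‖ * (y ^ i * y ^ j) := by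
        have h3 : (0 : ℝ) ≤ y := le_trans (by positivity) hb
        gcongr
    _ = _ := by rw [pow_add]

/-- For fixed `j` the sum over `i` is a Taylor series in `b`, and the sum over `j` is then the
exponential series in `θ * v`. The Cauchy bounds make the double family summable, which identifies
its total with this iterated sum. -/
theorem CauchyBound.hasSum_betaFormula (hAK : E.CauchyBound δ A K) {y : ℝ} (hy : y < 1)
    {b θ : ℂ} (hb : ‖b‖ * K ≤ y) (hθ : ‖θ‖ * K ≤ y) (f : E.B) {x : ℂ} (hx : x ∈ E.V) :
    HasSum (fun p : ℕ × ℕ => b ^ p.1 * θ ^ p.2 * E.betaFormula δ p.1 p.2 f x)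
      (Complex.exp ((δ + θ) * E.v b x) * f.ev (E.u b x)) := by
  have h2 := hAK.K_pos
  have h3 : (0 : ℝ) ≤ y := le_trans (by positivity) hb
  have hbK : b ∈ Metric.ball (0 : ℂ) K⁻¹ := by
    rw [mem_ball_zero_iff, ← one_div, lt_div_iff₀ h2]
    exact hb.trans_lt hy
  have hsum : Summable fun p : ℕ × ℕ => b ^ p.1 * θ ^ p.2 * E.betaFormula δ p.1 p.2 f x :=
    Summable.of_norm_bounded ((summable_pow_add h3 hy).mul_left (A * ‖f‖))
      fun p => hAK.norm_term_le hb hθ p.1 p.2 f hx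
  have hin : ∀ j : ℕ, HasSum (fun i : ℕ => b ^ i * θ ^ j * E.betaFormula δ i j f x)
      (θ ^ j * ((j.factorial : ℂ))⁻¹ *
        (E.v b x ^ j * Complex.exp (δ * E.v b x) * f.ev (E.u b x))) := fun j => by
    have hd : DifferentiableOn ℂ (fun b : ℂ =>
        E.v b x ^ j * Complex.exp (δ * E.v b x) * f.ev (E.u b x)) (Metric.ball 0 K⁻¹) :=
      fun b hb => (E.analyticAt_integrand_left δ j f (hAK.ball_subset hb)
        hx).differentiableAt.differentiableWithinAt
    have ht := Complex.hasSum_taylorSeries_on_ball hd hbK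
    refine (ht.mul_left (θ ^ j * ((j.factorial : ℂ))⁻¹)).congr_fun fun i => ?_
    rw [betaFormula_eq, sub_zero, smul_eq_mul, smul_eq_mul]
    ring
  have hout : HasSum (fun j : ℕ => θ ^ j * ((j.factorial : ℂ))⁻¹ *
      (E.v b x ^ j * Complex.exp (δ * E.v b x) * f.ev (E.u b x)))
      (Complex.exp ((δ + θ) * E.v b x) * f.ev (E.u b x)) := by
    have he := (NormedSpace.expSeries_div_hasSum_exp (θ * E.v b x)).mul_left
      (Complex.exp (δ * E.v b x) * f.ev (E.u b x))
    rw [← Complex.exp_eq_exp_ℂ] at he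
    rw [add_mul, Complex.exp_add, mul_right_comm]
    refine he.congr_fun fun j => ?_
    rw [mul_pow]
    ring
  have hinl : ∀ i : ℕ, HasSum (fun j : ℕ => b ^ i * θ ^ j * E.betaFormula δ i j f x)
      (∑' j : ℕ, b ^ i * θ ^ j * E.betaFormula δ i j f x) := fun i =>
    (hsum.comp_injective (Prod.mk_right_injective i)).hasSum
  rw [← (hasSum_tsum_of_hasSum_fiberwise hsum hinl hin).2.unique hout]
  exact hsum.hasSum

/-- The moments `∑_{b ∈ T} |b| ^ (q s) * b ^ i`. -/
noncomputable def moment (D : PACSystem) (T : Set ℝ) (s : ℝ) (i : ℕ) : ℝ :=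
  ∑' b : T, |(b : ℝ)| ^ (D.q * s) * (b : ℝ) ^ i

theorem summable_moment {T : Set ℝ} {s ε : ℝ}
    (hs : Summable fun b : T => |(b : ℝ)| ^ (D.q * s)) (hT : ∀ b ∈ T, |b| ≤ ε) (i : ℕ) :
    Summable fun b : T => |(b : ℝ)| ^ (D.q * s) * (b : ℝ) ^ i := by
  refine Summable.of_norm_bounded (hs.mul_right (ε ^ i)) fun b => ?_
  rw [norm_mul, norm_pow, Real.norm_of_nonneg (by positivity), Real.norm_eq_abs]
  have := hT b b.2
  gcongr

theorem abs_moment_le {T : Set ℝ} {s ε : ℝ}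
    (hs : Summable fun b : T => |(b : ℝ)| ^ (D.q * s)) (hT : ∀ b ∈ T, |b| ≤ ε) (i : ℕ) :
    |moment D T s i| ≤ moment D T s 0 * ε ^ i := by
  rw [← Real.norm_eq_abs, moment, moment, ← tsum_mul_right]
  simp only [pow_zero, mul_one]
  refine tsum_of_norm_bounded (hs.mul_right (ε ^ i)).hasSum fun b => ?_
  rw [norm_mul, norm_pow, Real.norm_of_nonneg (by positivity), Real.norm_eq_abs]
  have := hT b b.2
  gcongr

theorem CauchyBound.norm_moment_smul_betaCoeff_le (hAK : E.CauchyBound δ A K) {T : Set ℝ}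
    {θ ε y : ℝ} (hs : Summable fun b : T => |(b : ℝ)| ^ (D.q * (δ + θ)))
    (hT : ∀ b ∈ T, |b| ≤ ε) (hε : 0 ≤ ε) (hεK : ε * K ≤ y) (hθ : |θ| ≤ ε) (i j : ℕ) :
    ‖((moment D T (δ + θ) i : ℂ) * (θ : ℂ) ^ j) • E.betaCoeff δ i j‖ ≤
      A * moment D T (δ + θ) 0 * y ^ (i + j) := by
  have h1 := hAK.A_pos
  have h2 := hAK.K_pos
  have h0 : 0 ≤ moment D T (δ + θ) 0 := tsum_nonneg fun b => by simp; positivity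
  rw [norm_smul, norm_mul, norm_pow, Complex.norm_real, Complex.norm_real, Real.norm_eq_abs,
    Real.norm_eq_abs]
  calc _ ≤ (moment D T (δ + θ) 0 * ε ^ i) * ε ^ j * (A * K ^ (i + j)) := by
        gcongr
        · exact abs_moment_le hs hT i
        · exact hAK.norm_betaCoeff_le i j
    _ = A * moment D T (δ + θ) 0 * (ε * K) ^ (i + j) := by rw [mul_pow, pow_add, pow_add]; ring
    _ ≤ _ := by gcongr

theorem CauchyBound.hasSum_transfer (hAK : E.CauchyBound δ A K) {T : Set ℝ} {θ ε y : ℝ}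
    (hs : Summable fun b : T => |(b : ℝ)| ^ (D.q * (δ + θ)))
    (hT : ∀ b ∈ T, |b| ≤ ε) (hε : 0 ≤ ε) (hεK : ε * K ≤ y) (hy : y < 1) (hθ : |θ| ≤ ε) :
    HasSum (fun p : ℕ × ℕ =>
      ((moment D T (δ + θ) p.1 : ℂ) * (θ : ℂ) ^ p.2) • E.betaCoeff δ p.1 p.2)
      (E.transfer T (δ + θ)) := by
  have h2 := hAK.K_pos
  have hy0 : (0 : ℝ) ≤ y := le_trans (by positivity) hεK
  have hbK : ∀ b ∈ T, ‖(b : ℂ)‖ * K ≤ y := fun b hb => by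
    rw [Complex.norm_real, Real.norm_eq_abs]
    exact (mul_le_mul_of_nonneg_right (hT b hb) h2.le).trans hεK
  have hθK : ‖(θ : ℂ)‖ * K ≤ y := by
    rw [Complex.norm_real, Real.norm_eq_abs]
    exact (mul_le_mul_of_nonneg_right hθ h2.le).trans hεK
  have hTU : ∀ b ∈ T, (b : ℂ) ∈ E.U := fun b hb => by
    refine hAK.ball_subset ?_
    rw [mem_ball_zero_iff, ← one_div, lt_div_iff₀ h2]
    exact (hbK b hb).trans_lt hy
  have hop : Summable fun p : ℕ × ℕ =>
      ((moment D T (δ + θ) p.1 : ℂ) * (θ : ℂ) ^ p.2) • E.betaCoeff δ p.1 p.2 :=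
    Summable.of_norm_bounded ((summable_pow_add hy0 hy).mul_left _)
      fun p => hAK.norm_moment_smul_betaCoeff_le hs hT hε hεK hθ p.1 p.2
  -- The series converges in operator norm to some `Z`. It is identified with the transfer operator
  -- by evaluating at `f` and `x` and exchanging the sum over `T` with the Taylor expansion.
  obtain ⟨Z, hZ⟩ := hop
  convert hZ using 1
  ext1 f
  refine BddHol.ext_ev fun x hx => ?_
  rw [E.ev_transfer hTU hs f hx]
  have hZx : HasSum (fun p : ℕ × ℕ => (moment D T (δ + θ) p.1 : ℂ) * (θ : ℂ) ^ p.2 *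
      E.betaFormula δ p.1 p.2 f x) ((Z f).ev x) := by
    have h := ((BddHol.evalCLM (⟨x, hx⟩ : E.V)).comp
      (ContinuousLinearMap.apply ℂ E.B f)).hasSum hZ
    simp only [ContinuousLinearMap.comp_apply, ContinuousLinearMap.apply_apply,
      _root_.smul_apply, BddHol.evalCLM_apply, BddHol.ev_smul, E.ev_betaCoeff δ _ _ f hx] at h
    exact h
  have hG : Summable fun q : T × (ℕ × ℕ) => ((|(q.1 : ℝ)| ^ (D.q * (δ + θ)) : ℝ) : ℂ) *
      (((q.1 : ℝ) : ℂ) ^ q.2.1 * (θ : ℂ) ^ q.2.2 * E.betaFormula δ q.2.1 q.2.2 f x) := by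
    have hpos : 0 < A := hAK.A_pos
    have hprod := Summable.mul_of_nonneg (f := fun b : T => |(b : ℝ)| ^ (D.q * (δ + θ)))
      (g := fun p : ℕ × ℕ => A * ‖f‖ * y ^ (p.1 + p.2)) hs
      ((summable_pow_add hy0 hy).mul_left (A * ‖f‖)) (fun b => by positivity)
      fun p => by positivity
    refine Summable.of_norm_bounded hprod fun q => ?_
    rw [norm_mul, Complex.norm_real, Real.norm_of_nonneg (by positivity)]
    exact mul_le_mul_of_nonneg_left (hAK.norm_term_le (hbK _ q.1.2) hθK _ _ f hx) (by positivity)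
  have h1 : ∀ b : T, HasSum (fun p : ℕ × ℕ => ((|(b : ℝ)| ^ (D.q * (δ + θ)) : ℝ) : ℂ) *
      (((b : ℝ) : ℂ) ^ p.1 * (θ : ℂ) ^ p.2 * E.betaFormula δ p.1 p.2 f x))
      (((|(b : ℝ)| ^ (D.q * (δ + θ)) : ℝ) : ℂ) * Complex.exp ((δ + θ : ℝ) * E.v b x) *
        f.ev (E.u b x)) := fun b => by
    rw [mul_assoc, Complex.ofReal_add]
    exact (hAK.hasSum_betaFormula hy (hbK _ b.2) hθK f hx).mul_left _
  have h3 : ∀ p : ℕ × ℕ, HasSum (fun b : T => ((|(b : ℝ)| ^ (D.q * (δ + θ)) : ℝ) : ℂ) *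
      (((b : ℝ) : ℂ) ^ p.1 * (θ : ℂ) ^ p.2 * E.betaFormula δ p.1 p.2 f x))
      ((moment D T (δ + θ) p.1 : ℂ) * (θ : ℂ) ^ p.2 * E.betaFormula δ p.1 p.2 f x) := fun p => by
    have hm := (Complex.hasSum_ofReal.2 (summable_moment hs hT p.1).hasSum).mul_right
      ((θ : ℂ) ^ p.2 * E.betaFormula δ p.1 p.2 f x)
    rw [mul_assoc]
    refine hm.congr_fun fun b => ?_
    push_cast
    ring
  obtain ⟨h4, h5⟩ := hasSum_tsum_of_hasSum_fiberwise hG h1 h3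
  rw [h4.tsum_eq, ← h5.unique hZx]

end ComplexExtension

namespace ComplexExtension

variable {D : PACSystem} {S : D.IndexSet} {E : ComplexExtension D S} {δ A K : ℝ}

/-! ### Evaluation of the series `β` -/

/-- The values of the formal variables at the moments of `T`. -/
noncomputable def momentPoint (D : PACSystem) (T : Set ℝ) (δ θ : ℝ) (c : ℂ) : SeriesVar → ℂ
  | SeriesVar.eta i => moment D T (δ + θ) i
  | SeriesVar.theta => θ
  | SeriesVar.xi => moment D T (δ + θ) 0 - c

theorem monoVal_momentPoint_zero (T : Set ℝ) (θ : ℝ) (c : ℂ) (j k : ℕ) :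
    MvPowerSeries.monoVal (momentPoint D T δ θ c) (monoExp 0 j k) =
      (θ : ℂ) ^ j * (moment D T (δ + θ) 0 - c) ^ k := by
  rw [monoVal_monoExp, Finsupp.prod_zero_index, one_mul]
  rfl

theorem monoVal_momentPoint_single (T : Set ℝ) (θ : ℝ) (c : ℂ) (i : ℕ+) (j : ℕ) :
    MvPowerSeries.monoVal (momentPoint D T δ θ c) (monoExp (Finsupp.single i 1) j 0) =
      (moment D T (δ + θ) i : ℂ) * (θ : ℂ) ^ j := by
  rw [monoVal_monoExp, Finsupp.prod_single_index (h := fun i n =>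
    momentPoint D T δ θ c (SeriesVar.eta i) ^ n) (pow_zero _), pow_one, pow_zero, mul_one]
  rfl

theorem pnat_prod_coe_injective : Function.Injective fun p : ℕ+ × ℕ => ((p.1 : ℕ), p.2) :=
  fun a b h => by
    rw [Prod.mk.injEq] at h
    exact Prod.ext (PNat.coe_injective h.1) h.2

theorem tsum_prod_nat_eq_add {R : Type*} [NormedAddCommGroup R] [CompleteSpace R]
    {H : ℕ × ℕ → R} (hH : Summable H) :
    ∑' p, H p = H (0, 0) + ∑' j, H (0, j + 1) + ∑' p : ℕ+ × ℕ, H (p.1, p.2) := by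
  have h0 : Summable fun j => H (0, j) := hH.comp_injective (Prod.mk_right_injective 0)
  have hp : Summable fun p : ℕ+ × ℕ => H (p.1, p.2) := hH.comp_injective pnat_prod_coe_injective
  rw [hH.tsum_prod, hH.prod.tsum_eq_zero_add, h0.tsum_eq_zero_add, hp.tsum_prod,
    tsum_pnat_eq_tsum_succ (f := fun i => ∑' j, H (i, j))]

theorem hasSum_pow_add_pnat {y : ℝ} (h0 : 0 ≤ y) (h1 : y < 1) :
    HasSum (fun p : ℕ+ × ℕ => y ^ ((p.1 : ℕ) + p.2)) (y * (1 - y)⁻¹ * (1 - y)⁻¹) := by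
  have hg := hasSum_geometric_of_lt_one h0 h1
  have hf : HasSum (fun i : ℕ+ => y ^ (i : ℕ)) (y * (1 - y)⁻¹) := by
    rw [← hg.tsum_eq, ← tsum_mul_left]
    have h := tsum_pnat_eq_tsum_succ (f := fun i => y ^ i)
    simp only [pow_succ'] at h
    rw [← h]
    exact (hg.summable.comp_injective PNat.coe_injective).hasSum
  have hs : Summable fun p : ℕ+ × ℕ => y ^ (p.1 : ℕ) * y ^ p.2 :=
    Summable.mul_of_nonneg (f := fun i : ℕ+ => y ^ (i : ℕ)) (g := fun j : ℕ => y ^ j)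
      hf.summable hg.summable (fun i => by positivity) fun j => by positivity
  simp only [pow_add]
  exact HasSum.mul (f := fun i : ℕ+ => y ^ (i : ℕ)) (g := fun j : ℕ => y ^ j) hf hg hs

/-- The Taylor expansion of the transfer operator is split into `(0, 0)`, `(0, j + 1)` and `i ≥ 1`,
and `η_0 = c̃ + ξ` splits the middle part in two. The four summands of the bound correspond to the
four families of `β`. -/
theorem CauchyBound.hasAbsEval_betaSeries (hAK : E.CauchyBound δ A K) {T : Set ℝ} {θ ε y : ℝ}
    (hs : Summable fun b : T => |(b : ℝ)| ^ (D.q * (δ + θ)))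
    (hT : ∀ b ∈ T, |b| ≤ ε) (hε : 0 ≤ ε) (hεK : ε * K ≤ y) (hy : y < 1) (hθ : |θ| ≤ ε) :
    MvPowerSeries.HasAbsEval (momentPoint D T δ θ (E.cTilde δ)) (E.betaSeries δ)
      (E.transfer T (δ + θ) - E.cTilde δ • E.rankOne (E.h δ) E.nu)
      (A * ‖(moment D T (δ + θ) 0 : ℂ) - E.cTilde δ‖ +
        A * ‖E.cTilde δ‖ * (y * (1 - y)⁻¹) +
        A * ‖(moment D T (δ + θ) 0 : ℂ) - E.cTilde δ‖ * (y * (1 - y)⁻¹) +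
        A * moment D T (δ + θ) 0 * (y * (1 - y)⁻¹ * (1 - y)⁻¹)) := by
  have hA := hAK.A_pos
  have hK := hAK.K_pos
  have hy0 : (0 : ℝ) ≤ y := le_trans (by positivity) hεK
  set c := E.cTilde δ with hc
  set η := moment D T (δ + θ) 0 with hη
  have hθK : ∀ j : ℕ, ‖(θ : ℂ) ^ j • E.betaCoeff δ 0 j‖ ≤ A * y ^ j := fun j => by
    rw [norm_smul, norm_pow, Complex.norm_real, Real.norm_eq_abs]
    calc _ ≤ ε ^ j * (A * K ^ (0 + j)) := by
          gcongr
          exact hAK.norm_betaCoeff_le 0 j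
      _ = A * (ε * K) ^ j := by rw [zero_add, mul_pow]; ring
      _ ≤ _ := by gcongr
  have hgeo : HasSum (fun j : ℕ => y ^ (j + 1)) (y * (1 - y)⁻¹) := by
    simpa only [pow_succ'] using (hasSum_geometric_of_lt_one hy0 hy).mul_left y
  have hW : Summable fun j : ℕ => (θ : ℂ) ^ (j + 1) • E.betaCoeff δ 0 (j + 1) :=
    Summable.of_norm_bounded (hgeo.summable.mul_left A) fun j => hθK (j + 1)
  set W := ∑' j : ℕ, (θ : ℂ) ^ (j + 1) • E.betaCoeff δ 0 (j + 1) with hWdef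
  have hZ := hAK.hasSum_transfer hs hT hε hεK hy hθ
  have hZeq := tsum_prod_nat_eq_add hZ.summable
  set X := ∑' p : ℕ+ × ℕ, ((moment D T (δ + θ) p.1 : ℂ) * (θ : ℂ) ^ p.2) •
    E.betaCoeff δ p.1 p.2 with hX
  have hXs : HasSum (fun p : ℕ+ × ℕ => ((moment D T (δ + θ) p.1 : ℂ) * (θ : ℂ) ^ p.2) •
      E.betaCoeff δ p.1 p.2) X := (hZ.summable.comp_injective pnat_prod_coe_injective).hasSum
  have hsum1 := hasAbsEval_monomial (z := momentPoint D T δ θ c) (monoExp 0 0 1)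
    (E.rankOne (E.h δ) E.nu) (N := A * ‖(η : ℂ) - c‖) (by
      rw [monoVal_momentPoint_zero, pow_zero, one_mul, pow_one, norm_smul, mul_comm,
        -- Reading `h ν` as `β_{0,0}` bounds its norm by the same constant `A`.
        ← betaCoeff_zero_zero]
      refine mul_le_mul_of_nonneg_right ?_ (norm_nonneg _)
      simpa using hAK.norm_betaCoeff_le 0 0)
  have hsum2 := hasAbsEval_formalSum (z := momentPoint D T δ θ c)
    (monoExp_zero_succ_injective 0) (T := fun j => c • E.betaCoeff δ 0 (j + 1)) (a := c • W)
    (hgeo.mul_left (A * ‖c‖)) (fun j => by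
      rw [monoVal_momentPoint_zero, pow_zero, mul_one, smul_comm, norm_smul]
      calc _ ≤ ‖c‖ * (A * y ^ (j + 1)) :=
            mul_le_mul_of_nonneg_left (hθK (j + 1)) (norm_nonneg _)
        _ = _ := by ring)
    ((hW.hasSum.const_smul c).congr_fun fun j => by
      rw [monoVal_momentPoint_zero, pow_zero, mul_one, smul_comm])
  have hsum3 := hasAbsEval_formalSum (z := momentPoint D T δ θ c)
    (monoExp_zero_succ_injective 1) (T := fun j => E.betaCoeff δ 0 (j + 1))
    (a := ((η : ℂ) - c) • W)
    (hgeo.mul_left (A * ‖(η : ℂ) - c‖)) (fun j => by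
      rw [monoVal_momentPoint_zero, pow_one, mul_comm, mul_smul, norm_smul]
      calc _ ≤ ‖(η : ℂ) - c‖ * (A * y ^ (j + 1)) :=
            mul_le_mul_of_nonneg_left (hθK (j + 1)) (norm_nonneg _)
        _ = _ := by ring)
    ((hW.hasSum.const_smul ((η : ℂ) - c)).congr_fun fun j => by
      rw [monoVal_momentPoint_zero, pow_one, mul_comm, mul_smul])
  have hsum4 := hasAbsEval_formalSum (z := momentPoint D T δ θ c)
    monoExp_single_injective (T := fun p : ℕ+ × ℕ => E.betaCoeff δ p.1 p.2) (a := X)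
    ((hasSum_pow_add_pnat hy0 hy).mul_left (A * η)) (fun p => by
      rw [monoVal_momentPoint_single]
      exact hAK.norm_moment_smul_betaCoeff_le hs hT hε hεK hθ p.1 p.2)
    (hXs.congr_fun fun p => by rw [monoVal_momentPoint_single])
  have hall := ((hsum1.add hsum2).add hsum3).add hsum4
  have hval : E.transfer T (δ + θ) - c • E.rankOne (E.h δ) E.nu =
      MvPowerSeries.monoVal (momentPoint D T δ θ c) (monoExp 0 0 1) •
        E.rankOne (E.h δ) E.nu + c • W + ((η : ℂ) - c) • W + X := by
    have h1 : ∑' j : ℕ, ((moment D T (δ + θ) 0 : ℂ) * (θ : ℂ) ^ (j + 1)) •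
        E.betaCoeff δ 0 (j + 1) = (η : ℂ) • W := by
      simp only [mul_smul]
      exact (hW.hasSum.const_smul (η : ℂ)).tsum_eq
    rw [hZ.tsum_eq] at hZeq
    simp only [h1, betaCoeff_zero_zero, pow_zero, mul_one] at hZeq
    rw [hZeq, monoVal_momentPoint_zero, pow_zero, one_mul, pow_one, ← hη]
    module
  rw [hval]
  exact hall

end ComplexExtension

/-! ### Regular index sets near zero -/

namespace PACSystem

/-- `u_b 0` tends to `u_0 0 = 0`, and `u_b` varies on the bounded interval `V` by at most a multiple
of `|b| ^ q`. -/
theorem exists_forall_abs_u_le (D : PACSystem) {ρ : ℝ} (hρ : 0 < ρ) :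
    ∃ ε > 0, ∀ b ∈ D.U, |b| ≤ ε → ∀ x ∈ D.V, |D.u b x| ≤ ρ := by
  obtain ⟨M, hM⟩ := D.bounded_v
  obtain ⟨C, hC⟩ := D.bounded_V.exists_norm_le
  have hC0 : 0 ≤ C := (norm_nonneg _).trans (hC 0 D.zero_mem_V)
  have hcont : ContinuousAt (fun b : ℝ => |D.u b 0| + |b| ^ D.q * Real.exp M * C) 0 := by
    have h1 : ContinuousAt (fun b : ℝ => D.u b 0) 0 :=
      (D.analytic_u (0, 0) ⟨D.zero_mem_U, D.zero_mem_V⟩).continuousAt.comp_of_eq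
        (f := fun b : ℝ => (b, (0 : ℝ))) (by fun_prop) rfl
    have h2 : ContinuousAt (fun b : ℝ => |b| ^ D.q) 0 :=
      continuous_abs.continuousAt.rpow_const (Or.inr D.q_pos.le)
    exact h1.abs.add ((h2.mul continuousAt_const).mul continuousAt_const)
  have h0 : |D.u 0 0| + |(0 : ℝ)| ^ D.q * Real.exp M * C < ρ := by
    rw [D.u_zero 0 D.zero_mem_V, abs_zero, Real.zero_rpow D.q_pos.ne']
    simpa using hρ
  obtain ⟨ε, hε, hball⟩ := Metric.eventually_nhds_iff.1 (hcont.eventually (gt_mem_nhds h0))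
  refine ⟨ε / 2, half_pos hε, fun b hb hbε x hx => ?_⟩
  have h1 := hball (y := b) (by rw [Real.dist_eq, sub_zero]; linarith)
  have hconv : Convex ℝ D.V := D.connected_V.isPreconnected.ordConnected.convex
  have hd : ∀ z ∈ D.V, DifferentiableAt ℝ (D.u b) z := fun z hz =>
    ((D.analytic_u (b, z) ⟨hb, hz⟩).differentiableAt).comp z
      ((differentiableAt_const b).prodMk differentiableAt_id)
  have h2 := hconv.norm_image_sub_le_of_norm_deriv_le hd (C := |b| ^ D.q * Real.exp M)
    (fun z hz => by
      rw [Real.norm_eq_abs, D.deriv_eq b hb z hz]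
      exact mul_le_mul_of_nonneg_left
        (Real.exp_le_exp.2 ((le_abs_self _).trans (hM b hb z hz))) (by positivity))
    D.zero_mem_V hx
  have h3 : ‖x - 0‖ ≤ C := by simpa using hC x hx
  have h4 : ‖D.u b x - D.u b 0‖ ≤ |b| ^ D.q * Real.exp M * C :=
    h2.trans (mul_le_mul_of_nonneg_left h3 (by positivity))
  rw [Real.norm_eq_abs] at h4
  have h5 := abs_add_le (D.u b x - D.u b 0) (D.u b 0)
  rw [sub_add_cancel] at h5
  linarith

namespace IndexSet

variable {D : PACSystem}

theorem abs_coding_le {S : D.IndexSet} {ρ : ℝ}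
    (h : ∀ b : S.carrier, ∀ x ∈ D.V, |D.u b x| ≤ ρ) (ω : S.Word) : |coding ω| ≤ ρ := by
  have hpre : ∀ (n : ℕ) (x : ℝ), x ∈ D.V → |prefixMap ω (n + 1) x| ≤ ρ := by
    intro n
    induction n with
    | zero => intro x hx; exact h _ x hx
    | succ n ih => intro x hx; exact ih _ (D.mapsTo_V (S.mem_U _) hx)
  have hlim := (tendsto_add_atTop_iff_nat 1).2 ((tendstoUniformly_coding (S := S)).tendsto_at ω)
  exact le_of_tendsto hlim.abs (Eventually.of_forall fun n => hpre n 0 D.zero_mem_V)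

/-- With all letters small, coded points lie near `0`, so every weight is `|b| ^ (q t)` times a
factor within `e^{±κ/2}` of `e^{δ v(0,0)}`. Spectral radius one then squeezes `η_0` to within the
same factors of `e^{-δ v(0,0)}`. This is what makes `ξ` small. -/
theorem exists_abs_moment_sub_le (D : PACSystem) (δ : ℝ) {τ : ℝ} (hτ : 0 < τ) :
    ∃ ε > 0, ∀ (S : D.IndexSet) (t : ℝ), S.pressure t = 0 → (∀ b ∈ S.carrier, |b| ≤ ε) →
      |t - δ| ≤ ε →
      |ComplexExtension.moment D S.carrier t 0 - Real.exp (-(δ * D.v 0 0))| ≤ τ := by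
  set a := δ * D.v 0 0 with ha
  obtain ⟨κ, hκ, hexp⟩ := Metric.continuousAt_iff.1
    (Real.continuous_exp.continuousAt (x := -a)) τ hτ
  have hcont : ContinuousAt (fun p : ℝ × ℝ × ℝ => p.1 * D.v p.2.1 p.2.2) (δ, 0, 0) := by
    have hv : ContinuousAt (fun p : ℝ × ℝ × ℝ => D.v p.2.1 p.2.2) (δ, 0, 0) :=
      (D.analytic_v (0, 0) ⟨D.zero_mem_U, D.zero_mem_V⟩).continuousAt.comp_of_eq
        (f := fun p : ℝ × ℝ × ℝ => p.2) (by fun_prop) rfl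
    exact continuousAt_fst.mul hv
  obtain ⟨ρ, hρ, hvρ⟩ := Metric.continuousAt_iff.1 hcont (κ / 2) (half_pos hκ)
  obtain ⟨ε, hε, hu⟩ := D.exists_forall_abs_u_le (half_pos hρ)
  refine ⟨min ε (ρ / 2), lt_min hε (half_pos hρ), fun S t hP hS ht => ?_⟩
  obtain ⟨hs, -⟩ := spectralRadius_of_pressure_eq_zero hP
  have hπ : ∀ ω : S.Word, |coding ω| ≤ ρ / 2 := fun ω =>
    abs_coding_le (fun b x hx => hu b (S.mem_U b) ((hS b b.2).trans (min_le_left _ _)) x hx) ω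
  have hv : ∀ (b : S.carrier) (ω : S.Word), |t * D.v b (coding ω) - a| < κ / 2 := fun b ω => by
    have h := hvρ (x := (t, (b : ℝ), coding ω)) (by
      rw [Prod.dist_eq, Prod.dist_eq, max_lt_iff, max_lt_iff]
      simp only [Real.dist_eq, sub_zero]
      have h1 := ht.trans (min_le_right _ _)
      have h2 := (hS b b.2).trans (min_le_right _ _)
      have h3 := hπ ω
      exact ⟨by linarith, by linarith, by linarith⟩)
    rwa [Real.dist_eq] at h
  have hw : ∀ (b : S.carrier) (ω : S.Word), |deriv (D.u b) (coding ω)| ^ t =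
      |(b : ℝ)| ^ (D.q * t) * Real.exp (t * D.v b (coding ω)) := fun b ω => by
    rw [D.deriv_eq _ (S.mem_U b) _ (coding_mem ω), Real.mul_rpow (by positivity) (by positivity),
      ← Real.rpow_mul (abs_nonneg _), ← Real.exp_mul, mul_comm t]
  have hm : ComplexExtension.moment D S.carrier t 0 =
      ∑' b : S.carrier, |(b : ℝ)| ^ (D.q * t) := by simp [ComplexExtension.moment]
  have hs' : Summable fun b : S.carrier => |(b : ℝ)| ^ (D.q * t) := hs
  have hm0 : 0 ≤ ∑' b : S.carrier, |(b : ℝ)| ^ (D.q * t) := tsum_nonneg fun b => by positivity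
  rw [hm]
  set η := ∑' b : S.carrier, |(b : ℝ)| ^ (D.q * t) with hη
  have h1 : 1 ≤ η * Real.exp (a + κ / 2) := by
    refine one_le_of_pressure_eq_zero hP fun ω => ?_
    rw [hη, ← tsum_mul_right]
    refine (summable_weight hs ω).tsum_le_tsum (fun b => ?_) (hs'.mul_right _)
    rw [hw]
    refine mul_le_mul_of_nonneg_left (Real.exp_le_exp.2 ?_) (by positivity)
    linarith [(abs_lt.1 (hv b ω)).2]
  have h2 : η * Real.exp (a - κ / 2) ≤ 1 := by
    refine le_one_of_pressure_eq_zero hP (by positivity) fun ω => ?_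
    rw [hη, ← tsum_mul_right]
    refine (hs'.mul_right _).tsum_le_tsum (fun b => ?_) (summable_weight hs ω)
    rw [hw]
    refine mul_le_mul_of_nonneg_left (Real.exp_le_exp.2 ?_) (by positivity)
    linarith [(abs_lt.1 (hv b ω)).1]
  have h3 : Real.exp (-a - κ / 2) ≤ η := by
    have : -a - κ / 2 = -(a + κ / 2) := by ring
    rw [this, Real.exp_neg, inv_le_iff_one_le_mul₀ (Real.exp_pos _)]
    exact h1
  have h4 : η ≤ Real.exp (-a + κ / 2) := by
    have : -a + κ / 2 = -(a - κ / 2) := by ring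
    rw [this, Real.exp_neg, ← one_div, le_div_iff₀ (Real.exp_pos _)]
    exact h2
  have h5 := hexp (x := -a - κ / 2) (by
    rw [Real.dist_eq, sub_sub_cancel_left, abs_neg, abs_of_pos (half_pos hκ)]; linarith)
  have h6 := hexp (x := -a + κ / 2) (by
    rw [Real.dist_eq, add_sub_cancel_left, abs_of_pos (half_pos hκ)]; linarith)
  rw [Real.dist_eq, abs_lt] at h5 h6
  rw [abs_le]
  constructor <;> linarith [h5.1, h6.2]

end IndexSet

end PACSystem

/-! ### Convergence of `Ξ(S')` for the empty index set. -/

namespace ComplexExtension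

variable {D : PACSystem} {S : D.IndexSet} (E : ComplexExtension D S) {δ : ℝ}

theorem cTilde_eq_exp_of_isEmpty (hS : S.carrier = ∅) :
    E.cTilde δ = (Real.exp (-(δ * D.v 0 0)) : ℝ) := by
  have h := E.extends_v 0 D.zero_mem_U 0 D.zero_mem_V (by simpa using E.zero_mem_U)
    (by simpa using E.zero_mem_V)
  rw [Complex.ofReal_zero] at h
  rw [E.cTilde_of_isEmpty hS, nu_apply, E.ev_h δ E.zero_mem_V, h, one_div, ← Complex.exp_neg]
  push_cast
  rfl

theorem abs_le_of_etaSup_le (hS : S.carrier = ∅) {S' : D.IndexSet} {ε : ℝ}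
    (h : E.etaSup S' ≤ ε) {b : ℝ} (hb : b ∈ S'.carrier) : |b| ≤ ε := by
  obtain ⟨C, hC⟩ := D.bounded_U.exists_norm_le
  have hmem : |b| ∈ (fun b : ℝ => |b|) '' symmDiff S.carrier S'.carrier :=
    ⟨b, Or.inr ⟨hb, by rw [hS]; exact notMem_empty b⟩, rfl⟩
  -- A real supremum bounds its members only if the set is bounded above, which boundedness of `U`
  -- supplies.
  refine le_trans (le_csSup ⟨C, ?_⟩ hmem) h
  rintro _ ⟨x, hx, rfl⟩
  rcases hx with hx | hx
  · exact hC x (S.subset hx.1).1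
  · exact hC x (S'.subset hx.1).1

theorem alphaOp_of_isEmpty (hS : S.carrier = ∅) (S' : D.IndexSet) : E.alphaOp δ S' = 0 := by
  rw [alphaOp, Ldoubleprime, L, L₁, E.transfer_of_isEmpty hS, E.transfer_of_isEmpty hS, sub_self]

theorem betaOp_of_isEmpty (hS : S.carrier = ∅) (S' : D.IndexSet) : E.betaOp δ S' =
    E.transfer S'.carrier (δ + E.theta δ S') - E.cTilde δ • E.rankOne (E.h δ) E.nu := by
  rw [betaOp, Lprime, Ldoubleprime, E.transfer_of_isEmpty hS, zero_add]

theorem etaVal_of_isEmpty (hS : S.carrier = ∅) (S' : D.IndexSet) (i : ℕ) :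
    E.etaVal δ S' i = moment D S'.carrier (δ + E.theta δ S') i := by
  have : IsEmpty S.carrier := isEmpty_coe_sort.2 hS
  rw [etaVal, moment, tsum_empty (β := S.carrier), sub_zero]

theorem xiTerm_of_isEmpty (hS : S.carrier = ∅) (hΘ : S.finiteness < (δ : EReal))
    (S' : D.IndexSet) (m : (ℕ+ →₀ ℕ) × ℕ × ℕ) :
    E.xiTerm δ (E.h δ) E.nu S' m =
      MvPowerSeries.monoVal (momentPoint D S'.carrier δ (E.theta δ S') (E.cTilde δ))
        (monoExpEquiv m) * ∑ᶠ p : ℕ,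
          E.nu (MvPowerSeries.coeff (monoExpEquiv m) (E.betaSeries δ ^ (p + 1)) (E.h δ)) := by
  have h : monoExpEquiv m = monoExp m.1 m.2.1 m.2.2 := rfl
  rw [xiTerm, coef, E.coeff_xiSeries_of_isEmpty hS hΘ, h, monoVal_monoExp, mul_comm, xiVal]
  simp only [E.etaVal_of_isEmpty hS]
  rfl

theorem exists_forall_hasSum_Xi (hS : S.carrier = ∅) (hΘ : S.finiteness < (δ : EReal)) :
    ∃ ε : ℝ, 0 < ε ∧ ∀ S' : D.IndexSet, S'.IsRegular → E.etaSup S' ≤ ε → |E.theta δ S'| ≤ ε →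
      Summable (E.xiTerm δ (E.h δ) E.nu S') ∧
      HasSum (fun p : ℕ => E.nu ((E.betaOp δ S' ^ (p + 1)) (E.h δ)))
        (E.Xi δ (E.h δ) E.nu S') := by
  obtain ⟨A, K, hAK⟩ := E.exists_cauchyBound δ
  have hA := hAK.A_pos
  have hK := hAK.K_pos
  set c := Real.exp (-(δ * D.v 0 0)) with hc
  have hc0 : 0 < c := Real.exp_pos _
  have hcT : E.cTilde δ = (c : ℂ) := E.cTilde_eq_exp_of_isEmpty hS
  -- This tolerance makes the first summand `A |ξ|` of the bound for `β` at most `1 / 4`, and gives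
  -- `η_0 ≤ c + 1`.
  obtain ⟨ε₁, hε₁, hmom⟩ := PACSystem.IndexSet.exists_abs_moment_sub_le D δ
    (τ := min 1 (1 / (4 * A))) (by positivity)
  -- From `y ≤ 1 / 2` comes `(1 - y)⁻¹ ≤ 2`. The two middle summands then total at most `1 / 8` and
  -- the last at most `1 / 4`, so the whole bound is at most `5 / 8`.
  set y := min (1 / 2) (1 / (16 * (A * (c + 1)))) with hy
  have hy0 : 0 < y := by positivity
  have hy2 : y ≤ 1 / 2 := min_le_left _ _
  have hyA : A * (c + 1) * y ≤ 1 / 16 := by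
    have h : y ≤ 1 / (16 * (A * (c + 1))) := min_le_right _ _
    rw [le_div_iff₀ (by positivity)] at h
    linarith
  refine ⟨min ε₁ (y / K), by positivity, fun S' hreg hη hθ => ?_⟩
  obtain ⟨t, -, hP⟩ := hreg
  -- The zero of the pressure is the Bowen parameter, which is therefore finite, so `toReal` loses
  -- nothing.
  have ht : δ + E.theta δ S' = t := by
    rw [theta, PACSystem.IndexSet.bowen_eq_of_pressure_eq_zero hP, EReal.toReal_coe]
    ring
  have hb : ∀ b ∈ S'.carrier, |b| ≤ min ε₁ (y / K) := fun b hb => E.abs_le_of_etaSup_le hS hη hb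
  obtain ⟨hs, -⟩ := PACSystem.IndexSet.spectralRadius_of_pressure_eq_zero hP
  have hs' : Summable fun b : S'.carrier => |(b : ℝ)| ^ (D.q * (δ + E.theta δ S')) := by
    rw [ht]
    exact hs
  have hm := hmom S' t hP (fun b hbS => (hb b hbS).trans (min_le_left _ _)) (by
    rw [← ht, add_sub_cancel_left]
    exact hθ.trans (min_le_left _ _))
  have hεK : min ε₁ (y / K) * K ≤ y := by
    calc _ ≤ y / K * K := mul_le_mul_of_nonneg_right (min_le_right _ _) hK.le
      _ = y := div_mul_cancel₀ y hK.ne'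
  have hev := hAK.hasAbsEval_betaSeries hs' hb (by positivity) hεK (by linarith) hθ
  rw [← E.betaOp_of_isEmpty hS] at hev
  set η := moment D S'.carrier (δ + E.theta δ S') 0 with hηdef
  rw [← ht, ← hηdef] at hm
  have hξ : ‖(η : ℂ) - E.cTilde δ‖ = |η - c| := by
    rw [hcT, ← Complex.ofReal_sub, Complex.norm_real, Real.norm_eq_abs]
  have hcn : ‖E.cTilde δ‖ = c := by rw [hcT, Complex.norm_real, Real.norm_of_nonneg hc0.le]
  rw [hξ, hcn] at hev
  have hm1 : |η - c| ≤ 1 := hm.trans (min_le_left _ _)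
  have hm2 : A * |η - c| ≤ 1 / 4 := by
    have h := hm.trans (min_le_right _ _)
    rw [le_div_iff₀ (by positivity)] at h
    linarith
  have hηc : η ≤ c + 1 := by linarith [(abs_le.1 hm1).2]
  have hinv : (1 - y)⁻¹ ≤ 2 := inv_le_of_inv_le₀ (by norm_num) (by linarith)
  have hinv0 : 0 < (1 - y)⁻¹ := inv_pos.2 (by linarith)
  have hN : A * |η - c| + A * c * (y * (1 - y)⁻¹) + A * |η - c| * (y * (1 - y)⁻¹) +
      A * η * (y * (1 - y)⁻¹ * (1 - y)⁻¹) < 1 := by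
    have h1 : A * c * (y * (1 - y)⁻¹) ≤ A * c * (y * 2) := by gcongr
    have h2 : A * |η - c| * (y * (1 - y)⁻¹) ≤ A * 1 * (y * 2) := by gcongr
    have h3 : A * η * (y * (1 - y)⁻¹ * (1 - y)⁻¹) ≤ A * (c + 1) * (y * 2 * 2) := by gcongr
    nlinarith
  obtain ⟨h1, h2⟩ := hev.geometric hN (E.coeff_zero_betaSeries δ)
    (E.nu.comp (ContinuousLinearMap.apply ℂ E.B (E.h δ)))
  simp only [ContinuousLinearMap.comp_apply, ContinuousLinearMap.apply_apply] at h1 h2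
  have he := funext (E.xiTerm_of_isEmpty (δ := δ) hS hΘ S')
  refine ⟨?_, ?_⟩
  · rw [he]
    exact monoExpEquiv.summable_iff.2 h1
  · rw [Xi, he]
    rwa [← monoExpEquiv.tsum_eq] at h2

end ComplexExtension

/-! ### Assembly of the four assertions. -/

theorem proposition6p1 (D : PACSystem) (S : D.IndexSet) (E : ComplexExtension D S) (δ : ℝ)
    (hδ : S.bowen ≤ (δ : EReal)) (hΘ : S.finiteness < (δ : EReal)) :
    -- the case `S = ∅`
    (S.carrier = ∅ →
      E.IsFixedPair δ (E.h δ) E.nu ∧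
      (∃ g μ, E.IsNormalizedPair δ g μ) ∧
      (∀ g μ, E.IsNormalizedPair δ g μ →
        ∃ a b : ℂ, a ≠ 0 ∧ b ≠ 0 ∧ a • g = E.h δ ∧ b • μ = E.nu) ∧
      (∀ S' : D.IndexSet, E.alphaOp δ S' = 0) ∧
      E.alphaSeries δ = 0 ∧
      E.L₁ δ = 0 ∧
      E.Q₁ δ = 1 ∧
      E.nu (E.h δ) ≠ 0 ∧
      E.cConst (E.h δ) E.nu = E.cTilde δ ∧
      E.cTilde δ = 1 / E.nu (E.h δ) ∧
      E.L δ = E.cConst (E.h δ) E.nu • E.rankOne (E.h δ) E.nu ∧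
      E.R δ (E.h δ) E.nu = 0 ∧
      E.Q δ (E.h δ) E.nu = 1 ∧
      (∀ m, MvPowerSeries.coeff m (E.xiSeries δ (E.h δ) E.nu) =
        ∑ᶠ p : ℕ, E.nu (MvPowerSeries.coeff m (E.betaSeries δ ^ (p + 1)) (E.h δ))) ∧
      (∃ ε : ℝ, 0 < ε ∧ ∀ S' : D.IndexSet, S'.IsRegular → E.etaSup S' ≤ ε → |E.theta δ S'| ≤ ε →
        Summable (E.xiTerm δ (E.h δ) E.nu S') ∧
        HasSum (fun p : ℕ => E.nu ((E.betaOp δ S' ^ (p + 1)) (E.h δ)))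
          (E.Xi δ (E.h δ) E.nu S'))) ∧
    -- vanishing of `β_{i,j}` and `c_{I,j,k}` for large `j`
    ((∀ x ∈ D.V, D.v 0 x = 0) →
      (∀ i j, i < j → E.betaCoeff δ i j = 0) ∧
      ((∀ b ∈ D.U, D.v b 0 = 0) →
        (∀ i j, 0 < j → E.nu.comp (E.betaCoeff δ i j) = 0) ∧
        (S.carrier = ∅ → ∀ g μ, E.IsNormalizedPair δ g μ →
          (∀ I j k, multSum I ≤ j → (I, j) ≠ (0, 0) → E.coef δ g μ I j k = 0) ∧
          (∀ I j, multSum I ≤ j → E.coef δ g μ I j 0 = 0) ∧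
          (∀ I j k, multSum I < j → E.coef δ g μ I j k = 0)))) ∧
    -- vanishing of `c_{I,j,0}` for `#(I) < 2`
    ((∀ x ∈ D.V, D.v 0 x = 0) → (∀ b ∈ D.U, D.v b 0 = 0) →
      (∀ i j, (i, j) ≠ (0, 0) → E.nu (E.betaCoeff δ i j (E.h δ)) = 0) ∧
      (S.carrier = ∅ → ∀ g μ, E.IsNormalizedPair δ g μ →
        ∀ I j, multCard I < 2 → E.coef δ g μ I j 0 = 0)) ∧
    -- the case `δ = 0`
    (δ = 0 → ∀ g μ, E.IsNormalizedPair δ g μ →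
      (∀ i, 0 < i → E.betaCoeff δ i 0 g = 0 ∧ E.betaCoeff δ i 0 (E.h δ) = 0) ∧
      (∀ I k, I ≠ 0 → E.coef δ g μ I 0 k = 0)) := by
  
  refine ⟨fun hS => ?_, fun h0 => ⟨fun i j => E.betaCoeff_eq_zero_of_lt δ h0, fun h0' =>
    ⟨fun i j => E.nu_comp_betaCoeff δ h0' i, fun hS g μ hgμ => ⟨fun I j k hj hIj =>
      E.coef_eq_zero_of_multSum_le hΘ hS h0 h0' hgμ k hj hIj, fun I j hj => ?_,
      fun I j k hj => E.coef_eq_zero_of_multSum_le hΘ hS h0 h0' hgμ k hj.le ?_⟩⟩⟩,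
    fun h0 h0' => ⟨fun i j => E.nu_betaCoeff_h δ h0 h0', fun hS g μ hgμ I j hI =>
      E.coef_eq_zero_of_multCard_lt_two hΘ hS h0 h0' hgμ j hI⟩, ?_⟩
  · have hn := E.nu_h_ne_zero δ
    have hc : E.cConst (E.h δ) E.nu = 1 / E.nu (E.h δ) := rfl
    refine ⟨E.isFixedPair_h_nu_of_isEmpty hS, E.exists_isNormalizedPair_of_isEmpty hS,
      fun g μ hgμ => ⟨_, _, hn, hn, E.smul_eq_of_isNormalizedPair_of_isEmpty hS hgμ⟩,
      E.alphaOp_of_isEmpty hS, E.alphaSeries_of_isEmpty hΘ hS, E.L₁_of_isEmpty hS,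
      E.Q₁_of_isEmpty hS, hn, hc.trans (E.cTilde_of_isEmpty hS).symm, E.cTilde_of_isEmpty hS,
      hc ▸ E.L_of_isEmpty hS, E.R_of_isEmpty hS, E.Q_of_isEmpty hS,
      E.coeff_xiSeries_of_isEmpty hS hΘ, E.exists_forall_hasSum_Xi hS hΘ⟩
  -- The pair `(∅, 0)` escapes the general vanishing result; for `k = 0` it is the constant
  -- coefficient, which is zero because `Δ` has no constant term.
  · by_cases hIj : (I, j) = (0, 0)
    · obtain ⟨rfl, rfl⟩ := Prod.mk.inj hIj
      exact E.coef_zero_zero_zero g μ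
    · exact E.coef_eq_zero_of_multSum_le hΘ hS h0 h0' hgμ 0 hj hIj
  · rintro h
    obtain ⟨rfl, rfl⟩ := Prod.mk.inj h
    exact absurd hj (Nat.not_lt_zero _)
  · rintro rfl g μ hgμ
    have hg := E.eq_h_of_isNormalizedPair_zero hδ hgμ
    exact ⟨fun i hi => ⟨by rw [hg, E.betaCoeff_zero_apply_h hi], E.betaCoeff_zero_apply_h hi⟩,
      fun I k => E.coef_zero_eq_zero hδ hgμ k⟩
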